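/- Let $n\ge 2$, $\Lambda=\bigoplus_{i=1}^n\mathbb{Z}\epsilon_i$ with the form $\langle\epsilon_i,\epsilon_j\rangle=\delta_{ij}$, extended to $\Lambda\oplus\frac12\mathbb{Z}\delta$ with $\delta$ in the radical. Let $$S=\{\pm\epsilon_i+\tfrac m2\delta,\ \pm2\epsilon_i+m\delta\ (1\le i\le n),\ \pm\epsilon_i\pm\epsilon_j+m\delta\ (i<j)\ :\ m\in\mathbb{Z}\}$$ be the affine root system of type $C^\vee C_n$, with reflections $s_\beta(g)=g-\langle g,\beta^\vee\rangle\beta$, $\beta^\vee=2\beta/\langle\beta,\beta\rangle$, generating the affine Weyl group $\mathcal W$. Let $R=\{\beta\in S: 2\beta\notin S\}$, with basis $a_0=\delta-2\epsilon_1$, $a_i=\epsilon_i-\epsilon_{i+1}$ ($0<i<n$), $a_n=2\epsilon_n$, and positive roots $R^+=\Sigma^+\cup\{\alpha+m\delta\in R: \alpha\in\Lambda,\ m>0\}$, where $\Sigma^+=\{2\epsilon_i\}\cup\{\epsilon_i\pm\epsilon_j: i<j\}$. Let $s_i=s_{a_i}$. Let $0<q<1$ with a fixed square root $q^{1/2}$,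 and let $\mathbf t=(t_\beta)_{\beta\in S}$ be a $\mathcal W$-invariant map $S\to\mathbb{C}\setminus\{0\}$; put $t_f=1$ for $f\notin S$, $t_i=t_{a_i}$, $t_0^\vee=t_{a_0/2}$, $t_n^\vee=t_{a_n/2}$. Assume that the common value $t$ of $t_1,\dots,t_{n-1}$ satisfies $0<t<1$, and that the four numbers $t_0t_0^\vee q^{1/2}$, $-t_0(t_0^\vee)^{-1}q^{1/2}$, $t_nt_n^\vee$, $-t_n(t_n^\vee)^{-1}$ have modulus less than one. Let $\mathcal A=\mathbb{C}[x_1^{\pm1},\dots,x_n^{\pm1}]$ with monomials $x^\lambda$ ($\lambda\in\Lambda$), let $x^{\lambda+c\delta}=q^cx^\lambda$ for $c\in\frac12\mathbb{Z}$, and let $s_\beta$ act linearly on $\mathcal A$ by $x^\lambda\mapsto x^{s_\beta\lambda}$. For $\beta\in R$ let $$v_\beta(x)=\frac{(1-t_\beta t_{\beta/2}x^{\beta/2})(1+t_\beta t_{\beta/2}^{-1}x^{\beta/2})}{1-x^\beta},$$ read as $(1-t_\beta^2x^\beta)/(1-x^\beta)$ if $\beta/2\notin S$. Let $T_i=t_i+t_i^{-1}v_{a_i}(x)(s_i-\mathrm{id})\in\mathrm{End}_{\mathbb{C}}(\mathcal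 A)$ for $0\le i\le n$. The double affine Hecke algebra $\mathcal H=\mathcal H(S;\mathbf t;q)$ is the subalgebra of $\mathrm{End}_{\mathbb{C}}(\mathcal A)$ generated by $T_0,\dots,T_n$ and all multiplication operators by elements of $\mathcal A$; $z_j\in\mathcal H$ is multiplication by $x_j$. Let $\mathcal H'=\mathcal H(S;\mathbf t^{-1};q^{-1})$ (with square root $(q^{1/2})^{-1}$ of $q^{-1}$), and write $T_i',z_j'$ for its elements $T_i,z_j$. Let $\Delta(x)=\prod_{\beta\in R^+}v_\beta(x)^{-1}$ and $$\langle f,g\rangle=\frac1{(2\pi i)^n}\int_{\mathbb{T}^n}f(x)\,g(x^{-1})\,\Delta(x)\,\frac{dx_1}{x_1}\cdots\frac{dx_n}{x_n},\qquad f,g\in\mathcal A,$$ where $\mathbb{T}$ is the positively oriented unit circle and $x^{-1}=(x_1^{-1},\dots,x_n^{-1})$. Then the product $\Delta(x)$ converges unconditionally for every $x\in\mathbb{T}^n$ and the integral defining $\langle f,g\rangle$ is absolutely convergent for all $f,g\in\mathcal A$. There is a unique anti-algebra isomorphism $\ddagger:\mathcal H\to\mathcal H'$ with $T_i^\ddagger=(T_i')^{-1}$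 for $0\le i\le n$ and $z_j^\ddagger=(z_j')^{-1}$ for $1\le j\le n$, and $$\langle X(f),g\rangle=\langle f,X^\ddagger(g)\rangle\qquad\text{for all }X\in\mathcal H,\ f,g\in\mathcal A.$$ -/

import Mathlib

noncomputable section

namespace Koornwinder

/-! ### The affine root system of type `C^∨C_n` -/

/-- The lattice `Λ ⊕ ½ℤδ`, with `Λ = ℤε₁ ⊕ ⋯ ⊕ ℤεₙ`. The pair `(lam, m)` stands for `lam + (m/2)δ`;
the index `k : Fin n` stands for the basis vector `ε_{k+1}`. All roots lie in this lattice. -/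
abbrev AffWeight (n : ℕ) : Type := (Fin n → ℤ) × ℤ

variable {n : ℕ}

/-- The basis vector `ε_{i+1}` of `Λ`. -/
def eps (i : Fin n) : Fin n → ℤ := Pi.single i 1

/-- The positive semi-definite form, with `δ` in its radical. -/
def form (f g : AffWeight n) : ℤ := ∑ k, f.1 k * g.1 k

/-- The affine root system `S` of type `C^∨C_n`: `±ε_i + (m/2)δ`, `±2ε_i + mδ` and
`±ε_i ± ε_j + mδ` with `i < j`, where `m` runs over the integers. -/
def rootSystem (n : ℕ) : Set (AffWeight n) :=
  {β | (∃ (i : Fin n) (s : ℤˣ) (m : ℤ), β = ((s : ℤ) • eps i, m)) ∨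
    (∃ (i : Fin n) (s : ℤˣ) (m : ℤ), β = ((2 * s : ℤ) • eps i, 2 * m)) ∨
    (∃ (i j : Fin n) (s s' : ℤˣ) (m : ℤ), i < j ∧
      β = ((s : ℤ) • eps i + (s' : ℤ) • eps j, 2 * m))}

/-- `⟨g, β^∨⟩ = 2⟨g, β⟩ / ⟨β, β⟩`. The division is exact for `β ∈ S`, see `pairing_mul_form`. -/
def pairing (g β : AffWeight n) : ℤ := 2 * form g β / form β β

/-- The reflection `s_β(g) = g - ⟨g, β^∨⟩ β`. -/
def reflect (β g : AffWeight n) : AffWeight n := g - pairing g β • β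

theorem pairing_mul_form (g β : AffWeight n) (hβ : β ∈ rootSystem n) :
    pairing g β * form β β = 2 * form g β := by
  apply Int.ediv_mul_cancel
  rcases hβ with ⟨i, s, m, rfl⟩ | ⟨i, s, m, rfl⟩ | ⟨i, j, s, s', m, hij, rfl⟩
  · rcases Int.units_eq_one_or s with rfl | rfl <;> simp [form, eps, Pi.single_apply]
  · rcases Int.units_eq_one_or s with rfl | rfl
    · simp [form, eps, Pi.single_apply]; exact ⟨g.1 i, by ring⟩
    · simp [form, eps, Pi.single_apply]; exact ⟨g.1 i, by ring⟩
  · have h1 : i ≠ j := hij.ne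
    have key : form ((s : ℤ) • eps i + (s' : ℤ) • eps j, 2 * m)
        ((s : ℤ) • eps i + (s' : ℤ) • eps j, 2 * m) = 2 := by
      rcases Int.units_eq_one_or s with rfl | rfl <;>
      rcases Int.units_eq_one_or s' with rfl | rfl <;>
      simp [form, eps, Pi.single_apply, add_mul, Finset.sum_add_distrib, h1, h1.symm]
    rw [key]
    exact dvd_mul_right _ _

/-- The inmultiplyable roots `R` of `S`. -/
def redRoots (n : ℕ) : Set (AffWeight n) := {β | β ∈ rootSystem n ∧ (2 : ℤ) • β ∉ rootSystem n}

/-- The positive roots `Σ⁺` of the gradient root system of type `C_n`: `2ε_i`, and `ε_i ± ε_j`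
with `i < j`. -/
def posGradRoots (n : ℕ) : Set (AffWeight n) :=
  {β | (∃ i : Fin n, β = ((2 : ℤ) • eps i, 0)) ∨
    (∃ (i j : Fin n) (s : ℤˣ), i < j ∧ β = (eps i + (s : ℤ) • eps j, 0))}

/-- The positive roots `R⁺ = Σ⁺ ∪ {β ∈ R | β(0) > 0}`. -/
def posRoots (n : ℕ) : Set (AffWeight n) := posGradRoots n ∪ {β | β ∈ redRoots n ∧ 0 < β.2}

/-- The simple roots of `R`: `a_0 = δ - 2ε_1`, `a_i = ε_i - ε_{i+1}` for `0 < i < n`,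
and `a_n = 2ε_n`. -/
def simpleRoot (n : ℕ) (i : Fin (n + 1)) : AffWeight n :=
  if i = 0 then (fun k => if (k : ℕ) = 0 then -2 else 0, 2)
  else if i = Fin.last n then (fun k => if (k : ℕ) + 1 = n then 2 else 0, 0)
  else (fun k => if (k : ℕ) + 1 = i then 1 else if (k : ℕ) = i then -1 else 0, 0)

/-- Half of `β`, for `β` divisible by two in the lattice. -/
def half (β : AffWeight n) : AffWeight n := (fun k => β.1 k / 2, β.2 / 2)

/-- A multiplicity function on `S`: nonzero complex values, invariant under the affine Weyl group,
which is generated by the reflections in the roots; extended by `1` outside `S`. -/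
structure Multiplicity (n : ℕ) where
  val : AffWeight n → ℂˣ
  invariant : ∀ β ∈ rootSystem n, ∀ γ ∈ rootSystem n, val (reflect β γ) = val γ
  eq_one : ∀ γ, γ ∉ rootSystem n → val γ = 1

/-- The inverse multiplicity function. -/
def Multiplicity.inverse (t : Multiplicity n) : Multiplicity n where
  val γ := (t.val γ)⁻¹
  invariant β hβ γ hγ := by rw [t.invariant β hβ γ hγ]
  eq_one γ hγ := by rw [t.eq_one γ hγ, inv_one]

/-! ### Laurent polynomials

Throughout, `r` is the chosen square root of `q`. -/

/-- The group algebra of `Λ`: Laurent polynomials in `x_1, …, x_n`. -/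
abbrev Laurent (n : ℕ) : Type := AddMonoidAlgebra ℂ (Fin n → ℤ)

/-- `x^{lam + (m/2)δ} = r^m x^lam`. -/
def mono (r : ℂˣ) (β : AffWeight n) : Laurent n :=
  AddMonoidAlgebra.single β.1 ((r ^ β.2 : ℂˣ) : ℂ)

/-- The linear endomorphism of the Laurent polynomials with prescribed values at the monomials. -/
def onMonomials (F : (Fin n → ℤ) → Laurent n) : Laurent n →ₗ[ℂ] Laurent n :=
  (AddMonoidAlgebra.basis (Fin n → ℤ) ℂ).constr ℂ F

/-- The action of the reflection `s_β` on Laurent polynomials: `x^mu ↦ x^{s_β mu}`. -/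
def reflAct (r : ℂˣ) (β : AffWeight n) : Laurent n →ₗ[ℂ] Laurent n :=
  onMonomials fun mu => mono r (reflect β (mu, 0))

/-- The action of the longest element `σ = -1` of the finite Weyl group: `x ↦ x⁻¹`. -/
def longestAct : Laurent n →ₗ[ℂ] Laurent n :=
  onMonomials fun mu => AddMonoidAlgebra.single (-mu) 1

/-- The value of a Laurent polynomial at `x`. -/
def eval (f : Laurent n) (x : Fin n → ℂ) : ℂ :=
  f.coeff.sum fun mu c => c * ∏ i, x i ^ mu i

/-- The quotient `(1 - x^{-kβ}) / (1 - x^β)` as a Laurent polynomial. -/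
def geom (r : ℂˣ) (β : AffWeight n) (k : ℤ) : Laurent n :=
  if 0 ≤ k then -∑ j ∈ Finset.range k.toNat, mono r (-(((j : ℤ) + 1) • β))
  else ∑ j ∈ Finset.range (-k).toNat, mono r ((j : ℤ) • β)

/-- The divided difference `f ↦ (f - s_β f) / (1 - x^β)`, see `one_sub_mono_mul_dividedDiff`. -/
def dividedDiff (r : ℂˣ) (β : AffWeight n) : Laurent n →ₗ[ℂ] Laurent n :=
  onMonomials fun mu => AddMonoidAlgebra.single mu 1 * geom r β (pairing (mu, 0) β)

theorem mono_add (r : ℂˣ) (β γ : AffWeight n) : mono r (β + γ) = mono r β * mono r γ := by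
  simp [mono, AddMonoidAlgebra.single_mul_single, zpow_add]

theorem mono_zero (r : ℂˣ) : mono r (0 : AffWeight n) = 1 := by
  simp [mono, AddMonoidAlgebra.one_def]

theorem one_sub_mono_mul_geom (r : ℂˣ) (β : AffWeight n) (k : ℤ) :
    (1 - mono r β) * geom r β k = 1 - mono r (-(k • β)) := by
  have hneg : ∀ N : ℕ, (1 - mono r β) *
      (-∑ j ∈ Finset.range N, mono r (-(((j : ℤ) + 1) • β))) = 1 - mono r (-((N : ℤ) • β)) := by
    intro N
    induction N with
    | zero => simp [mono_zero]
    | succ N ih =>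
      rw [Finset.sum_range_succ, neg_add, mul_add, ih]
      have h1 : mono r β * mono r (-(((N : ℤ) + 1) • β)) = mono r (-((N : ℤ) • β)) := by
        rw [← mono_add]; congr 1; module
      push_cast
      linear_combination h1
  have hpos : ∀ N : ℕ, (1 - mono r β) *
      (∑ j ∈ Finset.range N, mono r ((j : ℤ) • β)) = 1 - mono r ((N : ℤ) • β) := by
    intro N
    induction N with
    | zero => simp [mono_zero]
    | succ N ih =>
      rw [Finset.sum_range_succ, mul_add, ih]
      have h1 : mono r β * mono r ((N : ℤ) • β) = mono r (((N : ℤ) + 1) • β) := by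
        rw [← mono_add]; congr 1; module
      push_cast
      linear_combination -h1
  unfold geom
  split_ifs with h
  · rw [hneg, Int.toNat_of_nonneg h]
  · rw [hpos, Int.toNat_of_nonneg (by omega), neg_smul]

theorem onMonomials_single (F : (Fin n → ℤ) → Laurent n) (mu : Fin n → ℤ) :
    onMonomials F (AddMonoidAlgebra.single mu 1) = F mu := by
  have h := (AddMonoidAlgebra.basis (Fin n → ℤ) ℂ).constr_basis ℂ F mu
  simpa [onMonomials] using h

theorem one_sub_mono_mul_dividedDiff (r : ℂˣ) (β : AffWeight n) (f : Laurent n) :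
    (1 - mono r β) * dividedDiff r β f = f - reflAct r β f := by
  have h : (LinearMap.mulLeft ℂ (1 - mono r β)) ∘ₗ dividedDiff r β
      = LinearMap.id - reflAct r β := by
    refine (AddMonoidAlgebra.basis (Fin n → ℤ) ℂ).ext fun mu => ?_
    simp only [AddMonoidAlgebra.basis_apply, LinearMap.comp_apply, LinearMap.sub_apply,
      LinearMap.id_apply, LinearMap.mulLeft_apply, dividedDiff, reflAct, onMonomials_single]
    rw [mul_left_comm, one_sub_mono_mul_geom, mul_sub, mul_one]
    congr 1
    have h2 : (AddMonoidAlgebra.single mu 1 : Laurent n) = mono r (mu, 0) := by simp [mono]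
    rw [h2, ← mono_add, reflect, sub_eq_add_neg]
  exact LinearMap.congr_fun h f

/-! ### The double affine Hecke algebra -/

/-- The numerator `(1 - t_β t_{β/2} x^{β/2})(1 + t_β t_{β/2}⁻¹ x^{β/2})` of `v_β`, whose denominator
is `1 - x^β`. If `β/2` is not in the lattice, then `t_{β/2} = 1` and the product is
`1 - t_β² x^β`. -/
def vNum (t : Multiplicity n) (r : ℂˣ) (β : AffWeight n) : Laurent n :=
  if (2 : ℤ) • half β = β then
    (1 - ((t.val β * t.val (half β) : ℂˣ) : ℂ) • mono r (half β)) *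
      (1 + ((t.val β * (t.val (half β))⁻¹ : ℂˣ) : ℂ) • mono r (half β))
  else 1 - ((t.val β ^ 2 : ℂˣ) : ℂ) • mono r β

/-- The parameter `t_i = t_{a_i}`. -/
def tpar (t : Multiplicity n) (i : Fin (n + 1)) : ℂˣ := t.val (simpleRoot n i)

/-- The parameter `t_i^∨ = t_{a_i^∨}` for `i = 0` and `i = n`, where `a_i^∨ = a_i / 2`. -/
def tparDual (t : Multiplicity n) (i : Fin (n + 1)) : ℂˣ := t.val (half (simpleRoot n i))

/-- The difference-reflection operator `T_i = t_i + t_i⁻¹ v_{a_i}(x) (s_i - id)`, where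
`v_{a_i}(x) (s_i - id) = -vNum(a_i) · (id - s_i) / (1 - x^{a_i})`. -/
def T (t : Multiplicity n) (r : ℂˣ) (i : Fin (n + 1)) : Module.End ℂ (Laurent n) :=
  (tpar t i : ℂ) • LinearMap.id -
    (((tpar t i)⁻¹ : ℂˣ) : ℂ) •
      (LinearMap.mulLeft ℂ (vNum t r (simpleRoot n i)) ∘ₗ dividedDiff r (simpleRoot n i))

/-- The defining formula of `T_i`, with the denominator `1 - x^{a_i}` cleared. -/
theorem one_sub_mono_mul_T (t : Multiplicity n) (r : ℂˣ) (i : Fin (n + 1)) (f : Laurent n) :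
    (1 - mono r (simpleRoot n i)) * T t r i f =
      (1 - mono r (simpleRoot n i)) * ((tpar t i : ℂ) • f) +
        (((tpar t i)⁻¹ : ℂˣ) : ℂ) •
          (vNum t r (simpleRoot n i) * (reflAct r (simpleRoot n i) f - f)) := by
  have h := one_sub_mono_mul_dividedDiff r (simpleRoot n i) f
  have h2 : reflAct r (simpleRoot n i) f - f
      = -((1 - mono r (simpleRoot n i)) * dividedDiff r (simpleRoot n i) f) := by rw [h]; ring
  rw [h2]
  simp only [T, LinearMap.sub_apply, LinearMap.smul_apply, LinearMap.id_apply,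
    LinearMap.comp_apply, LinearMap.mulLeft_apply]
  simp only [mul_sub, Algebra.smul_def]
  ring

/-- The double affine Hecke algebra: the algebra of endomorphisms of the Laurent polynomials
generated by `T_0, …, T_n` and by all multiplication operators. -/
def DAHA (t : Multiplicity n) (r : ℂˣ) : Subalgebra ℂ (Module.End ℂ (Laurent n)) :=
  Algebra.adjoin ℂ (Set.range (T t r) ∪ Set.range (LinearMap.mulLeft ℂ : Laurent n → _))

/-- The element `T_i` of the double affine Hecke algebra. -/
def genT (t : Multiplicity n) (r : ℂˣ) (i : Fin (n + 1)) : DAHA t r :=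
  ⟨T t r i, Algebra.subset_adjoin (Or.inl ⟨i, rfl⟩)⟩

/-- The element `z_j` of the double affine Hecke algebra, multiplication by `x_j`. -/
def genZ (t : Multiplicity n) (r : ℂˣ) (j : Fin n) : DAHA t r :=
  ⟨LinearMap.mulLeft ℂ (AddMonoidAlgebra.single (eps j) 1), Algebra.subset_adjoin (Or.inr ⟨_, rfl⟩)⟩

/-- `φ` is an anti-algebra isomorphism from the algebra with parameters `(t, q)` to the one with
inverse parameters that maps `T_i` to the two-sided inverse of `T_i'` and `z_j` to the two-sided
inverse of `z_j'`. -/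
def IsDoubleDagger (t : Multiplicity n) (r : ℂˣ)
    (φ : DAHA t r ≃ₐ[ℂ] (DAHA t.inverse r⁻¹)ᵐᵒᵖ) : Prop :=
  (∀ i : Fin (n + 1), (φ (genT t r i)).unop * genT t.inverse r⁻¹ i = 1 ∧
      genT t.inverse r⁻¹ i * (φ (genT t r i)).unop = 1) ∧
  (∀ j : Fin n, (φ (genZ t r j)).unop * genZ t.inverse r⁻¹ j = 1 ∧
      genZ t.inverse r⁻¹ j * (φ (genZ t r j)).unop = 1)

/-! ### The pairing -/

/-- The value of the rational function `v_β` at `x`. -/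
def v (t : Multiplicity n) (r : ℂˣ) (β : AffWeight n) (x : Fin n → ℂ) : ℂ :=
  eval (vNum t r β) x / eval (1 - mono r β) x

/-- The weight function `Δ(x) = ∏_{β ∈ R⁺} 1 / v_β(x)`. -/
def Delta (t : Multiplicity n) (r : ℂˣ) (x : Fin n → ℂ) : ℂ :=
  ∏' β : posRoots n, (v t r β x)⁻¹

/-- The integrand `f(x) (σg)(x) Δ(x) / (x_1 ⋯ x_n)`. -/
def integrand (t : Multiplicity n) (r : ℂˣ) (f g : Laurent n) (x : Fin n → ℂ) : ℂ :=
  eval f x * eval (longestAct g) x * Delta t r x * ∏ i, (x i)⁻¹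

/-- The pairing `⟨f, g⟩ = (2πi)⁻ⁿ ∫_{𝕋ⁿ} f(x) (σg)(x) Δ(x) dx/x` over the unit torus. -/
def torusPairing (t : Multiplicity n) (r : ℂˣ) (f g : Laurent n) : ℂ :=
  1 / (2 * (Real.pi : ℂ) * Complex.I) ^ n *
    torusIntegral (integrand t r f g) (0 : Fin n → ℂ) (fun _ => (1 : ℝ))

end Koornwinder

end

noncomputable section

namespace Koornwinder

open MeasureTheory
open scoped Pointwise

variable {n : ℕ}

/-! ### Reflections -/

/-! The pairing is, up to a constant, `(f, g) ↦ ∫ f · (σg) · Δ` with `σ : x ↦ x⁻¹`, so everything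
reduces to the symmetric form `weightForm`, `(f, h) ↦ ∫ f h Δ`. Three facts carry the proof.

Each `T_i` is self-adjoint for this form (`weightForm_T`). Write `Δ = v_{a_i}⁻¹ · c_i`. The
reflection `s_i` permutes the positive roots other than `a_i`, so `c_i` is `s_i`-invariant
(`cofactor_reflPoint`). Then `T_i f · Δ = (t_i v_{a_i}⁻¹ f + t_i⁻¹ (s_i f - f)) c_i`, hence `((T_i
f) g - f (T_i g)) Δ` is `t_i⁻¹` times the difference between `f · (s_i g) · c_i` composed with `s_i`
and that function itself. Its integral vanishes once integration is invariant under `s_i`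
(`haarIntegral_comp_reflPoint`). For `i > 0` this is a permutation or inversion of angles. For `i =
0` the substitution is `x_1 ↦ q / x_1`, and Cauchy's theorem moves the contour across the annulus `q
≤ |x_1| ≤ 1`, on which `c_0` is continuous up to the boundary and holomorphic inside by the
parameter conditions (`exists_factor_bound`).

Conjugation by `σ` turns `T_i` into `T_i' + t_i - t_i⁻¹` (`longestHom_T`), which is `(T_i')⁻¹` by
the quadratic relation (`T_mul_T_sub`). So the adjoint of `T_i` for the pairing is `(T_i')⁻¹`, while
the adjoint of multiplication by `p` is multiplication by `σp`.

The form is nondegenerate (`eq_zero_of_weightForm_eq_zero`): if `g` is orthogonal to all monomials,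
the Fourier coefficients of the continuous function `gΔ` vanish, and `Δ` is nonzero off the zeros of
finitely many binomials. Adjoints are therefore unique in both directions, so "take the adjoint" is
itself the required anti-isomorphism (`exists_adjointEquiv`), and no presentation of the Hecke
algebra is needed. Its uniqueness follows from its values on generators (`IsDoubleDagger.unique`).
-/

theorem form_comm (f g : AffWeight n) : form f g = form g f := by
  simp only [form, mul_comm]

theorem form_add_left (f g h : AffWeight n) : form (f + g) h = form f h + form g h := by
  simp [form, add_mul, Finset.sum_add_distrib]

theorem form_smul_left (c : ℤ) (f g : AffWeight n) : form (c • f) g = c * form f g := by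
  simp [form, Finset.mul_sum, mul_assoc]

theorem form_smul_right (c : ℤ) (f g : AffWeight n) : form f (c • g) = c * form f g := by
  rw [form_comm, form_smul_left, form_comm]

theorem form_neg_left (f g : AffWeight n) : form (-f) g = -form f g := by
  simp [form]

theorem form_sub_left (f g h : AffWeight n) : form (f - g) h = form f h - form g h := by
  rw [sub_eq_add_neg, form_add_left, form_neg_left, sub_eq_add_neg]

theorem form_level (m : ℤ) (g : AffWeight n) : form (0, m) g = 0 := by
  simp [form]

theorem eps_apply (i k : Fin n) : eps i k = if k = i then 1 else 0 := by
  simp [eps, Pi.single_apply]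

/-- A sum of integer squares equal to 1 has exactly one nonzero term. Describing roots by length
makes stability under reflections a consequence of isometry. -/
theorem form_self_eq_one_iff (β : AffWeight n) :
    form β β = 1 ↔ ∃ (i : Fin n) (s : ℤˣ), β.1 = (s : ℤ) • eps i := by
  constructor
  · intro h
    obtain ⟨i, hi⟩ : ∃ i, β.1 i ≠ 0 := by
      by_contra! h0
      simp [form, h0] at h
    have hsum : β.1 i * β.1 i + ∑ k ∈ Finset.univ.erase i, β.1 k * β.1 k = 1 :=
      (Finset.add_sum_erase _ (fun k => β.1 k * β.1 k) (Finset.mem_univ i)).trans h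
    have hpos : 0 < β.1 i * β.1 i := mul_self_pos.mpr hi
    have hnn : 0 ≤ ∑ k ∈ Finset.univ.erase i, β.1 k * β.1 k :=
      Finset.sum_nonneg fun k _ => mul_self_nonneg _
    have h1 : β.1 i * β.1 i = 1 := by omega
    have h2 : ∑ k ∈ Finset.univ.erase i, β.1 k * β.1 k = 0 := by omega
    rw [Finset.sum_eq_zero_iff_of_nonneg fun k _ => mul_self_nonneg _] at h2
    refine ⟨i, Units.mkOfMulEqOne _ _ h1, ?_⟩
    funext k
    by_cases hk : k = i
    · subst hk; simp [eps_apply]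
    · simpa [eps_apply, hk] using h2 k (by simp [hk])
  · rintro ⟨i, s, h⟩
    rcases Int.units_eq_one_or s with rfl | rfl <;> simp [form, h, eps_apply]

theorem form_self_eq_two_iff (β : AffWeight n) :
    form β β = 2 ↔ ∃ (i j : Fin n) (s s' : ℤˣ), i < j ∧
      β.1 = (s : ℤ) • eps i + (s' : ℤ) • eps j := by
  constructor
  · intro h
    obtain ⟨i, hi⟩ : ∃ i, β.1 i ≠ 0 := by
      by_contra! h0
      simp [form, h0] at h
    have hsum : β.1 i * β.1 i + ∑ k ∈ Finset.univ.erase i, β.1 k * β.1 k = 2 :=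
      (Finset.add_sum_erase _ (fun k => β.1 k * β.1 k) (Finset.mem_univ i)).trans h
    have hpos : 0 < β.1 i * β.1 i := mul_self_pos.mpr hi
    have hnn : 0 ≤ ∑ k ∈ Finset.univ.erase i, β.1 k * β.1 k :=
      Finset.sum_nonneg fun k _ => mul_self_nonneg _
    have h1 : β.1 i * β.1 i = 1 := by
      have : β.1 i ≤ 1 := by nlinarith
      have : -1 ≤ β.1 i := by nlinarith
      have : β.1 i = 1 ∨ β.1 i = -1 := by omega
      rcases this with h | h <;> rw [h] <;> norm_num
    -- Deleting the coordinate `i`, which is `±1`, leaves a vector of squared length 1.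
    have h2 : form (Function.update β.1 i 0, 0) (Function.update β.1 i 0, (0 : ℤ)) = 1 := by
      have h3 : ∑ k ∈ Finset.univ.erase i, Function.update β.1 i 0 k * Function.update β.1 i 0 k
          = ∑ k ∈ Finset.univ.erase i, β.1 k * β.1 k :=
        Finset.sum_congr rfl fun k hk => by
          rw [Function.update_of_ne (Finset.ne_of_mem_erase hk)]
      simp only [form]
      rw [← Finset.add_sum_erase Finset.univ
        (fun k => Function.update β.1 i 0 k * Function.update β.1 i 0 k) (Finset.mem_univ i), h3,
        Function.update_self]
      omega
    obtain ⟨j, s', hj⟩ := (form_self_eq_one_iff _).1 h2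
    have hij : i ≠ j := by
      rintro rfl
      have := congrFun hj i
      simp [eps_apply] at this
      exact s'.ne_zero this.symm
    have hβ : β.1 = ((Units.mkOfMulEqOne _ _ h1 : ℤˣ) : ℤ) • eps i + (s' : ℤ) • eps j := by
      funext k
      have hk := congrFun hj k
      by_cases hki : k = i
      · subst hki; simp [eps_apply, hij]
      · simp only [Function.update_of_ne hki] at hk
        simp [hk, eps_apply, hki]
    rcases lt_or_gt_of_ne hij with hlt | hlt
    · exact ⟨i, j, _, s', hlt, hβ⟩
    · exact ⟨j, i, s', _, hlt, by rw [hβ, add_comm]⟩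
  · rintro ⟨i, j, s, s', hij, h⟩
    rcases Int.units_eq_one_or s with rfl | rfl <;>
    rcases Int.units_eq_one_or s' with rfl | rfl <;>
    simp [form, h, eps_apply, add_mul, Finset.sum_add_distrib, hij.ne, hij.ne']

/-- Only lengths, divisibility by two and one parity condition are involved; of these, only the
parity needs an argument when a reflection is applied. -/
theorem mem_rootSystem_iff (β : AffWeight n) :
    β ∈ rootSystem n ↔ form β β = 1 ∨ (∃ γ : AffWeight n, form γ γ = 1 ∧ β = (2 : ℤ) • γ) ∨
      (form β β = 2 ∧ Even β.2) := by
  rw [form_self_eq_one_iff, form_self_eq_two_iff]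
  constructor
  · rintro (⟨i, s, m, rfl⟩ | ⟨i, s, m, rfl⟩ | ⟨i, j, s, s', m, hij, rfl⟩)
    · exact Or.inl ⟨i, s, rfl⟩
    · exact Or.inr (Or.inl ⟨((s : ℤ) • eps i, m), (form_self_eq_one_iff _).2 ⟨i, s, rfl⟩, by
        simp [mul_smul]⟩)
    · exact Or.inr (Or.inr ⟨⟨i, j, s, s', hij, rfl⟩, even_two_mul m⟩)
  · rintro (⟨i, s, h⟩ | ⟨γ, h, rfl⟩ | ⟨⟨i, j, s, s', hij, h⟩, m, hm⟩)
    · exact Or.inl ⟨i, s, β.2, Prod.ext h rfl⟩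
    · obtain ⟨i, s, h⟩ := (form_self_eq_one_iff _).1 h
      exact Or.inr (Or.inl ⟨i, s, γ.2, Prod.ext (by simp [h, mul_smul]) (by simp)⟩)
    · exact Or.inr (Or.inr ⟨i, j, s, s', m, hij, Prod.ext h (by rw [hm]; ring)⟩)

theorem form_self_pos {β : AffWeight n} (hβ : β ∈ rootSystem n) : 0 < form β β := by
  rcases (mem_rootSystem_iff β).1 hβ with h | ⟨γ, h, rfl⟩ | ⟨h, -⟩
  · omega
  · rw [form_smul_left, form_smul_right]; omega
  · omega

/-- Since `pairing` is an integer division, values are computed through the equation with the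
denominator cleared. -/
theorem pairing_eq_of {g β : AffWeight n} (hβ : β ∈ rootSystem n) {k : ℤ}
    (h : k * form β β = 2 * form g β) : pairing g β = k :=
  mul_right_cancel₀ (form_self_pos hβ).ne' ((pairing_mul_form g β hβ).trans h.symm)

theorem pairing_add {β : AffWeight n} (hβ : β ∈ rootSystem n) (g h : AffWeight n) :
    pairing (g + h) β = pairing g β + pairing h β :=
  pairing_eq_of hβ (by
    rw [add_mul, pairing_mul_form g β hβ, pairing_mul_form h β hβ, form_add_left]; ring)

theorem pairing_smul {β : AffWeight n} (hβ : β ∈ rootSystem n) (c : ℤ) (g : AffWeight n) :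
    pairing (c • g) β = c * pairing g β :=
  pairing_eq_of hβ (by rw [mul_assoc, pairing_mul_form g β hβ, form_smul_left]; ring)

theorem pairing_self {β : AffWeight n} (hβ : β ∈ rootSystem n) : pairing β β = 2 :=
  pairing_eq_of hβ rfl

theorem reflect_add {β : AffWeight n} (hβ : β ∈ rootSystem n) (g h : AffWeight n) :
    reflect β (g + h) = reflect β g + reflect β h := by
  simp only [reflect, pairing_add hβ]; module

theorem reflect_smul {β : AffWeight n} (hβ : β ∈ rootSystem n) (c : ℤ) (g : AffWeight n) :
    reflect β (c • g) = c • reflect β g := by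
  simp only [reflect, pairing_smul hβ]; module

theorem reflect_neg {β : AffWeight n} (hβ : β ∈ rootSystem n) (g : AffWeight n) :
    reflect β (-g) = -reflect β g := by
  simpa using reflect_smul hβ (-1) g

theorem reflect_level (β : AffWeight n) (m : ℤ) : reflect β (0, m) = (0, m) := by
  simp [reflect, pairing, form_level]

theorem reflect_self {β : AffWeight n} (hβ : β ∈ rootSystem n) : reflect β β = -β := by
  simp only [reflect, pairing_self hβ]; module

theorem reflect_reflect {β : AffWeight n} (hβ : β ∈ rootSystem n) (g : AffWeight n) :
    reflect β (reflect β g) = g := by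
  have h : reflect β g = g + (-pairing g β) • β := by simp only [reflect]; module
  rw [h, reflect_add hβ, reflect_smul hβ, reflect_self hβ, h]; module

theorem reflect_eq_add_level {β : AffWeight n} (hβ : β ∈ rootSystem n) (lam : Fin n → ℤ) (m : ℤ) :
    reflect β (lam, m) = reflect β (lam, 0) + (0, m) := by
  rw [← reflect_level β m, ← reflect_add hβ]; simp

theorem form_reflect {β : AffWeight n} (hβ : β ∈ rootSystem n) (g : AffWeight n) :
    form (reflect β g) (reflect β g) = form g g := by
  have h := pairing_mul_form g β hβ
  simp only [reflect]
  rw [form_sub_left, form_smul_left, form_comm g, form_comm β, form_sub_left, form_sub_left,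
    form_smul_left, form_smul_left, form_comm β g]
  linear_combination pairing g β * h

/-- This product is the change of the `δ`-component under `s_β`, so the parity condition on roots of
squared length 2 survives. If `β` has squared length 1 the pairing is even; otherwise the level of
`β` is even. -/
theorem even_pairing_mul_level {β : AffWeight n} (hβ : β ∈ rootSystem n) (g : AffWeight n) :
    Even (pairing g β * β.2) := by
  rcases (mem_rootSystem_iff β).1 hβ with h | ⟨γ, h, rfl⟩ | ⟨h, h2⟩
  · rw [pairing_eq_of hβ (k := 2 * form g β) (by rw [h]; ring), mul_assoc]
    exact even_two_mul _
  · exact (even_two_mul γ.2).mul_left _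
  · exact h2.mul_left _

theorem reflect_mem_rootSystem {β γ : AffWeight n} (hβ : β ∈ rootSystem n)
    (hγ : γ ∈ rootSystem n) : reflect β γ ∈ rootSystem n := by
  rw [mem_rootSystem_iff] at hγ ⊢
  rw [form_reflect hβ]
  rcases hγ with h | ⟨γ, h, rfl⟩ | ⟨h, h2⟩
  · exact Or.inl h
  · exact Or.inr (Or.inl ⟨reflect β γ, by rw [form_reflect hβ, h], reflect_smul hβ 2 γ⟩)
  · exact Or.inr (Or.inr ⟨h, h2.sub (even_pairing_mul_level hβ γ)⟩)

theorem reflect_mem_rootSystem_iff {β γ : AffWeight n} (hβ : β ∈ rootSystem n) :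
    reflect β γ ∈ rootSystem n ↔ γ ∈ rootSystem n :=
  ⟨fun h => reflect_reflect hβ γ ▸ reflect_mem_rootSystem hβ h, reflect_mem_rootSystem hβ⟩

/-- Invariance extends to all weights because `t` is 1 off the stable set `S`; thus `t_{β/2}` needs
no case distinction on whether `β/2` is a root. -/
theorem val_reflect (t : Multiplicity n) {β : AffWeight n} (hβ : β ∈ rootSystem n)
    (γ : AffWeight n) : t.val (reflect β γ) = t.val γ := by
  by_cases hγ : γ ∈ rootSystem n
  · exact t.invariant β hβ γ hγ
  · rw [t.eq_one γ hγ, t.eq_one _ (fun h => hγ ((reflect_mem_rootSystem_iff hβ).1 h))]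

theorem half_two_smul (γ : AffWeight n) : half ((2 : ℤ) • γ) = γ := by
  ext <;> simp [half]

theorem two_smul_half_iff (β : AffWeight n) :
    (2 : ℤ) • half β = β ↔ ∃ γ : AffWeight n, β = (2 : ℤ) • γ :=
  ⟨fun h => ⟨half β, h.symm⟩, by rintro ⟨γ, rfl⟩; rw [half_two_smul]⟩

theorem two_smul_injective {β γ : AffWeight n} (h : (2 : ℤ) • β = (2 : ℤ) • γ) : β = γ := by
  rw [← half_two_smul β, h, half_two_smul]

theorem two_smul_half_reflect_iff {β : AffWeight n} (hβ : β ∈ rootSystem n) (γ : AffWeight n) :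
    (2 : ℤ) • half (reflect β γ) = reflect β γ ↔ (2 : ℤ) • half γ = γ := by
  simp only [two_smul_half_iff]
  constructor
  · rintro ⟨δ, h⟩
    exact ⟨reflect β δ, by rw [← reflect_smul hβ, ← h, reflect_reflect hβ]⟩
  · rintro ⟨δ, rfl⟩
    exact ⟨reflect β δ, reflect_smul hβ 2 δ⟩

theorem half_reflect {β : AffWeight n} (hβ : β ∈ rootSystem n) {γ : AffWeight n}
    (h : (2 : ℤ) • half γ = γ) : half (reflect β γ) = reflect β (half γ) := by
  conv_lhs => rw [← h, reflect_smul hβ, half_two_smul]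

theorem simpleRoot_mem (hn : 2 ≤ n) (i : Fin (n + 1)) : simpleRoot n i ∈ rootSystem n := by
  unfold simpleRoot
  split_ifs with h0 hl
  · refine Or.inr (Or.inl ⟨⟨0, by omega⟩, -1, 1, ?_⟩)
    ext k
    · simp [eps_apply, Fin.ext_iff]
    · simp
  · refine Or.inr (Or.inl ⟨⟨n - 1, by omega⟩, 1, 0, ?_⟩)
    ext k
    · have : (k : ℕ) + 1 = n ↔ (k : ℕ) = n - 1 := by omega
      simp [eps_apply, Fin.ext_iff, this]
    · simp
  · have hi0 : (i : ℕ) ≠ 0 := fun h => h0 (Fin.ext h)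
    have hin : (i : ℕ) ≠ n := fun h => hl (Fin.ext h)
    refine Or.inr (Or.inr ⟨⟨i - 1, by omega⟩, ⟨i, by omega⟩, 1, -1, 0, by
      rw [Fin.lt_def]; simp only; omega, ?_⟩)
    ext k
    · have : (k : ℕ) + 1 = i ↔ (k : ℕ) = i - 1 := by omega
      simp only [this, Pi.add_apply, Pi.smul_apply, eps_apply, Fin.ext_iff]
      split_ifs <;> first | omega | simp
    · simp

/-! ### Evaluation and substitution of Laurent polynomials -/

theorem eval_single (mu : Fin n → ℤ) (c : ℂ) (x : Fin n → ℂ) :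
    eval (AddMonoidAlgebra.single mu c) x = c * ∏ i, x i ^ mu i := by
  simp [eval, Finsupp.sum_single_index]

/-- Evaluation at a point with nonzero coordinates is an algebra homomorphism. -/
def evalHom (x : Fin n → ℂ) (hx : ∀ i, x i ≠ 0) : Laurent n →ₐ[ℂ] ℂ :=
  AddMonoidAlgebra.lift ℂ ℂ (Fin n → ℤ)
    { toFun := fun mu => ∏ i, x i ^ (Multiplicative.toAdd mu i)
      map_one' := by simp
      map_mul' := fun a b => by
        simp [← Finset.prod_mul_distrib, zpow_add₀ (hx _)] }

theorem evalHom_apply (x : Fin n → ℂ) (hx : ∀ i, x i ≠ 0) (f : Laurent n) :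
    evalHom x hx f = eval f x := by
  simp only [evalHom, AddMonoidAlgebra.lift_apply, eval, smul_eq_mul]
  rfl

theorem eval_mono (r : ℂˣ) (β : AffWeight n) (x : Fin n → ℂ) :
    eval (mono r β) x = (r : ℂ) ^ β.2 * ∏ i, x i ^ β.1 i := by
  rw [mono, eval_single]; simp

/-- The algebra endomorphism underlying the action of a reflection. -/
def reflHom (r : ℂˣ) {β : AffWeight n} (hβ : β ∈ rootSystem n) : Laurent n →ₐ[ℂ] Laurent n :=
  AddMonoidAlgebra.lift ℂ (Laurent n) (Fin n → ℤ)
    { toFun := fun mu => mono r (reflect β (Multiplicative.toAdd mu, 0))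
      map_one' := by
        rw [toAdd_one]
        exact (congrArg (mono r) (reflect_level β 0)).trans (mono_zero r)
      map_mul' := fun a b => by
        rw [← mono_add, ← reflect_add hβ]; simp }

theorem reflHom_apply (r : ℂˣ) {β : AffWeight n} (hβ : β ∈ rootSystem n) (f : Laurent n) :
    reflHom r hβ f = reflAct r β f := by
  have h : (reflHom r hβ).toLinearMap = reflAct r β := by
    refine (AddMonoidAlgebra.basis (Fin n → ℤ) ℂ).ext fun mu => ?_
    simp [reflAct, onMonomials_single, reflHom]
  exact LinearMap.congr_fun h f

theorem single_eq_smul_mono (r : ℂˣ) (mu : Fin n → ℤ) (c : ℂ) :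
    (AddMonoidAlgebra.single mu c : Laurent n) = c • mono r (mu, 0) := by
  simp [mono]

theorem mono_level (r : ℂˣ) (lam : Fin n → ℤ) (m : ℤ) :
    mono r (lam, m) = ((r ^ m : ℂˣ) : ℂ) • mono r (lam, 0) := by
  simp [mono]

theorem reflHom_mono (r : ℂˣ) {β : AffWeight n} (hβ : β ∈ rootSystem n) (γ : AffWeight n) :
    reflHom r hβ (mono r γ) = mono r (reflect β γ) := by
  obtain ⟨lam, m⟩ := γ
  rw [reflect_eq_add_level hβ, mono_add, mono_level r lam m, map_smul]
  have h1 : reflHom r hβ (mono r (lam, 0)) = mono r (reflect β (lam, 0)) := by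
    simp [reflHom, mono]
  have h2 : mono r ((0, m) : AffWeight n) = ((r ^ m : ℂˣ) : ℂ) • 1 := by
    rw [mono_level]; congr 1
  rw [h1, h2, mul_smul_comm, mul_one]

theorem reflHom_reflHom (r : ℂˣ) {β : AffWeight n} (hβ : β ∈ rootSystem n) (f : Laurent n) :
    reflHom r hβ (reflHom r hβ f) = f := by
  have h : (reflHom r hβ).toLinearMap ∘ₗ (reflHom r hβ).toLinearMap = LinearMap.id := by
    refine (AddMonoidAlgebra.basis (Fin n → ℤ) ℂ).ext fun mu => ?_
    simp only [AddMonoidAlgebra.basis_apply, LinearMap.comp_apply, AlgHom.toLinearMap_apply,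
      single_eq_smul_mono r mu 1, one_smul, reflHom_mono, reflect_reflect hβ, LinearMap.id_apply]
  exact LinearMap.congr_fun h f

/-- The algebra endomorphism `x ↦ x⁻¹`. -/
def longestHom : Laurent n →ₐ[ℂ] Laurent n :=
  AddMonoidAlgebra.lift ℂ (Laurent n) (Fin n → ℤ)
    { toFun := fun mu => AddMonoidAlgebra.single (-Multiplicative.toAdd mu) 1
      map_one' := by simp [AddMonoidAlgebra.one_def]
      map_mul' := fun a b => by
        simp [AddMonoidAlgebra.single_mul_single, add_comm (-Multiplicative.toAdd b)] }

theorem longestHom_apply (f : Laurent n) : longestHom f = longestAct f := by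
  have h : (longestHom (n := n)).toLinearMap = longestAct := by
    refine (AddMonoidAlgebra.basis (Fin n → ℤ) ℂ).ext fun mu => ?_
    simp [longestAct, onMonomials_single, longestHom]
  exact LinearMap.congr_fun h f

/-- The map `σ` negates exponents but fixes the scalar `r^m`, so the opposite weight must be read
with `r⁻¹`. This is the source of `q⁻¹` in the target algebra. -/
theorem longestHom_mono (r : ℂˣ) (β : AffWeight n) :
    longestHom (mono r β) = mono r⁻¹ (-β) := by
  simp [longestHom, mono, AddMonoidAlgebra.smul_single]

theorem longestHom_longestHom (f : Laurent n) : longestHom (longestHom f) = f := by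
  have h : (longestHom (n := n)).toLinearMap ∘ₗ longestHom.toLinearMap = LinearMap.id := by
    refine (AddMonoidAlgebra.basis (Fin n → ℤ) ℂ).ext fun mu => ?_
    simp [longestHom]
  exact LinearMap.congr_fun h f

theorem longestHom_reflHom (r : ℂˣ) {β : AffWeight n} (hβ : β ∈ rootSystem n) (f : Laurent n) :
    longestHom (reflHom r hβ f) = reflHom r⁻¹ hβ (longestHom f) := by
  have h : (longestHom (n := n)).toLinearMap ∘ₗ (reflHom r hβ).toLinearMap
      = (reflHom r⁻¹ hβ).toLinearMap ∘ₗ longestHom.toLinearMap := by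
    refine (AddMonoidAlgebra.basis (Fin n → ℤ) ℂ).ext fun mu => ?_
    simp only [AddMonoidAlgebra.basis_apply, LinearMap.comp_apply, AlgHom.toLinearMap_apply,
      single_eq_smul_mono r mu 1, one_smul, reflHom_mono, longestHom_mono, ← reflect_neg hβ]
  exact LinearMap.congr_fun h f

/-! ### The operators `T_i` -/

theorem one_sub_mono_ne_zero (r : ℂˣ) {β : AffWeight n} (hβ : β.1 ≠ 0) : 1 - mono r β ≠ 0 := by
  intro h
  have h1 := congrArg (fun f : Laurent n => f.coeff 0) h
  simp [mono, AddMonoidAlgebra.one_def, AddMonoidAlgebra.coeff_sub, hβ] at h1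

theorem fst_ne_zero {β : AffWeight n} (hβ : β ∈ rootSystem n) : β.1 ≠ 0 := by
  intro h
  have := form_self_pos hβ
  simp [form, h] at this

theorem mono_mul_mono_neg (r : ℂˣ) (β : AffWeight n) : mono r β * mono r (-β) = 1 := by
  rw [← mono_add, add_neg_cancel, mono_zero]

/-- This is `v_a + s_a v_a = 1 + t_a²` with denominators cleared; the quadratic relation rests on
it. -/
theorem vNum_sub (t : Multiplicity n) (r : ℂˣ) {a : AffWeight n} (ha : a ∈ rootSystem n) :
    vNum t r a - mono r a * reflHom r ha (vNum t r a)
      = (1 + (t.val a : ℂ) ^ 2) • (1 - mono r a) := by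
  unfold vNum
  split_ifs with h
  · have h1 : mono r a = mono r (half a) * mono r (half a) := by
      rw [← mono_add]; conv_lhs => rw [← h, two_smul]
    have h2 : reflHom r ha (mono r (half a)) = mono r (-half a) := by
      rw [reflHom_mono]
      congr 1
      apply two_smul_injective
      rw [← reflect_smul ha, h, reflect_self ha, smul_neg, h]
    have h3 := mono_mul_mono_neg r (half a)
    have h4 : algebraMap ℂ (Laurent n) ((t.val a * t.val (half a) : ℂˣ) : ℂ)
        * algebraMap ℂ (Laurent n) ((t.val a * (t.val (half a))⁻¹ : ℂˣ) : ℂ)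
        = algebraMap ℂ (Laurent n) (t.val a) ^ 2 := by
      rw [← map_mul, ← map_pow]
      congr 1
      have := (t.val (half a)).ne_zero
      push_cast
      field_simp
    simp only [map_mul, map_sub, map_add, map_one, map_smul, h2, h1]
    simp only [Algebra.smul_def, map_add, map_one, map_pow]
    set y := mono r (half a)
    set z := mono r (-half a)
    set A := algebraMap ℂ (Laurent n) ((t.val a * t.val (half a) : ℂˣ) : ℂ)
    set B := algebraMap ℂ (Laurent n) ((t.val a * (t.val (half a))⁻¹ : ℂˣ) : ℂ)
    linear_combination (1 - y * y) * h4 - (y * (B - A) - A * B * (1 + y * z)) * h3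
  · have h3 := mono_mul_mono_neg r a
    simp only [map_sub, map_one, map_smul, reflHom_mono, reflect_self ha]
    simp only [Algebra.smul_def, map_add, map_one, map_pow, Units.val_pow_eq_pow_val]
    linear_combination (algebraMap ℂ (Laurent n) (t.val a)) ^ 2 * h3

/-- With `z = y⁻¹`, one has `1 - A z = -A z (1 - A⁻¹ y)`: inverting the variable amounts to
inverting the parameter, up to a monomial. Since `1 - x^{-a} = -x^{-a} (1 - x^a)`, the identity says
that `σ v_a = t_a² v_a'`. -/
theorem longestHom_vNum (t : Multiplicity n) (r : ℂˣ) (a : AffWeight n) :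
    longestHom (vNum t r a)
      = -((t.val a : ℂ) ^ 2) • (mono r⁻¹ (-a) * vNum t.inverse r⁻¹ a) := by
  unfold vNum
  have h0 := (t.val a).ne_zero
  have h0' := (t.val (half a)).ne_zero
  have hc : ∀ c d : ℂ, c * d = 1 →
      algebraMap ℂ (Laurent n) c * algebraMap ℂ (Laurent n) d = 1 := by
    intro c d h; rw [← map_mul, h, map_one]
  split_ifs with h
  · have h1 : mono r⁻¹ (-a) = mono r⁻¹ (-half a) * mono r⁻¹ (-half a) := by
      rw [← mono_add]; conv_lhs => rw [← h, two_smul, neg_add]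
    have h3 := mono_mul_mono_neg r⁻¹ (half a)
    have h4 := hc ((t.val a * t.val (half a) : ℂˣ) : ℂ)
      ((t.inverse.val a * t.inverse.val (half a) : ℂˣ) : ℂ) (by
        simp only [Multiplicity.inverse]; push_cast; field_simp)
    have h5 := hc ((t.val a * (t.val (half a))⁻¹ : ℂˣ) : ℂ)
      ((t.inverse.val a * (t.inverse.val (half a))⁻¹ : ℂˣ) : ℂ) (by
        simp only [Multiplicity.inverse]; push_cast; field_simp)
    have h6 : algebraMap ℂ (Laurent n) ((t.val a * t.val (half a) : ℂˣ) : ℂ)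
        * algebraMap ℂ (Laurent n) ((t.val a * (t.val (half a))⁻¹ : ℂˣ) : ℂ)
        = algebraMap ℂ (Laurent n) (t.val a) ^ 2 := by
      rw [← map_mul, ← map_pow]
      congr 1
      push_cast
      field_simp
    simp only [map_mul, map_sub, map_add, map_one, map_smul, h1, longestHom_mono]
    simp only [Algebra.smul_def, map_pow, map_neg]
    generalize mono r⁻¹ (half a) = y at *
    generalize mono r⁻¹ (-half a) = z at *
    generalize algebraMap ℂ (Laurent n) ((t.val a * t.val (half a) : ℂˣ) : ℂ) = A at *
    generalize algebraMap ℂ (Laurent n) ((t.val a * (t.val (half a))⁻¹ : ℂˣ) : ℂ) = B at *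
    generalize algebraMap ℂ (Laurent n)
      ((t.inverse.val a * t.inverse.val (half a) : ℂˣ) : ℂ) = A' at *
    generalize algebraMap ℂ (Laurent n)
      ((t.inverse.val a * (t.inverse.val (half a))⁻¹ : ℂˣ) : ℂ) = B' at *
    rw [← h6]
    have e1 : 1 - A * z = -(A * z) * (1 - A' * y) := by linear_combination (-A * A') * h3 - h4
    have e2 : 1 + B * z = (B * z) * (1 + B' * y) := by linear_combination (-B * B') * h3 - h5
    rw [e1, e2]; ring
  · have h3 := mono_mul_mono_neg r⁻¹ a
    have h4 := hc (t.val a) (t.inverse.val a) (by simp [Multiplicity.inverse])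
    simp only [map_sub, map_one, map_smul, longestHom_mono]
    simp only [Algebra.smul_def, map_neg, map_pow, Units.val_pow_eq_pow_val]
    generalize mono r⁻¹ a = y at *
    generalize mono r⁻¹ (-a) = z at *
    generalize algebraMap ℂ (Laurent n) (t.val a) = A at *
    generalize algebraMap ℂ (Laurent n) (t.inverse.val a) = A' at *
    linear_combination (-A ^ 2 * A' ^ 2) * h3 - (1 + A * A') * h4

theorem T_apply (t : Multiplicity n) (r : ℂˣ) (i : Fin (n + 1)) (f : Laurent n) :
    T t r i f = (tpar t i : ℂ) • f - ((tpar t i : ℂ)⁻¹) •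
      (vNum t r (simpleRoot n i) * dividedDiff r (simpleRoot n i) f) := by
  simp [T]

/-- For `g = (f - s_a f) / (1 - x^a)` one has `s_a g = x^a g`, so `(1 - x^a)` times the left side is
`(N - x^a s_a N) g` with `N` the numerator of `v_a`, and `vNum_sub` applies. -/
theorem dividedDiff_vNum_mul (t : Multiplicity n) (r : ℂˣ) {a : AffWeight n}
    (ha : a ∈ rootSystem n) (f : Laurent n) :
    dividedDiff r a (vNum t r a * dividedDiff r a f)
      = (1 + (t.val a : ℂ) ^ 2) • dividedDiff r a f := by
  have hd : 1 - mono r a ≠ 0 := one_sub_mono_ne_zero r (fst_ne_zero ha)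
  set g := dividedDiff r a f with hg
  have hDf := one_sub_mono_mul_dividedDiff r a f
  rw [← hg, ← reflHom_apply r ha] at hDf
  have hinv := reflHom_reflHom r ha f
  have hsg : reflHom r ha g = mono r a * g := by
    have h1 := congrArg (reflHom r ha) hDf
    simp only [map_mul, map_sub, map_one, reflHom_mono, reflect_self ha, hinv] at h1
    apply mul_left_cancel₀ hd
    have h3 := mono_mul_mono_neg r a
    linear_combination (-mono r a) * h1 - mono r a * hDf - reflHom r ha g * h3
  apply mul_left_cancel₀ hd
  rw [one_sub_mono_mul_dividedDiff, ← reflHom_apply r ha, map_mul, hsg]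
  have h := vNum_sub t r ha
  rw [Algebra.smul_def] at h ⊢
  linear_combination g * h

/-- The quadratic relation `(T_i - t_i)(T_i + t_i⁻¹) = 0`. -/
theorem T_mul_T_sub (hn : 2 ≤ n) (t : Multiplicity n) (r : ℂˣ) (i : Fin (n + 1)) (f : Laurent n) :
    T t r i (T t r i f) = ((tpar t i : ℂ) - (tpar t i : ℂ)⁻¹) • T t r i f + f := by
  have ha := simpleRoot_mem hn i
  have h := dividedDiff_vNum_mul t r ha f
  have h0 : (tpar t i : ℂ) ≠ 0 := (tpar t i).ne_zero
  simp only [T_apply, map_sub, map_smul]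
  rw [h, show t.val (simpleRoot n i) = tpar t i from rfl, mul_smul_comm]
  match_scalars <;> field_simp <;> ring

/-- From `σ v_a = t_i² v_a'` one gets `σ T_i σ = t_i + t_i v_a' (s_i - 1)`, whereas `T_i' = t_i⁻¹ +
t_i v_a' (s_i - 1)`. By the quadratic relation for `T_i'` the right side is `(T_i')⁻¹ f`. -/
theorem longestHom_T (hn : 2 ≤ n) (t : Multiplicity n) (r : ℂˣ) (i : Fin (n + 1)) (f : Laurent n) :
    longestHom (T t r i (longestHom f))
      = T t.inverse r⁻¹ i f + ((tpar t i : ℂ) - (tpar t i : ℂ)⁻¹) • f := by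
  have ha := simpleRoot_mem hn i
  have h0 : (tpar t i : ℂ) ≠ 0 := (tpar t i).ne_zero
  have hd : 1 - mono r⁻¹ (simpleRoot n i) ≠ 0 := one_sub_mono_ne_zero _ (fst_ne_zero ha)
  have h1 := congrArg longestHom (one_sub_mono_mul_T t r i (longestHom f))
  have h2 := one_sub_mono_mul_T t.inverse r⁻¹ i f
  have h3 := mono_mul_mono_neg r⁻¹ (simpleRoot n i)
  have h5 : tpar t.inverse i = (tpar t i)⁻¹ := rfl
  simp only [map_mul, map_add, map_sub, map_one, map_smul, longestHom_mono, longestHom_vNum,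
    ← reflHom_apply _ ha, longestHom_reflHom, longestHom_longestHom] at h1
  rw [h5, inv_inv, ← reflHom_apply _ ha] at h2
  apply mul_left_cancel₀ hd
  rw [show t.val (simpleRoot n i) = tpar t i from rfl] at h1
  have h6 : algebraMap ℂ (Laurent n) (((tpar t i)⁻¹ : ℂˣ) : ℂ)
      * algebraMap ℂ (Laurent n) (tpar t i) = 1 := by
    rw [← map_mul, Units.inv_mul, map_one]
  rw [← Units.val_inv_eq_inv_val]
  simp only [Algebra.smul_def, map_neg, map_pow, map_sub] at h1 h2 ⊢
  generalize longestHom (T t r i (longestHom f)) = X at *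
  generalize T t.inverse r⁻¹ i f = Y at *
  generalize mono r⁻¹ (simpleRoot n i) = y at *
  generalize mono r⁻¹ (-simpleRoot n i) = z at *
  generalize algebraMap ℂ (Laurent n) (tpar t i) = A at *
  generalize algebraMap ℂ (Laurent n) (((tpar t i)⁻¹ : ℂˣ) : ℂ) = A' at *
  generalize vNum t.inverse r⁻¹ (simpleRoot n i) = V at *
  generalize reflHom r⁻¹ ha f = g at *
  linear_combination (-y) * h1 - h2 - (X - A * f) * h3 + (A * V * (g - f)) * (y * z) * h6
    + A * V * (g - f) * h3

/-! ### Positive roots -/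

theorem simpleRoot_zero (i0 : Fin n) (h0 : (i0 : ℕ) = 0) :
    simpleRoot n 0 = (2 : ℤ) • ((((-1 : ℤˣ) : ℤ) • eps i0, 1) : AffWeight n) := by
  ext k
  · simp [simpleRoot, eps_apply, Fin.ext_iff, h0]; split_ifs <;> rfl
  · simp [simpleRoot]

theorem simpleRoot_last (i1 : Fin n) (h1 : (i1 : ℕ) + 1 = n) :
    simpleRoot n (Fin.last n) = (2 : ℤ) • ((((1 : ℤˣ) : ℤ) • eps i1, 0) : AffWeight n) := by
  have h0 : Fin.last n ≠ 0 := by rw [Ne, Fin.ext_iff, Fin.val_last, Fin.val_zero]; omega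
  ext k
  · have : (k : ℕ) + 1 = n ↔ k = i1 := by rw [Fin.ext_iff]; omega
    simp [simpleRoot, eps_apply, h0, this]
  · simp [simpleRoot, h0]

theorem simpleRoot_mid (i : Fin (n + 1)) (hi0 : i ≠ 0) (hin : i ≠ Fin.last n) (j j' : Fin n)
    (hj : (j : ℕ) + 1 = i) (hj' : (j' : ℕ) = i) :
    simpleRoot n i = (((1 : ℤˣ) : ℤ) • eps j + ((-1 : ℤˣ) : ℤ) • eps j', 2 * 0) := by
  ext k
  · have h1 : (k : ℕ) + 1 = i ↔ k = j := by rw [Fin.ext_iff]; omega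
    have h2 : (k : ℕ) = i ↔ k = j' := by rw [Fin.ext_iff]; omega
    simp only [simpleRoot, hi0, hin, if_false, h1, h2, Pi.add_apply, Pi.smul_apply, eps_apply]
    have : j ≠ j' := by rw [Ne, Fin.ext_iff]; omega
    split_ifs with h3 h4 h4
    · exact absurd (h3.symm.trans h4) this
    all_goals simp
  · simp [simpleRoot, hi0, hin]

theorem two_smul_two_smul_notMem {γ : AffWeight n} (h : form γ γ = 1) :
    (2 : ℤ) • (2 : ℤ) • γ ∉ rootSystem n := by
  rw [mem_rootSystem_iff]
  have h16 : form ((2 : ℤ) • (2 : ℤ) • γ) ((2 : ℤ) • (2 : ℤ) • γ) = 16 := by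
    simp only [form_smul_left, form_smul_right, h]; norm_num
  rintro (h1 | ⟨δ, h1, h2⟩ | ⟨h1, -⟩)
  · omega
  · rw [h2, form_smul_left, form_smul_right, h1] at h16; omega
  · omega

/-- Doubling a root of squared length 1 gives a root, while lengths 2 and 4 double to 8 and 16,
which do not occur. -/
theorem mem_redRoots_iff (β : AffWeight n) :
    β ∈ redRoots n ↔ (∃ γ : AffWeight n, form γ γ = 1 ∧ β = (2 : ℤ) • γ) ∨
      (form β β = 2 ∧ Even β.2) := by
  simp only [redRoots, Set.mem_ofPred_eq, mem_rootSystem_iff β]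
  constructor
  · rintro ⟨h | h | h, h2⟩
    · exact absurd ((mem_rootSystem_iff _).2 (Or.inr (Or.inl ⟨β, h, rfl⟩))) h2
    · exact Or.inl h
    · exact Or.inr h
  · rintro (⟨γ, h, rfl⟩ | h)
    · exact ⟨Or.inr (Or.inl ⟨γ, h, rfl⟩), two_smul_two_smul_notMem h⟩
    · refine ⟨Or.inr (Or.inr h), fun h2 => ?_⟩
      have h8 : form ((2 : ℤ) • β) ((2 : ℤ) • β) = 8 := by
        rw [form_smul_left, form_smul_right, h.1]; norm_num
      rcases (mem_rootSystem_iff _).1 h2 with h1 | ⟨δ, h1, h2⟩ | ⟨h1, -⟩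
      · omega
      · rw [h2, form_smul_left, form_smul_right, h1] at h8; omega
      · omega

theorem mem_redRoots_iff_exists (β : AffWeight n) :
    β ∈ redRoots n ↔
      (∃ (i : Fin n) (s : ℤˣ) (m : ℤ), β = (2 : ℤ) • (((s : ℤ) • eps i, m) : AffWeight n)) ∨
      (∃ (i j : Fin n) (s s' : ℤˣ) (m : ℤ), i < j ∧
        β = ((s : ℤ) • eps i + (s' : ℤ) • eps j, 2 * m)) := by
  rw [mem_redRoots_iff, form_self_eq_two_iff]
  refine or_congr ⟨?_, ?_⟩ ⟨?_, ?_⟩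
  · rintro ⟨γ, h, rfl⟩
    obtain ⟨i, s, h⟩ := (form_self_eq_one_iff γ).1 h
    exact ⟨i, s, γ.2, by rw [← h]⟩
  · rintro ⟨i, s, m, rfl⟩
    exact ⟨_, (form_self_eq_one_iff _).2 ⟨i, s, rfl⟩, rfl⟩
  · rintro ⟨⟨i, j, s, s', hij, h⟩, m, hm⟩
    exact ⟨i, j, s, s', m, hij, Prod.ext h (by rw [hm]; ring)⟩
  · rintro ⟨i, j, s, s', m, hij, rfl⟩
    exact ⟨⟨i, j, s, s', hij, rfl⟩, even_two_mul m⟩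

theorem reflect_mem_redRoots {β γ : AffWeight n} (hβ : β ∈ rootSystem n) (hγ : γ ∈ redRoots n) :
    reflect β γ ∈ redRoots n :=
  ⟨reflect_mem_rootSystem hβ hγ.1, by
    rw [← reflect_smul hβ, reflect_mem_rootSystem_iff hβ]; exact hγ.2⟩

theorem unit_eq_one_of_nonneg {s : ℤˣ} (h : 0 ≤ (s : ℤ)) : s = 1 := by
  rcases Int.units_eq_one_or s with rfl | rfl
  · rfl
  · norm_num at h

/-- The positive roots are `±2ε_i + 2mδ` and `±ε_i ± ε_j + mδ` for `i < j`, with `m ≥ 0`, the first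
sign being positive if `m = 0`. -/
theorem mem_posRoots_iff_exists (β : AffWeight n) :
    β ∈ posRoots n ↔
      (∃ (i : Fin n) (s : ℤˣ) (m : ℤ), 0 ≤ m ∧ (m = 0 → s = 1) ∧
        β = (2 : ℤ) • (((s : ℤ) • eps i, m) : AffWeight n)) ∨
      (∃ (i j : Fin n) (s s' : ℤˣ) (m : ℤ), i < j ∧ 0 ≤ m ∧ (m = 0 → s = 1) ∧
        β = ((s : ℤ) • eps i + (s' : ℤ) • eps j, 2 * m)) := by
  constructor
  · rintro ((⟨i, rfl⟩ | ⟨i, j, s, hij, rfl⟩) | ⟨h, hpos⟩)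
    · exact Or.inl ⟨i, 1, 0, le_rfl, fun _ => rfl, by simp⟩
    · exact Or.inr ⟨i, j, 1, s, 0, hij, le_rfl, fun _ => rfl, by simp⟩
    · rcases (mem_redRoots_iff_exists β).1 h with ⟨i, s, m, rfl⟩ | ⟨i, j, s, s', m, hij, rfl⟩
      · have : 0 < m := by simpa using hpos
        exact Or.inl ⟨i, s, m, this.le, fun h => absurd h this.ne', rfl⟩
      · have : 0 < m := by simpa using hpos
        exact Or.inr ⟨i, j, s, s', m, hij, this.le, fun h => absurd h this.ne', rfl⟩
  · rintro (⟨i, s, m, hm, hs, rfl⟩ | ⟨i, j, s, s', m, hij, hm, hs, rfl⟩)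
    · rcases hm.eq_or_lt with rfl | hm
      · exact Or.inl (Or.inl ⟨i, by simp [hs rfl]⟩)
      · exact Or.inr ⟨(mem_redRoots_iff_exists _).2 (Or.inl ⟨i, s, m, rfl⟩), by simpa using hm⟩
    · rcases hm.eq_or_lt with rfl | hm
      · exact Or.inl (Or.inr ⟨i, j, s', hij, by simp [hs rfl]⟩)
      · exact Or.inr ⟨(mem_redRoots_iff_exists _).2 (Or.inr ⟨i, j, s, s', m, hij, rfl⟩), by
          simpa using hm⟩

/-! ### Coefficients with respect to the simple roots. -/

/-- The coefficient of `a_j` in `β`, up to a positive factor. -/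
def partialSum (j : Fin (n + 1)) (β : AffWeight n) : ℤ :=
  β.2 + ∑ k : Fin n, if (k : ℕ) < j then β.1 k else 0

theorem partialSum_add (j : Fin (n + 1)) (β γ : AffWeight n) :
    partialSum j (β + γ) = partialSum j β + partialSum j γ := by
  simp only [partialSum, Prod.snd_add, Prod.fst_add, Pi.add_apply]
  rw [add_add_add_comm, ← Finset.sum_add_distrib]
  congr 2 with k
  split_ifs <;> simp

theorem partialSum_smul (j : Fin (n + 1)) (c : ℤ) (β : AffWeight n) :
    partialSum j (c • β) = c * partialSum j β := by
  simp [partialSum, mul_add, Finset.mul_sum]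

theorem partialSum_eps (j : Fin (n + 1)) (c : ℤ) (i : Fin n) (m : ℤ) :
    partialSum j (c • eps i, m) = m + if (i : ℕ) < j then c else 0 := by
  simp only [partialSum, Pi.smul_apply, eps_apply, smul_eq_mul, mul_ite, mul_one, mul_zero]
  congr 1
  rw [Finset.sum_eq_single i] <;> simp +contextual

theorem partialSum_eps_add (j : Fin (n + 1)) (c d : ℤ) (i k : Fin n) (m : ℤ) :
    partialSum j (c • eps i + d • eps k, m)
      = m + (if (i : ℕ) < j then c else 0) + if (k : ℕ) < j then d else 0 := by
  have h : ((c • eps i + d • eps k, m) : AffWeight n) = (c • eps i, m) + (d • eps k, 0) := by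
    simp
  rw [h, partialSum_add, partialSum_eps, partialSum_eps]; ring

theorem partialSum_succ_sub (k : Fin n) (β : AffWeight n) :
    partialSum k.succ β - partialSum k.castSucc β = β.1 k := by
  simp only [partialSum, add_sub_add_left_eq_sub, ← Finset.sum_sub_distrib]
  rw [Finset.sum_eq_single k]
  · simp
  · intro b _ hb
    have : (b : ℕ) < k + 1 ↔ (b : ℕ) < k := by
      have := fun h => hb (Fin.ext h); omega
    simp [this]
  · simp

theorem eq_of_partialSum_eq {β γ : AffWeight n} (h : ∀ j, partialSum j β = partialSum j γ) :
    β = γ := by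
  ext k
  · rw [← partialSum_succ_sub, h, h, partialSum_succ_sub]
  · simpa [partialSum] using h 0

/-- The partial sums start at the level and then move by the signs in order. With leading sign `+`
the threshold between the two cases is `m ≥ 0`; a leading `-` lowers the sum at once, so it becomes
`m ≥ 1`. -/
theorem partialSum_nonneg_or_nonpos {β : AffWeight n} (hβ : β ∈ redRoots n) :
    (∀ j, 0 ≤ partialSum j β) ∨ (∀ j, partialSum j β ≤ 0) := by
  rcases (mem_redRoots_iff_exists β).1 hβ with ⟨i, s, m, rfl⟩ | ⟨i, k, s, s', m, hik, rfl⟩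
  · simp only [partialSum_smul, partialSum_eps]
    rcases Int.units_eq_one_or s with rfl | rfl
    · by_cases hm : 0 ≤ m
      · left; intro j; split_ifs <;> simp <;> omega
      · right; intro j; split_ifs <;> simp <;> omega
    · by_cases hm : 1 ≤ m
      · left; intro j; split_ifs <;> simp <;> omega
      · right; intro j; split_ifs <;> simp <;> omega
  · simp only [partialSum_eps_add]
    rw [Fin.lt_def] at hik
    rcases Int.units_eq_one_or s with rfl | rfl <;>
    rcases Int.units_eq_one_or s' with rfl | rfl
    · by_cases hm : 0 ≤ m
      · left; intro j; split_ifs <;> simp <;> omega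
      · right; intro j; split_ifs <;> simp <;> omega
    · by_cases hm : 0 ≤ m
      · left; intro j; split_ifs <;> simp <;> omega
      · right; intro j; split_ifs <;> simp <;> omega
    · by_cases hm : 1 ≤ m
      · left; intro j; split_ifs <;> simp <;> omega
      · right; intro j; split_ifs <;> simp <;> omega
    · by_cases hm : 1 ≤ m
      · left; intro j; split_ifs <;> simp <;> omega
      · right; intro j; split_ifs <;> simp <;> omega

/-- Positivity becomes nonnegativity of all simple-root coefficients, as the usual argument for the
action of simple reflections requires. -/
theorem mem_posRoots_iff (β : AffWeight n) :
    β ∈ posRoots n ↔ β ∈ redRoots n ∧ ∀ j, 0 ≤ partialSum j β := by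
  rw [mem_posRoots_iff_exists]
  constructor
  · rintro (⟨i, s, m, hm, hs, rfl⟩ | ⟨i, k, s, s', m, hik, hm, hs, rfl⟩)
    · refine ⟨(mem_redRoots_iff_exists _).2 (Or.inl ⟨i, s, m, rfl⟩), fun j => ?_⟩
      rw [partialSum_smul, partialSum_eps]
      rcases Int.units_eq_one_or s with rfl | rfl
      · split_ifs <;> simp <;> omega
      · have : m ≠ 0 := fun h => by simpa using hs h
        split_ifs <;> simp <;> omega
    · refine ⟨(mem_redRoots_iff_exists _).2 (Or.inr ⟨i, k, s, s', m, hik, rfl⟩), fun j => ?_⟩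
      rw [partialSum_eps_add]
      rw [Fin.lt_def] at hik
      rcases Int.units_eq_one_or s with rfl | rfl
      · rcases Int.units_eq_one_or s' with rfl | rfl <;> split_ifs <;> simp <;> omega
      · have : m ≠ 0 := fun h => by simpa using hs h
        rcases Int.units_eq_one_or s' with rfl | rfl <;> split_ifs <;> simp <;> omega
  · rintro ⟨h, hj⟩
    rcases (mem_redRoots_iff_exists β).1 h with ⟨i, s, m, rfl⟩ | ⟨i, k, s, s', m, hik, rfl⟩
    · simp only [partialSum_smul, partialSum_eps] at hj
      refine Or.inl ⟨i, s, m, ?_, ?_, rfl⟩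
      · have := hj 0; simp at this; omega
      · rintro rfl
        have := hj i.succ
        exact unit_eq_one_of_nonneg (by simpa using this)
    · simp only [partialSum_eps_add] at hj
      rw [Fin.lt_def] at hik
      refine Or.inr ⟨i, k, s, s', m, hik, ?_, ?_, rfl⟩
      · have := hj 0; simp at this; omega
      · rintro rfl
        -- At level 0 the partial sum that ends with the first nonzero coordinate equals its sign.
        have := hj i.succ
        have hki : ¬ (k : ℕ) < i + 1 := by omega
        exact unit_eq_one_of_nonneg (by simpa [hki] using this)

/-- So the partial sums are dual to `a_0, …, a_n` up to positive factors, and adding a multiple of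
`a_i` changes only the `i`-th one. -/
theorem partialSum_simpleRoot_of_ne (hn : 2 ≤ n) {i j : Fin (n + 1)} (hij : j ≠ i) :
    partialSum j (simpleRoot n i) = 0 := by
  have hij' : (j : ℕ) ≠ i := fun h => hij (Fin.ext h)
  by_cases h0 : i = 0
  · subst h0
    rw [simpleRoot_zero ⟨0, by omega⟩ rfl, partialSum_smul, partialSum_eps]
    have : 0 < (j : ℕ) := Nat.pos_of_ne_zero hij'
    simp [this]
  by_cases hl : i = Fin.last n
  · subst hl
    rw [simpleRoot_last ⟨n - 1, by omega⟩ (by simp only; omega), partialSum_smul, partialSum_eps]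
    have : ¬ (n - 1 < (j : ℕ)) := by rw [Fin.val_last] at hij'; omega
    simp [this]
  · have hi0 : (i : ℕ) ≠ 0 := fun h => h0 (Fin.ext h)
    have hin : (i : ℕ) ≠ n := fun h => hl (Fin.ext h)
    rw [simpleRoot_mid i h0 hl ⟨i - 1, by omega⟩ ⟨i, by omega⟩ (by simp only; omega) rfl,
      partialSum_eps_add]
    simp only
    split_ifs <;> first | omega | simp

theorem simpleRoot_normalization (hn : 2 ≤ n) (i : Fin (n + 1)) :
    (partialSum i (simpleRoot n i) = 2 ∧ form (simpleRoot n i) (simpleRoot n i) = 4) ∨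
    (partialSum i (simpleRoot n i) = 1 ∧ form (simpleRoot n i) (simpleRoot n i) = 2) := by
  by_cases h0 : i = 0
  · subst h0
    left
    rw [simpleRoot_zero ⟨0, by omega⟩ rfl, partialSum_smul, partialSum_eps, form_smul_left,
      form_smul_right, (form_self_eq_one_iff _).2 ⟨_, _, rfl⟩]
    simp
  by_cases hl : i = Fin.last n
  · subst hl
    left
    rw [simpleRoot_last ⟨n - 1, by omega⟩ (by simp only; omega), partialSum_smul, partialSum_eps,
      form_smul_left, form_smul_right, (form_self_eq_one_iff _).2 ⟨_, _, rfl⟩]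
    have : n - 1 < n := by omega
    simp [this]
  · have hi0 : (i : ℕ) ≠ 0 := fun h => h0 (Fin.ext h)
    have hin : (i : ℕ) ≠ n := fun h => hl (Fin.ext h)
    right
    have hlt : (⟨i - 1, by omega⟩ : Fin n) < ⟨i, by omega⟩ := by rw [Fin.lt_def]; simp only; omega
    rw [simpleRoot_mid i h0 hl ⟨i - 1, by omega⟩ ⟨i, by omega⟩ (by simp only; omega) rfl,
      partialSum_eps_add, (form_self_eq_two_iff _).2 ⟨_, _, _, _, hlt, rfl⟩]
    have : (i : ℕ) - 1 < i := by omega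
    simp [this]

/-- Such a `β` is proportional to `a_i`. Squared lengths in `R` are 2 or 4, and their ratio must be
the square of the proportionality factor, which leaves only the factor 1. -/
theorem eq_simpleRoot (hn : 2 ≤ n) {i : Fin (n + 1)} {β : AffWeight n} (hβ : β ∈ posRoots n)
    (h : ∀ j, j ≠ i → partialSum j β = 0) : β = simpleRoot n i := by
  obtain ⟨hred, hpos⟩ := (mem_posRoots_iff β).1 hβ
  have key : partialSum i (simpleRoot n i) • β = partialSum i β • simpleRoot n i := by
    apply eq_of_partialSum_eq
    intro j
    rw [partialSum_smul, partialSum_smul]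
    by_cases hj : j = i
    · subst hj; ring
    · rw [h j hj, partialSum_simpleRoot_of_ne hn hj]; ring
  have hform : form β β = 4 ∨ form β β = 2 := by
    rcases (mem_redRoots_iff β).1 hred with ⟨γ, h1, rfl⟩ | ⟨h1, -⟩
    · left; rw [form_smul_left, form_smul_right, h1]; norm_num
    · exact Or.inr h1
  have key2 := congrArg (fun γ => form γ γ) key
  simp only [form_smul_left, form_smul_right] at key2
  have hp := hpos i
  rcases simpleRoot_normalization hn i with ⟨h1, h2⟩ | ⟨h1, h2⟩
  · rw [h1, h2] at key2
    have hsq : partialSum i β * partialSum i β = form β β := by linarith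
    have hle : partialSum i β ≤ 2 := by rcases hform with h | h <;> rw [h] at hsq <;> nlinarith
    have : partialSum i β = 2 := by
      have : partialSum i β = 0 ∨ partialSum i β = 1 ∨ partialSum i β = 2 := by omega
      rcases this with h | h | h <;> rw [h] at hsq <;> omega
    rw [h1, this] at key
    exact two_smul_injective key
  · rw [h1, h2] at key2
    have hsq : 2 * (partialSum i β * partialSum i β) = form β β := by linarith
    have hle : partialSum i β ≤ 1 := by rcases hform with h | h <;> rw [h] at hsq <;> nlinarith
    have : partialSum i β = 1 := by
      have : partialSum i β = 0 ∨ partialSum i β = 1 := by omega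
      rcases this with h | h <;> rw [h] at hsq <;> omega
    rw [h1, this, one_smul, one_smul] at key
    exact key

theorem simpleRoot_mem_posRoots (hn : 2 ≤ n) (i : Fin (n + 1)) :
    simpleRoot n i ∈ posRoots n := by
  rw [mem_posRoots_iff]
  constructor
  · rw [mem_redRoots_iff]
    rcases (mem_rootSystem_iff _).1 (simpleRoot_mem hn i) with h | h | h
    · have := simpleRoot_normalization hn i; omega
    · exact Or.inl h
    · exact Or.inr h
  · intro j
    by_cases hj : j = i
    · subst hj; have := simpleRoot_normalization hn j; omega
    · rw [partialSum_simpleRoot_of_ne hn hj]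

/-- The reflection in a simple root permutes the other positive roots. -/
theorem reflect_simpleRoot_mem (hn : 2 ≤ n) {i : Fin (n + 1)} {β : AffWeight n}
    (hβ : β ∈ posRoots n) (hne : β ≠ simpleRoot n i) :
    reflect (simpleRoot n i) β ∈ posRoots n ∧ reflect (simpleRoot n i) β ≠ simpleRoot n i := by
  have ha := simpleRoot_mem hn i
  have hβ' := (mem_posRoots_iff β).1 hβ
  have hred := reflect_mem_redRoots ha hβ'.1
  refine ⟨(mem_posRoots_iff _).2 ⟨hred, ?_⟩, fun h => ?_⟩
  · rcases partialSum_nonneg_or_nonpos hred with h | h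
    · exact h
    -- The reflection changes only the coefficient of `a_i`. If the image were negative, every other
    -- coefficient of `β` would be both `≥ 0` and `≤ 0`.
    · refine absurd (eq_simpleRoot hn hβ fun j hj => ?_) hne
      have h1 := h j
      have h2 : reflect (simpleRoot n i) β
          = β + (-pairing β (simpleRoot n i)) • simpleRoot n i := by
        simp only [reflect]; module
      rw [h2, partialSum_add, partialSum_smul, partialSum_simpleRoot_of_ne hn hj] at h1
      have := hβ'.2 j
      omega
  · have h1 : β = (-1 : ℤ) • simpleRoot n i := by
      rw [← reflect_reflect ha β, h, reflect_self ha]; simp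
    have h2 := hβ'.2 i
    rw [h1, partialSum_smul] at h2
    have := simpleRoot_normalization hn i
    omega

theorem reflect_simpleRoot_mem_iff (hn : 2 ≤ n) (i : Fin (n + 1)) (β : AffWeight n) :
    (reflect (simpleRoot n i) β ∈ posRoots n ∧ reflect (simpleRoot n i) β ≠ simpleRoot n i) ↔
      (β ∈ posRoots n ∧ β ≠ simpleRoot n i) := by
  refine ⟨fun h => ?_, fun h => reflect_simpleRoot_mem hn h.1 h.2⟩
  have := reflect_simpleRoot_mem hn h.1 h.2
  rwa [reflect_reflect (simpleRoot_mem hn i)] at this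

/-! ### The orbits of the affine Weyl group on the roots -/

theorem form_eps_right (g : AffWeight n) (c : ℤ) (i : Fin n) (m : ℤ) :
    form g (c • eps i, m) = c * g.1 i := by
  simp [form, eps_apply, mul_comm]

theorem form_eps_add_right (g : AffWeight n) (c d : ℤ) (i j : Fin n) (m : ℤ) :
    form g (c • eps i + d • eps j, m) = c * g.1 i + d * g.1 j := by
  simp [form, eps_apply, add_mul, ite_mul, Finset.sum_add_distrib, mul_comm]

theorem reflect_eps (i : Fin n) (c : ℤ) (g : AffWeight n) :
    reflect (eps i, c) g = g - (2 * g.1 i) • ((eps i, c) : AffWeight n) := by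
  have h : ((eps i, c) : AffWeight n) = ((1 : ℤ) • eps i, c) := by simp
  have hf : form ((1 : ℤ) • eps i, c) (((1 : ℤ) • eps i, c) : AffWeight n) = 1 :=
    (form_self_eq_one_iff _).2 ⟨i, 1, rfl⟩
  rw [reflect, pairing_eq_of (k := 2 * g.1 i)]
  · rw [h, mem_rootSystem_iff]; exact Or.inl hf
  · rw [h, hf, form_eps_right]; ring

theorem reflect_eps_sub {i j : Fin n} (hij : i ≠ j) (g : AffWeight n) :
    reflect (eps i - eps j, 0) g = g - (g.1 i - g.1 j) • ((eps i - eps j, 0) : AffWeight n) := by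
  have h : ((eps i - eps j, 0) : AffWeight n) = ((1 : ℤ) • eps i + (-1 : ℤ) • eps j, 0) := by
    simp [sub_eq_add_neg]
  have hf : form ((1 : ℤ) • eps i + (-1 : ℤ) • eps j, 0)
      (((1 : ℤ) • eps i + (-1 : ℤ) • eps j, 0) : AffWeight n) = 2 := by
    rw [form_eps_add_right]; simp [eps_apply, hij, hij.symm]
  rw [reflect, pairing_eq_of (k := g.1 i - g.1 j)]
  · rw [h, mem_rootSystem_iff]; exact Or.inr (Or.inr ⟨hf, by simp⟩)
  · rw [h, hf, form_eps_add_right]; ring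

theorem eps_mem (i : Fin n) (c : ℤ) : ((eps i, c) : AffWeight n) ∈ rootSystem n :=
  Or.inl ⟨i, 1, c, by simp⟩

theorem eps_sub_mem {i j : Fin n} (hij : i ≠ j) :
    ((eps i - eps j, 0) : AffWeight n) ∈ rootSystem n := by
  rw [mem_rootSystem_iff]
  refine Or.inr (Or.inr ⟨?_, by simp⟩)
  have h : ((eps i - eps j, 0) : AffWeight n) = ((1 : ℤ) • eps i + (-1 : ℤ) • eps j, 0) := by
    simp [sub_eq_add_neg]
  rw [h, form_eps_add_right]; simp [eps_apply, hij, hij.symm]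

/-- The reflection in `ε_i + (c/2)δ` flips the sign and moves the level by an even number, so only
the parity of the level is kept. The function `F` is abstract because it will be both `γ ↦ t_γ` and
`γ ↦ t_{2γ}`. -/
theorem invariant_eps_neg {α : Type*} {F : AffWeight n → α}
    (hF : ∀ β ∈ rootSystem n, ∀ γ, F (reflect β γ) = F γ)
    (i : Fin n) (s : ℤˣ) {m m' : ℤ} (h : Even (m - m')) :
    F ((s : ℤ) • eps i, m) = F (((-s : ℤˣ) : ℤ) • eps i, m') := by
  obtain ⟨c, hc⟩ := h
  rw [← hF _ (eps_mem i ((s : ℤ) * c)), reflect_eps]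
  congr 1
  have hs : (s : ℤ) * s = 1 := Int.units_coe_mul_self s
  ext k
  · simp [eps_apply]; split_ifs <;> ring
  · simp [eps_apply]; linear_combination hc - 2 * c * hs

theorem invariant_eps {α : Type*} {F : AffWeight n → α}
    (hF : ∀ β ∈ rootSystem n, ∀ γ, F (reflect β γ) = F γ)
    (i j : Fin n) (s s' : ℤˣ) {m m' : ℤ} (h : Even (m - m')) :
    F ((s : ℤ) • eps i, m) = F ((s' : ℤ) • eps j, m') := by
  have h1 : F ((s : ℤ) • eps i, m) = F ((s : ℤ) • eps j, m) := by
    by_cases hij : i = j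
    · rw [hij]
    · rw [← hF _ (eps_sub_mem hij), reflect_eps_sub hij]
      congr 1
      ext k
      · simp [eps_apply, Ne.symm hij]; split_ifs <;> ring
      · simp
  rw [h1]
  rcases Int.units_eq_one_or (s * s') with h2 | h2
  · have : s' = s := by
      rcases Int.units_eq_one_or s with rfl | rfl <;>
      rcases Int.units_eq_one_or s' with rfl | rfl <;> simp_all
    rw [this, invariant_eps_neg hF j s (sub_self m ▸ Even.zero : Even (m - m)),
      invariant_eps_neg hF j (-s) h, neg_neg]
  · have : s' = -s := by
      rcases Int.units_eq_one_or s with rfl | rfl <;>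
      rcases Int.units_eq_one_or s' with rfl | rfl <;> simp_all
    rw [this, invariant_eps_neg hF j s h]

/-- The same reflections move the level by any even number; here all levels are even, so they all
lie in one orbit. -/
theorem invariant_eps_add_neg {α : Type*} {F : AffWeight n → α}
    (hF : ∀ β ∈ rootSystem n, ∀ γ, F (reflect β γ) = F γ)
    {i j : Fin n} (hij : i ≠ j) (s s' : ℤˣ) (m m' : ℤ) :
    F ((s : ℤ) • eps i + (s' : ℤ) • eps j, 2 * m)
      = F (((-s : ℤˣ) : ℤ) • eps i + (s' : ℤ) • eps j, 2 * m') := by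
  rw [← hF _ (eps_mem i ((s : ℤ) * (m - m'))), reflect_eps]
  congr 1
  have hs : (s : ℤ) * s = 1 := Int.units_coe_mul_self s
  ext k
  · simp [eps_apply, hij]; split_ifs <;> ring
  · simp [eps_apply, hij]; linear_combination (-2 * (m - m')) * hs

theorem invariant_eps_add_sign {α : Type*} {F : AffWeight n → α}
    (hF : ∀ β ∈ rootSystem n, ∀ γ, F (reflect β γ) = F γ)
    {i j : Fin n} (hij : i ≠ j) (s s' s₁ s₁' : ℤˣ) (m m' : ℤ) :
    F ((s : ℤ) • eps i + (s' : ℤ) • eps j, 2 * m)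
      = F ((s₁ : ℤ) • eps i + (s₁' : ℤ) • eps j, 2 * m') := by
  have key : ∀ {i j : Fin n}, i ≠ j → ∀ (s s' s₁ : ℤˣ) (m m' : ℤ),
      F ((s : ℤ) • eps i + (s' : ℤ) • eps j, 2 * m)
        = F ((s₁ : ℤ) • eps i + (s' : ℤ) • eps j, 2 * m') := by
    intro i j hij s s' s₁ m m'
    have : s₁ = -s ∨ s₁ = s := by
      rcases Int.units_eq_one_or s with rfl | rfl <;>
      rcases Int.units_eq_one_or s₁ with rfl | rfl <;> simp
    rcases this with rfl | rfl
    · exact invariant_eps_add_neg hF hij s s' m m'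
    · rw [invariant_eps_add_neg hF hij s₁ s' m m,
        invariant_eps_add_neg hF hij (-s₁) s' m m', neg_neg]
  rw [key hij s s' s₁ m m', add_comm, key hij.symm s' s₁ s₁' m' m', add_comm]

theorem invariant_eps_add {α : Type*} {F : AffWeight n → α}
    (hF : ∀ β ∈ rootSystem n, ∀ γ, F (reflect β γ) = F γ)
    {i j k l : Fin n} (hij : i ≠ j) (hkl : k ≠ l) (s s' s₁ s₁' : ℤˣ)
    (m m' : ℤ) :
    F ((s : ℤ) • eps i + (s' : ℤ) • eps j, 2 * m)
      = F ((s₁ : ℤ) • eps k + (s₁' : ℤ) • eps l, 2 * m') := by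
  have move : ∀ {i j : Fin n}, i ≠ j → ∀ k, k ≠ j → ∀ (s s' : ℤˣ) (m : ℤ),
      F ((s : ℤ) • eps i + (s' : ℤ) • eps j, 2 * m)
        = F ((s : ℤ) • eps k + (s' : ℤ) • eps j, 2 * m) := by
    intro i j hij k hkj s s' m
    by_cases hik : i = k
    · rw [hik]
    · rw [← hF _ (eps_sub_mem hik), reflect_eps_sub hik]
      congr 1
      ext a
      · simp [eps_apply, Ne.symm hik, hij, hkj]; split_ifs <;> ring
      · simp
  have from_left : ∀ {j : Fin n}, k ≠ j →
      F ((s : ℤ) • eps k + (s' : ℤ) • eps j, 2 * m)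
        = F ((s₁ : ℤ) • eps k + (s₁' : ℤ) • eps l, 2 * m') := by
    intro j hkj
    rw [add_comm, move hkj.symm l hkl.symm, add_comm]
    exact invariant_eps_add_sign hF hkl _ _ _ _ _ _
  by_cases hkj : k = j
  -- If the new first index collides with the old second one, the two summands are exchanged
  -- beforehand.
  · subst hkj
    rw [invariant_eps_add_sign hF hij s s' s' s m m, add_comm]
    exact from_left hij.symm
  · rw [move hij k hkj]
    exact from_left hkj

theorem val_two_smul_eps (hn : 2 ≤ n) (t : Multiplicity n) (i : Fin n) (s : ℤˣ) (m : ℤ) :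
    t.val ((2 : ℤ) • (((s : ℤ) • eps i, m) : AffWeight n))
      = if Even m then tpar t (Fin.last n) else tpar t 0 := by
  have hF : ∀ β ∈ rootSystem n, ∀ γ, t.val ((2 : ℤ) • reflect β γ) = t.val ((2 : ℤ) • γ) :=
    fun β hβ γ => by rw [← reflect_smul hβ, val_reflect t hβ]
  split_ifs with hm
  · rw [tpar, simpleRoot_last ⟨n - 1, by omega⟩ (by simp only; omega)]
    exact invariant_eps (F := fun γ => t.val ((2 : ℤ) • γ)) hF _ _ _ _ (by simpa using hm)
  · rw [tpar, simpleRoot_zero ⟨0, by omega⟩ rfl]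
    exact invariant_eps (F := fun γ => t.val ((2 : ℤ) • γ)) hF _ _ _ _
      ((Int.not_even_iff_odd.1 hm).sub_odd odd_one)

theorem val_eps (hn : 2 ≤ n) (t : Multiplicity n) (i : Fin n) (s : ℤˣ) (m : ℤ) :
    t.val ((s : ℤ) • eps i, m)
      = if Even m then tparDual t (Fin.last n) else tparDual t 0 := by
  split_ifs with hm
  · rw [tparDual, simpleRoot_last ⟨n - 1, by omega⟩ (by simp only; omega), half_two_smul]
    exact invariant_eps (fun β hβ γ => val_reflect t hβ γ) _ _ _ _ (by simpa using hm)
  · rw [tparDual, simpleRoot_zero ⟨0, by omega⟩ rfl, half_two_smul]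
    exact invariant_eps (fun β hβ γ => val_reflect t hβ γ) _ _ _ _
      ((Int.not_even_iff_odd.1 hm).sub_odd odd_one)

theorem val_eps_add (hn : 2 ≤ n) (t : Multiplicity n) {i j : Fin n} (hij : i ≠ j) (s s' : ℤˣ)
    (m : ℤ) : t.val ((s : ℤ) • eps i + (s' : ℤ) • eps j, 2 * m) = tpar t ⟨1, by omega⟩ := by
  rw [tpar, simpleRoot_mid ⟨1, by omega⟩ (by simp [Fin.ext_iff])
    (by rw [Ne, Fin.ext_iff, Fin.val_last]; simp only; omega) ⟨0, by omega⟩ ⟨1, by omega⟩ rfl rfl]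
  exact invariant_eps_add (fun β hβ γ => val_reflect t hβ γ) hij (by simp [Fin.ext_iff]) _ _ _ _ _ _

/-! ### The action of reflections on points -/

theorem eval_mono_ne_zero (r : ℂˣ) (γ : AffWeight n) {x : Fin n → ℂ} (hx : ∀ i, x i ≠ 0) :
    eval (mono r γ) x ≠ 0 := by
  rw [eval_mono]
  exact mul_ne_zero (zpow_ne_zero _ r.ne_zero)
    (Finset.prod_ne_zero_iff.2 fun i _ => zpow_ne_zero _ (hx i))

theorem eval_mono_add (r : ℂˣ) (β γ : AffWeight n) {x : Fin n → ℂ} (hx : ∀ i, x i ≠ 0) :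
    eval (mono r (β + γ)) x = eval (mono r β) x * eval (mono r γ) x := by
  rw [mono_add, ← evalHom_apply x hx, map_mul, evalHom_apply, evalHom_apply]

theorem eval_mono_zsmul (r : ℂˣ) (c : ℤ) (γ : AffWeight n) (x : Fin n → ℂ) :
    eval (mono r (c • γ)) x = eval (mono r γ) x ^ c := by
  simp only [eval_mono, mul_zpow, ← Finset.prod_zpow, ← zpow_mul, Prod.smul_snd, Prod.smul_fst,
    Pi.smul_apply, smul_eq_mul, mul_comm c]

theorem eval_mono_sum (r : ℂˣ) {ι : Type*} (s : Finset ι) (g : ι → AffWeight n) {x : Fin n → ℂ}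
    (hx : ∀ i, x i ≠ 0) : eval (mono r (∑ j ∈ s, g j)) x = ∏ j ∈ s, eval (mono r (g j)) x := by
  classical
  induction s using Finset.induction_on with
  | empty => rw [Finset.sum_empty, Finset.prod_empty, eval_mono]; simp
  | insert a s ha ih => rw [Finset.sum_insert ha, Finset.prod_insert ha, eval_mono_add r _ _ hx, ih]

/-- The action of the reflection in `β` on points, dual to that on Laurent polynomials. -/
def reflPoint (r : ℂˣ) (β : AffWeight n) (x : Fin n → ℂ) : Fin n → ℂ :=
  fun j => eval (mono r (reflect β (eps j, 0))) x

theorem reflPoint_ne_zero (r : ℂˣ) (β : AffWeight n) {x : Fin n → ℂ} (hx : ∀ i, x i ≠ 0) (i : Fin n) :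
    reflPoint r β x i ≠ 0 :=
  eval_mono_ne_zero r _ hx

theorem eval_mono_reflPoint (r : ℂˣ) {β : AffWeight n} (hβ : β ∈ rootSystem n) (γ : AffWeight n)
    {x : Fin n → ℂ} (hx : ∀ i, x i ≠ 0) :
    eval (mono r γ) (reflPoint r β x) = eval (mono r (reflect β γ)) x := by
  obtain ⟨lam, m⟩ := γ
  have h1 : ((lam, 0) : AffWeight n) = ∑ j, lam j • ((eps j, 0) : AffWeight n) := by
    ext k
    · simp [Prod.fst_sum, Finset.sum_apply, eps_apply]
    · simp [Prod.snd_sum]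
  have h2 : ∀ s : Finset (Fin n), reflect β (∑ j ∈ s, lam j • ((eps j, 0) : AffWeight n))
      = ∑ j ∈ s, lam j • reflect β (eps j, 0) := by
    intro s
    induction s using Finset.induction_on with
    | empty => exact reflect_level β 0
    | insert a s ha ih =>
      rw [Finset.sum_insert ha, Finset.sum_insert ha, reflect_add hβ, ih, reflect_smul hβ]
  rw [reflect_eq_add_level hβ, eval_mono_add r _ _ hx, h1, h2, eval_mono_sum r _ _ hx,
    eval_mono r (lam, m), eval_mono r (0, m)]
  simp only [eval_mono_zsmul, Pi.zero_apply, zpow_zero, Finset.prod_const_one, mul_one]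
  rw [mul_comm]
  rfl

theorem eval_reflAct (r : ℂˣ) {β : AffWeight n} (hβ : β ∈ rootSystem n) (f : Laurent n)
    {x : Fin n → ℂ} (hx : ∀ i, x i ≠ 0) :
    eval (reflAct r β f) x = eval f (reflPoint r β x) := by
  rw [← reflHom_apply r hβ, ← evalHom_apply x hx, ← evalHom_apply _ (reflPoint_ne_zero r β hx)]
  have h : (evalHom x hx).toLinearMap ∘ₗ (reflHom r hβ).toLinearMap
      = (evalHom _ (reflPoint_ne_zero r β hx)).toLinearMap := by
    refine (AddMonoidAlgebra.basis (Fin n → ℤ) ℂ).ext fun mu => ?_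
    simp only [AddMonoidAlgebra.basis_apply, LinearMap.comp_apply, AlgHom.toLinearMap_apply,
      single_eq_smul_mono r mu 1, one_smul, reflHom_mono, evalHom_apply, eval_mono_reflPoint r hβ _ hx]
  exact LinearMap.congr_fun h f

theorem eval_one (x : Fin n → ℂ) : eval (1 : Laurent n) x = 1 := by
  rw [AddMonoidAlgebra.one_def, eval_single]; simp

theorem eval_mul (f g : Laurent n) {x : Fin n → ℂ} (hx : ∀ i, x i ≠ 0) :
    eval (f * g) x = eval f x * eval g x := by
  simp only [← evalHom_apply x hx, map_mul]

theorem eval_add (f g : Laurent n) {x : Fin n → ℂ} (hx : ∀ i, x i ≠ 0) :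
    eval (f + g) x = eval f x + eval g x := by
  simp only [← evalHom_apply x hx, map_add]

theorem eval_sub (f g : Laurent n) {x : Fin n → ℂ} (hx : ∀ i, x i ≠ 0) :
    eval (f - g) x = eval f x - eval g x := by
  simp only [← evalHom_apply x hx, map_sub]

theorem eval_smul (c : ℂ) (f : Laurent n) {x : Fin n → ℂ} (hx : ∀ i, x i ≠ 0) :
    eval (c • f) x = c * eval f x := by
  simp only [← evalHom_apply x hx, map_smul, smul_eq_mul]

theorem eval_vNum (t : Multiplicity n) (r : ℂˣ) (β : AffWeight n) {x : Fin n → ℂ}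
    (hx : ∀ i, x i ≠ 0) : eval (vNum t r β) x =
      if (2 : ℤ) • half β = β then
        (1 - ((t.val β * t.val (half β) : ℂˣ) : ℂ) * eval (mono r (half β)) x) *
          (1 + ((t.val β * (t.val (half β))⁻¹ : ℂˣ) : ℂ) * eval (mono r (half β)) x)
      else 1 - ((t.val β ^ 2 : ℂˣ) : ℂ) * eval (mono r β) x := by
  unfold vNum
  split_ifs <;> simp only [eval_mul _ _ hx, eval_sub _ _ hx, eval_add _ _ hx, eval_smul _ _ hx,
    eval_one]

/-- The monomials transform by duality, and the coefficients agree because `t` is invariant under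
the affine Weyl group. -/
theorem v_reflPoint (t : Multiplicity n) (r : ℂˣ) {a : AffWeight n} (ha : a ∈ rootSystem n)
    (β : AffWeight n) {x : Fin n → ℂ} (hx : ∀ i, x i ≠ 0) :
    v t r β (reflPoint r a x) = v t r (reflect a β) x := by
  have hx' := reflPoint_ne_zero r a hx
  unfold v
  rw [eval_vNum t r β hx', eval_vNum t r _ hx, eval_sub _ _ hx, eval_sub _ _ hx', eval_one,
    eval_one, eval_mono_reflPoint r ha _ hx]
  simp only [two_smul_half_reflect_iff ha, val_reflect t ha]
  split_ifs with h
  · rw [half_reflect ha h, val_reflect t ha, eval_mono_reflPoint r ha _ hx]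
  · rw [eval_mono_reflPoint r ha _ hx]

/-- Here `s_0 ε_1 = δ - ε_1`. Alone among the simple reflections, this one does not preserve the
torus. -/
theorem reflPoint_simpleRoot_zero (r : ℂˣ) (i0 : Fin n) (h0 : (i0 : ℕ) = 0) (x : Fin n → ℂ) :
    reflPoint r (simpleRoot n 0) x = Function.update x i0 ((r : ℂ) ^ 2 / x i0) := by
  have ha : (2 : ℤ) • ((((-1 : ℤˣ) : ℤ) • eps i0, 1) : AffWeight n) ∈ rootSystem n :=
    ((mem_redRoots_iff_exists _).2 (Or.inl ⟨i0, -1, 1, rfl⟩)).1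
  have hf : form (((-1 : ℤˣ) : ℤ) • eps i0, (1 : ℤ)) ((((-1 : ℤˣ) : ℤ) • eps i0, 1) : AffWeight n)
    = 1 := (form_self_eq_one_iff _).2 ⟨i0, -1, rfl⟩
  funext j
  rw [reflPoint, simpleRoot_zero i0 h0, reflect, pairing_eq_of ha (k := -eps j i0)]
  · by_cases hj : j = i0
    · subst hj
      rw [Function.update_self, eval_mono, Finset.prod_eq_single j]
      · have : ((eps j, 0) - (-eps j j) • (2 : ℤ) • ((((-1 : ℤˣ) : ℤ) • eps j, 1) : AffWeight n)).1 j
          = -1 := by simp [eps_apply]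
        rw [this]
        simp [eps_apply, div_eq_mul_inv]
      · intro b _ hb; simp [eps_apply, hb]
      · simp
    · rw [Function.update_of_ne hj, eval_mono, Finset.prod_eq_single j]
      · simp [eps_apply, Ne.symm hj]
      · intro b _ hb; simp [eps_apply, Ne.symm hj, hb]
      · simp
  · rw [form_smul_right, form_smul_left, form_smul_right, hf, form_eps_right]; simp; ring

theorem reflPoint_simpleRoot_last (r : ℂˣ) (i1 : Fin n) (h1 : (i1 : ℕ) + 1 = n) (x : Fin n → ℂ) :
    reflPoint r (simpleRoot n (Fin.last n)) x = Function.update x i1 (x i1)⁻¹ := by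
  have ha : (2 : ℤ) • ((((1 : ℤˣ) : ℤ) • eps i1, 0) : AffWeight n) ∈ rootSystem n :=
    ((mem_redRoots_iff_exists _).2 (Or.inl ⟨i1, 1, 0, rfl⟩)).1
  have hf : form (((1 : ℤˣ) : ℤ) • eps i1, (0 : ℤ)) ((((1 : ℤˣ) : ℤ) • eps i1, 0) : AffWeight n)
    = 1 := (form_self_eq_one_iff _).2 ⟨i1, 1, rfl⟩
  funext j
  rw [reflPoint, simpleRoot_last i1 h1, reflect, pairing_eq_of ha (k := eps j i1)]
  · by_cases hj : j = i1
    · subst hj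
      rw [Function.update_self, eval_mono, Finset.prod_eq_single j]
      · simp [eps_apply]
      · intro b _ hb; simp [eps_apply, hb]
      · simp
    · rw [Function.update_of_ne hj, eval_mono, Finset.prod_eq_single j]
      · simp [eps_apply, Ne.symm hj]
      · intro b _ hb; simp [eps_apply, Ne.symm hj, hb]
      · simp
  · rw [form_smul_right, form_smul_left, form_smul_right, hf, form_eps_right]; simp; ring

theorem reflPoint_simpleRoot_mid (r : ℂˣ) (i : Fin (n + 1)) (hi0 : i ≠ 0) (hin : i ≠ Fin.last n)
    (j j' : Fin n) (hj : (j : ℕ) + 1 = i) (hj' : (j' : ℕ) = i) (x : Fin n → ℂ) :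
    reflPoint r (simpleRoot n i) x = fun k => x (Equiv.swap j j' k) := by
  have hne : j ≠ j' := by rw [Ne, Fin.ext_iff]; omega
  have h1 : simpleRoot n i = (eps j - eps j', 0) := by
    rw [simpleRoot_mid i hi0 hin j j' hj hj']; simp [sub_eq_add_neg]
  have h2 : ∀ k : Fin n, reflect (eps j - eps j', 0) ((eps k, 0) : AffWeight n)
      = (eps (Equiv.swap j j' k), 0) := by
    intro k
    rw [reflect_eps_sub hne]
    by_cases hkj : k = j
    · subst hkj; simp [eps_apply, hne.symm]
    by_cases hkj' : k = j'
    · subst hkj'; simp [eps_apply, hne]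
    · simp [eps_apply, Ne.symm hkj, Ne.symm hkj', Equiv.swap_apply_of_ne_of_ne hkj hkj']
  funext k
  rw [reflPoint, h1, h2, eval_mono, Finset.prod_eq_single (Equiv.swap j j' k)]
  · simp [eps_apply]
  · intro b _ hb; simp [eps_apply, hb]
  · simp

/-! ### The factors of the weight function -/

/-- The unit torus. -/
def torus (n : ℕ) : Set (Fin n → ℂ) := {x | ∀ i, ‖x i‖ = 1}

/-- The points whose first coordinate lies in the annulus `|r|² ≤ |x₁| ≤ 1` and whose other
coordinates have modulus one. -/
def collar (n : ℕ) (r : ℂˣ) : Set (Fin n → ℂ) :=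
  {x | ∀ i, ‖x i‖ ≤ 1 ∧ (if (i : ℕ) = 0 then ‖(r : ℂ)‖ ^ 2 else 1) ≤ ‖x i‖}

/-- The conditions on the parameters. -/
structure Admissible (t : Multiplicity n) (r : ℂˣ) : Prop where
  two_le : 2 ≤ n
  norm_lt_one : ‖(r : ℂ)‖ < 1
  mid_lt_one : ‖(tpar t ⟨1, by omega⟩ : ℂ)‖ < 1
  zero_mul_lt_one : ‖(tpar t 0 : ℂ) * (tparDual t 0 : ℂ)‖ * ‖(r : ℂ)‖ < 1
  zero_div_lt_one : ‖(tpar t 0 : ℂ) * (tparDual t 0 : ℂ)⁻¹‖ * ‖(r : ℂ)‖ < 1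
  last_mul_lt_one : ‖(tpar t (Fin.last n) : ℂ) * (tparDual t (Fin.last n) : ℂ)‖ < 1
  last_div_lt_one : ‖(tpar t (Fin.last n) : ℂ) * (tparDual t (Fin.last n) : ℂ)⁻¹‖ < 1

theorem norm_unit_pos (r : ℂˣ) : 0 < ‖(r : ℂ)‖ := norm_pos_iff.2 r.ne_zero

theorem torus_subset_collar {r : ℂˣ} (hr : ‖(r : ℂ)‖ < 1) : torus n ⊆ collar n r := by
  intro x hx i
  have := hx i
  have := norm_unit_pos r
  refine ⟨by linarith, ?_⟩
  split_ifs
  · nlinarith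
  · linarith

theorem ne_zero_of_mem_collar {r : ℂˣ} {x : Fin n → ℂ} (hx : x ∈ collar n r) (i : Fin n) :
    x i ≠ 0 := by
  have h := (hx i).2
  have := norm_unit_pos r
  rw [← norm_pos_iff]
  split_ifs at h
  · exact lt_of_lt_of_le (by positivity) h
  · linarith

theorem ne_zero_of_mem_torus {x : Fin n → ℂ} (hx : x ∈ torus n) (i : Fin n) : x i ≠ 0 := by
  rw [← norm_pos_iff, hx i]; exact one_pos

theorem eval_mono_eps (r : ℂˣ) (i : Fin n) (c m : ℤ) (x : Fin n → ℂ) :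
    eval (mono r (c • eps i, m)) x = (r : ℂ) ^ m * x i ^ c := by
  rw [eval_mono, Finset.prod_eq_single i]
  · simp [eps_apply]
  · intro b _ hb; simp [eps_apply, hb]
  · simp

theorem eval_mono_eps_add (r : ℂˣ) (i j : Fin n) (c d m : ℤ) {x : Fin n → ℂ} (hx : ∀ i, x i ≠ 0) :
    eval (mono r (c • eps i + d • eps j, m)) x = (r : ℂ) ^ m * x i ^ c * x j ^ d := by
  have h : ((c • eps i + d • eps j, m) : AffWeight n) = (c • eps i, m) + (d • eps j, 0) := by
    simp
  rw [h, eval_mono_add r _ _ hx, eval_mono_eps, eval_mono_eps]; simp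

theorem norm_zpow_unit_le {r : ℂˣ} {x : Fin n → ℂ} (hx : x ∈ collar n r) (i : Fin n) (s : ℤˣ)
    (h : s = 1 ∨ (i : ℕ) ≠ 0 ∨ x ∈ torus n) : ‖x i ^ (s : ℤ)‖ ≤ 1 := by
  rcases Int.units_eq_one_or s with rfl | rfl
  · simpa using (hx i).1
  · have h1 : 1 ≤ ‖x i‖ := by
      rcases h with h | h | h
      · exact absurd h (by decide)
      · simpa [h] using (hx i).2
      · exact (h i).ge
    simpa using inv_le_one_of_one_le₀ h1

/-- On the collar an inverse coordinate costs at most `|r|⁻²`, so two powers of `r` always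
compensate. -/
theorem norm_zpow_unit_mul_sq_le {r : ℂˣ} (hr : ‖(r : ℂ)‖ < 1) {x : Fin n → ℂ}
    (hx : x ∈ collar n r) (i : Fin n) (s : ℤˣ) : ‖x i ^ (s : ℤ)‖ * ‖(r : ℂ)‖ ^ 2 ≤ 1 := by
  have hr0 := norm_unit_pos r
  have hr2 : ‖(r : ℂ)‖ ^ 2 ≤ 1 := pow_le_one₀ hr0.le hr.le
  rcases Int.units_eq_one_or s with rfl | rfl
  · have := (hx i).1
    have h2 : ‖x i ^ ((1 : ℤˣ) : ℤ)‖ = ‖x i‖ := by simp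
    rw [h2]
    exact mul_le_one₀ this (by positivity) hr2
  · have h1 : ‖(r : ℂ)‖ ^ 2 ≤ ‖x i‖ := by
      have := (hx i).2
      split_ifs at this
      · exact this
      · linarith
    have h2 : ‖x i ^ ((-1 : ℤˣ) : ℤ)‖ = ‖x i‖⁻¹ := by simp
    rw [h2, inv_mul_le_iff₀ (by rw [norm_pos_iff]; exact ne_zero_of_mem_collar hx i), mul_one]
    exact h1

/-- The estimates for `x^β` (`β` not divisible by two) or `x^{β/2}` that make the product
converge. -/
theorem norm_long_le {r : ℂˣ} (hr : ‖(r : ℂ)‖ < 1) {x : Fin n → ℂ} (hx : x ∈ collar n r)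
    (i : Fin n) (s : ℤˣ) (m : ℕ) (hs : m = 0 → s = 1)
    (h : (2 : ℤ) • (((s : ℤ) • eps i, (m : ℤ)) : AffWeight n) ≠ simpleRoot n 0 ∨ x ∈ torus n) :
    ‖eval (mono r (((s : ℤ) • eps i, (m : ℤ)) : AffWeight n)) x‖
        ≤ (if Even (m : ℤ) then 1 else ‖(r : ℂ)‖) ∧
      ‖eval (mono r (((s : ℤ) • eps i, (m : ℤ)) : AffWeight n)) x‖
        ≤ ‖(r : ℂ)‖ ^ m / ‖(r : ℂ)‖ ^ 2 := by
  have hr0 := norm_unit_pos r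
  have hsq := norm_zpow_unit_mul_sq_le hr hx i s
  have hnn := norm_nonneg (x i ^ (s : ℤ))
  rw [eval_mono_eps, norm_mul, zpow_natCast, norm_pow]
  refine ⟨?_, ?_⟩
  · by_cases hc : s = 1 ∨ (i : ℕ) ≠ 0 ∨ x ∈ torus n
    · have h1 := norm_zpow_unit_le hx i s hc
      have h2 : ‖(r : ℂ)‖ ^ m ≤ if Even (m : ℤ) then 1 else ‖(r : ℂ)‖ := by
        split_ifs with hm
        · exact pow_le_one₀ hr0.le hr.le
        · refine pow_le_of_le_one hr0.le hr.le ?_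
          rintro rfl; simp at hm
      calc ‖(r : ℂ)‖ ^ m * ‖x i ^ (s : ℤ)‖ ≤ ‖(r : ℂ)‖ ^ m * 1 := by gcongr
        _ ≤ _ := by simpa using h2
    -- What remains is `-ε_1 + (m/2)δ` at a point off the torus. The sign excludes `m = 0`, and `m =
    -- 1` is `a_0 / 2`. Hence `m ≥ 2`, two powers of `r` absorb `x_1⁻¹`, and the exponent left over
    -- keeps the parity of `m`.
    · push Not at hc
      have hm2 : 2 ≤ m ∧ (m ≠ 2 ∨ Even (m : ℤ)) := by
        have hm0 : m ≠ 0 := fun h => hc.1 (hs h)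
        have hm1 : m ≠ 1 := by
          rintro rfl
          have hs1 : s = -1 := (Int.units_eq_one_or s).resolve_left hc.1
          rcases h with h | h
          · exact h (by rw [simpleRoot_zero i hc.2.1, hs1]; rfl)
          · exact hc.2.2 h
        refine ⟨by omega, ?_⟩
        by_cases h : m = 2
        · right; subst h; exact ⟨1, by norm_num⟩
        · exact Or.inl h
      obtain ⟨k, rfl⟩ := Nat.exists_eq_add_of_le hm2.1
      have h2 : ‖(r : ℂ)‖ ^ k ≤ if Even ((2 + k : ℕ) : ℤ) then 1 else ‖(r : ℂ)‖ := by
        split_ifs with hm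
        · exact pow_le_one₀ hr0.le hr.le
        · refine pow_le_of_le_one hr0.le hr.le ?_
          rintro rfl; simp at hm
      calc ‖(r : ℂ)‖ ^ (2 + k) * ‖x i ^ (s : ℤ)‖
          = ‖(r : ℂ)‖ ^ k * (‖x i ^ (s : ℤ)‖ * ‖(r : ℂ)‖ ^ 2) := by ring
        _ ≤ ‖(r : ℂ)‖ ^ k * 1 := by gcongr
        _ ≤ _ := by simpa using h2
  · rw [le_div_iff₀ (by positivity), mul_assoc]
    exact mul_le_of_le_one_right (by positivity) hsq

/-- Since `i < j`, only `x_i` can be the coordinate off the unit circle. A negative sign at `i`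
forces `m ≥ 1`, so `r^{2m}` absorbs it. The decay `|r|^m` is weaker than what holds and matches that
of the long roots. -/
theorem norm_short_le {r : ℂˣ} (hr : ‖(r : ℂ)‖ < 1) {x : Fin n → ℂ} (hx : x ∈ collar n r)
    {i j : Fin n} (hij : i < j) (s s' : ℤˣ) (m : ℕ) (hs : m = 0 → s = 1) :
    ‖eval (mono r (((s : ℤ) • eps i + (s' : ℤ) • eps j, 2 * (m : ℤ)) : AffWeight n)) x‖ ≤ 1 ∧
      ‖eval (mono r (((s : ℤ) • eps i + (s' : ℤ) • eps j, 2 * (m : ℤ)) : AffWeight n)) x‖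
        ≤ ‖(r : ℂ)‖ ^ m / ‖(r : ℂ)‖ ^ 2 := by
  have hr0 := norm_unit_pos r
  have hsq := norm_zpow_unit_mul_sq_le hr hx i s
  have hj : ‖x j ^ (s' : ℤ)‖ ≤ 1 :=
    norm_zpow_unit_le hx j s' (Or.inr (Or.inl (by rw [Fin.lt_def] at hij; omega)))
  have e : (2 * (m : ℤ)) = ((2 * m : ℕ) : ℤ) := by push_cast; ring
  rw [eval_mono_eps_add r i j _ _ _ (ne_zero_of_mem_collar hx), norm_mul, norm_mul, e,
    zpow_natCast, norm_pow]
  have h0 : ‖(r : ℂ)‖ ^ (2 * m) * ‖x i ^ (s : ℤ)‖ * ‖x j ^ (s' : ℤ)‖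
      ≤ ‖(r : ℂ)‖ ^ (2 * m) * ‖x i ^ (s : ℤ)‖ := mul_le_of_le_one_right (by positivity) hj
  refine ⟨h0.trans ?_, h0.trans ?_⟩
  · rcases m.eq_zero_or_pos with rfl | hm
    · have := norm_zpow_unit_le hx i s (Or.inl (hs rfl))
      simpa using this
    · obtain ⟨k, rfl⟩ := Nat.exists_eq_add_of_le hm
      calc ‖(r : ℂ)‖ ^ (2 * (1 + k)) * ‖x i ^ (s : ℤ)‖
          = ‖(r : ℂ)‖ ^ (2 * k) * (‖x i ^ (s : ℤ)‖ * ‖(r : ℂ)‖ ^ 2) := by ring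
        _ ≤ 1 * 1 := by gcongr; exact pow_le_one₀ hr0.le hr.le
        _ = 1 := one_mul 1
  · rw [le_div_iff₀ (by positivity), mul_assoc]
    refine (mul_le_of_le_one_right (by positivity) hsq).trans ?_
    exact pow_le_pow_of_le_one hr0.le hr.le (by omega)

/-- The denominator has modulus at least `(1 - κ)²`, and the deviation has numerator `-w + Ay - By +
(Ay)(By)`. Long roots use `w = y²`; the others use `B = 0` and `w = y`. -/
theorem norm_factor_sub_one_le {A B y w : ℂ} {κ M ρ : ℝ} (hκ : κ < 1) (hA : ‖A * y‖ ≤ κ)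
    (hB : ‖B * y‖ ≤ κ) (hAM : ‖A‖ ≤ M) (hBM : ‖B‖ ≤ M) (hy : ‖y‖ ≤ ρ) (hw : ‖w‖ ≤ ‖y‖) :
    (1 - A * y) * (1 + B * y) ≠ 0 ∧
      ‖(1 - w) / ((1 - A * y) * (1 + B * y)) - 1‖ ≤ (3 * M + 1) / (1 - κ) ^ 2 * ρ := by
  have hκ0 : 0 ≤ κ := (norm_nonneg _).trans hA
  have hM0 : 0 ≤ M := (norm_nonneg _).trans hAM
  have h1 : 1 - κ ≤ ‖1 - A * y‖ := by
    have := norm_sub_norm_le (1 : ℂ) (A * y)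
    rw [norm_one] at this; linarith
  have h2 : 1 - κ ≤ ‖1 + B * y‖ := by
    have := norm_sub_norm_le (1 : ℂ) (-(B * y))
    rw [norm_one, norm_neg, sub_neg_eq_add] at this; linarith
  have h3 : (1 - κ) ^ 2 ≤ ‖(1 - A * y) * (1 + B * y)‖ := by
    rw [norm_mul, sq]
    exact mul_le_mul h1 h2 (by linarith) (norm_nonneg _)
  have hpos : 0 < (1 - κ) ^ 2 := by have : 0 < 1 - κ := by linarith
                                    positivity
  have hne : (1 - A * y) * (1 + B * y) ≠ 0 := by
    rw [← norm_pos_iff]; exact hpos.trans_le h3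
  refine ⟨hne, ?_⟩
  rw [div_sub_one hne, norm_div]
  have hnum : ‖1 - w - (1 - A * y) * (1 + B * y)‖ ≤ (3 * M + 1) * ρ := by
    have e : 1 - w - (1 - A * y) * (1 + B * y) = -w + A * y - B * y + (A * y) * (B * y) := by ring
    have hyρ : 0 ≤ ρ := (norm_nonneg _).trans hy
    have e1 : ‖A * y‖ ≤ M * ρ := by
      rw [norm_mul]; exact mul_le_mul hAM hy (norm_nonneg _) hM0
    have e2 : ‖B * y‖ ≤ M * ρ := by
      rw [norm_mul]; exact mul_le_mul hBM hy (norm_nonneg _) hM0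
    have e3 : ‖(A * y) * (B * y)‖ ≤ M * ρ * 1 := by
      rw [norm_mul]; exact mul_le_mul e1 (hB.trans hκ.le) (norm_nonneg _) (by positivity)
    rw [e]
    calc _ ≤ ‖-w‖ + ‖A * y‖ + ‖B * y‖ + ‖(A * y) * (B * y)‖ :=
          (norm_add_le _ _).trans (by
            gcongr; exact (norm_sub_le _ _).trans (by gcongr; exact norm_add_le _ _))
      _ ≤ _ := by rw [norm_neg]; linarith
  calc _ ≤ (3 * M + 1) * ρ / (1 - κ) ^ 2 :=
        div_le_div₀ ((norm_nonneg _).trans hnum) hnum hpos h3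
    _ = _ := by ring

/-- At `x^β = 1` the conventions `N / 0 = 0` and `0⁻¹ = 0` give the value 0, in agreement with the
quotient on the right. -/
theorem inv_v (t : Multiplicity n) (r : ℂˣ) (β : AffWeight n) {x : Fin n → ℂ}
    (hx : ∀ i, x i ≠ 0) :
    (v t r β x)⁻¹ = (1 - eval (mono r β) x) / eval (vNum t r β) x := by
  rw [v, inv_div, eval_sub _ _ hx, eval_one]

/-- The bounds match the parameter conditions orbit by orbit. For `β = 2γ` with `γ` of odd level,
`|x^γ| ≤ |r|` meets the parameters at `a_0`; at even level, `|x^γ| ≤ 1` meets those at `a_n`; for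
the other roots `|x^β| ≤ 1` meets `t²`. The root `a_0` is excluded off the torus because `v_{a_0}⁻¹`
may have poles in the annulus. -/
theorem exists_factor_bound {t : Multiplicity n} {r : ℂˣ} (h : Admissible t r) :
    ∃ C : ℝ, ∀ β ∈ posRoots n, ∀ x ∈ collar n r, (β ≠ simpleRoot n 0 ∨ x ∈ torus n) →
      eval (vNum t r β) x ≠ 0 ∧ ‖(v t r β x)⁻¹ - 1‖ ≤ C * ‖(r : ℂ)‖ ^ (β.2 / 2).toNat := by
  have hn := h.two_le
  have hr := h.norm_lt_one
  have hr0 := norm_unit_pos r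
  -- `N` lists the moduli of the coefficients on the orbits, and `K` multiplies them by the largest
  -- modulus of the accompanying monomial.
  set N : Fin 5 → ℝ := ![‖(tpar t 0 : ℂ) * (tparDual t 0 : ℂ)‖,
    ‖(tpar t 0 : ℂ) * (tparDual t 0 : ℂ)⁻¹‖,
    ‖(tpar t (Fin.last n) : ℂ) * (tparDual t (Fin.last n) : ℂ)‖,
    ‖(tpar t (Fin.last n) : ℂ) * (tparDual t (Fin.last n) : ℂ)⁻¹‖,
    ‖(tpar t ⟨1, by omega⟩ : ℂ) ^ 2‖] with hN
  set K : Fin 5 → ℝ := ![N 0 * ‖(r : ℂ)‖, N 1 * ‖(r : ℂ)‖, N 2, N 3, N 4] with hK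
  have hK1 : ∀ k, K k < 1 := by
    intro k
    fin_cases k
    · exact h.zero_mul_lt_one
    · exact h.zero_div_lt_one
    · exact h.last_mul_lt_one
    · exact h.last_div_lt_one
    · change ‖(tpar t ⟨1, by omega⟩ : ℂ) ^ 2‖ < 1
      rw [norm_pow]
      exact pow_lt_one₀ (norm_nonneg _) h.mid_lt_one two_ne_zero
  obtain ⟨κ, hκ, hκK⟩ : ∃ κ : ℝ, κ < 1 ∧ ∀ k, K k ≤ κ := by
    refine ⟨Finset.univ.sup' Finset.univ_nonempty K, ?_, fun k =>
      Finset.le_sup' K (Finset.mem_univ k)⟩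
    rw [Finset.sup'_lt_iff]
    exact fun k _ => hK1 k
  obtain ⟨M, hM⟩ : ∃ M : ℝ, ∀ k, N k ≤ M :=
    ⟨Finset.univ.sup' Finset.univ_nonempty N, fun k => Finset.le_sup' N (Finset.mem_univ k)⟩
  have hκ0 : 0 ≤ κ := (norm_nonneg _).trans (hκK 2)
  have hM0 : 0 ≤ M := (norm_nonneg _).trans (hM 0)
  -- The first quotient comes from `norm_factor_sub_one_le`; the division by `|r|²` pays for a
  -- possible `x_1⁻¹` on the collar.
  refine ⟨(3 * M + 1) / (1 - κ) ^ 2 / ‖(r : ℂ)‖ ^ 2, fun β hβ x hx hβx => ?_⟩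
  have hx0 := ne_zero_of_mem_collar hx
  rw [inv_v t r β hx0, eval_vNum t r β hx0]
  have mul_le : ∀ (a y : ℂ) (b c : ℝ), ‖a‖ * b ≤ c → ‖y‖ ≤ b → ‖a * y‖ ≤ c := by
    intro a y b c h1 h2
    rw [norm_mul]
    exact (mul_le_mul_of_nonneg_left h2 (norm_nonneg _)).trans h1
  rcases (mem_posRoots_iff_exists β).1 hβ with
    ⟨i, s, m, hm, hs, rfl⟩ | ⟨i, j, s, s', m, hij, hm, hs, rfl⟩
  · lift m to ℕ using hm
    obtain ⟨b1, b2⟩ := norm_long_le hr hx i s m (fun h => hs (by simp [h])) hβx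
    rw [half_two_smul, if_pos rfl, val_two_smul_eps hn, val_eps hn, eval_mono_zsmul]
    set y := eval (mono r (((s : ℤ) • eps i, (m : ℤ)) : AffWeight n)) x
    have hy1 : ‖y‖ ≤ 1 := b1.trans (by split_ifs; exacts [le_rfl, hr.le])
    have e : (((2 : ℤ) • (((s : ℤ) • eps i, (m : ℤ)) : AffWeight n)).2 / 2).toNat = m := by
      simp
    have hw : ‖y ^ (2 : ℤ)‖ ≤ ‖y‖ := by
      rw [norm_zpow]
      exact pow_le_of_le_one (norm_nonneg _) hy1 two_ne_zero
    rw [e, div_mul_eq_mul_div, mul_div_assoc]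
    split_ifs at b1 ⊢ with hev
    · refine norm_factor_sub_one_le hκ (mul_le _ _ 1 _ ?_ b1) (mul_le _ _ 1 _ ?_ b1) ?_ ?_ b2 hw
      · simpa [N, K] using hκK 2
      · simpa [N, K] using hκK 3
      · simpa [N] using hM 2
      · simpa [N] using hM 3
    · refine norm_factor_sub_one_le hκ (mul_le _ _ _ _ ?_ b1) (mul_le _ _ _ _ ?_ b1) ?_ ?_ b2 hw
      · simpa [N, K] using hκK 0
      · simpa [N, K] using hκK 1
      · simpa [N] using hM 0
      · simpa [N] using hM 1
  · lift m to ℕ using hm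
    obtain ⟨b1, b2⟩ := norm_short_le hr hx hij s s' m (fun h => hs (by simp [h]))
    have hhalf : ¬ (2 : ℤ) • half (((s : ℤ) • eps i + (s' : ℤ) • eps j, 2 * (m : ℤ)) : AffWeight n)
        = ((s : ℤ) • eps i + (s' : ℤ) • eps j, 2 * (m : ℤ)) := by
      rw [two_smul_half_iff]
      rintro ⟨γ, hγ⟩
      have := congrFun (congrArg Prod.fst hγ) i
      rcases Int.units_eq_one_or s with rfl | rfl
      · simp [eps_apply, hij.ne] at this; omega
      · simp [eps_apply, hij.ne] at this; omega
    rw [if_neg hhalf, val_eps_add hn t hij.ne]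
    set y := eval (mono r (((s : ℤ) • eps i + (s' : ℤ) • eps j, 2 * (m : ℤ)) : AffWeight n)) x
    have e : ((((s : ℤ) • eps i + (s' : ℤ) • eps j, 2 * (m : ℤ)) : AffWeight n).2 / 2).toNat
        = m := by simp
    rw [e, div_mul_eq_mul_div, mul_div_assoc]
    have key := norm_factor_sub_one_le (A := ((tpar t ⟨1, by omega⟩ ^ 2 : ℂˣ) : ℂ)) (B := 0)
      (M := M) hκ (mul_le _ y 1 _ (by simpa [N, K] using hκK 4) b1) (by simpa using hκ0)
      (by simpa [N] using hM 4) (by simpa using hM0) b2 le_rfl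
    simpa only [zero_mul, add_zero, mul_one] using key

/-! ### Summability over the positive roots. -/

theorem abs_le_two_of_mem_redRoots {β : AffWeight n} (hβ : β ∈ redRoots n) :
    β.1 ∈ Set.Icc (fun _ => -2 : Fin n → ℤ) (fun _ => 2) := by
  have hform : form β β ≤ 4 := by
    rcases (mem_redRoots_iff β).1 hβ with ⟨γ, h1, rfl⟩ | ⟨h1, -⟩
    · rw [form_smul_left, form_smul_right, h1]; norm_num
    · omega
  have hk : ∀ k, β.1 k * β.1 k ≤ 4 := fun k =>
    (Finset.single_le_sum (f := fun k => β.1 k * β.1 k) (fun k _ => mul_self_nonneg _)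
      (Finset.mem_univ k)).trans hform
  exact ⟨fun k => by have := hk k; simp only; nlinarith,
    fun k => by have := hk k; simp only; nlinarith⟩

/-- Finitely many gradients occur, and along each of them the series is dominated by a geometric
one. Halving the level loses nothing because levels in `R⁺` are even and nonnegative. -/
theorem summable_pow_level {ρ : ℝ} (h0 : 0 ≤ ρ) (h1 : ρ < 1) :
    Summable fun β : posRoots n => ρ ^ ((β : AffWeight n).2 / 2).toNat := by
  have hs : Summable fun p : (Set.Icc (fun _ => -2 : Fin n → ℤ) (fun _ => 2)) × ℕ => ρ ^ p.2 := by
    have := (summable_of_hasFiniteSupport (f := fun _ :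
      (Set.Icc (fun _ => -2 : Fin n → ℤ) (fun _ => 2)) => (1 : ℝ)) (Set.toFinite _)).mul_of_nonneg
      (summable_geometric_of_lt_one h0 h1) (fun _ => zero_le_one) (fun k => pow_nonneg h0 k)
    simpa using this
  refine hs.comp_injective (i := fun β : posRoots n =>
    (⟨(β : AffWeight n).1, abs_le_two_of_mem_redRoots ((mem_posRoots_iff _).1 β.2).1⟩,
      ((β : AffWeight n).2 / 2).toNat)) ?_
  have hlev : ∀ β : posRoots n, ∃ m : ℕ, (β : AffWeight n).2 = 2 * m := by
    rintro ⟨β, hβ⟩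
    rcases (mem_posRoots_iff_exists β).1 hβ with
      ⟨i, s, m, hm, hs, rfl⟩ | ⟨i, j, s, s', m, hij, hm, hs, rfl⟩
    · exact ⟨m.toNat, by simp [hm]⟩
    · exact ⟨m.toNat, by simp [hm]⟩
  intro β γ h
  obtain ⟨m, hm⟩ := hlev β
  obtain ⟨k, hk⟩ := hlev γ
  simp only [Prod.mk.injEq, Subtype.mk.injEq, hm, hk] at h
  apply Subtype.ext
  refine Prod.ext h.1 ?_
  have := h.2
  rw [hm, hk]
  omega

/-! ### The weight function with one factor removed -/

open Classical in
/-- The deviation from `1` of the factor at `β` of the weight function, if `β` is a positive root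
other than `a`. -/
def deviation (t : Multiplicity n) (r : ℂˣ) (a β : AffWeight n) (x : Fin n → ℂ) : ℂ :=
  if β ∈ posRoots n ∧ β ≠ a then (v t r β x)⁻¹ - 1 else 0

/-- The product of the factors of the weight function other than that at `a`. -/
def cofactor (t : Multiplicity n) (r : ℂˣ) (a : AffWeight n) (x : Fin n → ℂ) : ℂ :=
  ∏' β, (1 + deviation t r a β x)

theorem zero_notMem_posRoots : (0 : AffWeight n) ∉ posRoots n := by
  intro h
  have := form_self_pos (((mem_posRoots_iff _).1 h).1).1
  simp [form] at this

/-- The weight 0 is not a root, so removing it removes no factor; `Delta` thereby inherits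
everything shown for `cofactor`. -/
theorem Delta_eq_cofactor (t : Multiplicity n) (r : ℂˣ) (x : Fin n → ℂ) :
    Delta t r x = cofactor t r 0 x := by
  classical
  rw [Delta, cofactor, tprod_subtype (posRoots n) (fun β => (v t r β x)⁻¹)]
  refine tprod_congr fun β => ?_
  by_cases hβ : β ∈ posRoots n
  · have h0 : β ≠ 0 := by rintro rfl; exact zero_notMem_posRoots hβ
    simp [deviation, hβ, h0]
  · simp [deviation, hβ]

/-- A single majorant, independent of the point, gives uniform convergence. Off the torus only the
cofactor of `a_0` is controlled. -/
theorem exists_summable_deviation_bound {t : Multiplicity n} {r : ℂˣ} (h : Admissible t r) :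
    ∃ u : AffWeight n → ℝ, Summable u ∧ ∀ a β, ∀ x ∈ collar n r,
      (a = simpleRoot n 0 ∨ x ∈ torus n) → ‖deviation t r a β x‖ ≤ u β := by
  classical
  obtain ⟨C, hC⟩ := exists_factor_bound h
  have hs := (summable_pow_level (n := n) (norm_nonneg (r : ℂ)) h.norm_lt_one).mul_left |C|
  refine ⟨(posRoots n).indicator fun β => |C| * ‖(r : ℂ)‖ ^ (β.2 / 2).toNat,
    summable_subtype_iff_indicator.1 hs, fun a β x hx hax => ?_⟩
  unfold deviation
  split_ifs with hβ
  · rw [Set.indicator_of_mem hβ.1]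
    refine (hC β hβ.1 x hx ?_).2.trans ?_
    · rcases hax with rfl | hax
      · exact Or.inl hβ.2
      · exact Or.inr hax
    · gcongr; exact le_abs_self C
  · rw [norm_zero]
    exact Set.indicator_nonneg (fun β _ => by positivity) β

theorem vNum_ne_zero {t : Multiplicity n} {r : ℂˣ} (h : Admissible t r) {β : AffWeight n}
    (hβ : β ∈ posRoots n) {x : Fin n → ℂ} (hx : x ∈ collar n r)
    (hβx : β ≠ simpleRoot n 0 ∨ x ∈ torus n) : eval (vNum t r β) x ≠ 0 := by
  obtain ⟨C, hC⟩ := exists_factor_bound h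
  exact (hC β hβ x hx hβx).1

theorem summable_deviation {t : Multiplicity n} {r : ℂˣ} (h : Admissible t r) (a : AffWeight n)
    {x : Fin n → ℂ} (hx : x ∈ torus n) : Summable fun β => ‖deviation t r a β x‖ := by
  obtain ⟨u, hu, hb⟩ := exists_summable_deviation_bound h
  exact hu.of_nonneg_of_le (fun _ => norm_nonneg _)
    fun β => hb a β x (torus_subset_collar h.norm_lt_one hx) (Or.inr hx)

theorem multipliable_factors {t : Multiplicity n} {r : ℂˣ} (h : Admissible t r)
    {x : Fin n → ℂ} (hx : x ∈ torus n) :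
    Multipliable fun β : posRoots n => (v t r β x)⁻¹ := by
  have h1 : Summable fun β : posRoots n => ‖deviation t r 0 β x‖ :=
    (summable_deviation h 0 hx).comp_injective Subtype.val_injective
  refine (multipliable_one_add_of_summable h1).congr fun β => ?_
  have h0 : (β : AffWeight n) ≠ 0 := by
    intro h; exact zero_notMem_posRoots (h ▸ β.2)
  simp [deviation, h0]

theorem Delta_eq_mul_cofactor {t : Multiplicity n} {r : ℂˣ} (h : Admissible t r)
    {a : AffWeight n} (ha : a ∈ posRoots n) {x : Fin n → ℂ} (hx : x ∈ torus n) :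
    Delta t r x = (v t r a x)⁻¹ * cofactor t r a x := by
  classical
  have ha0 : a ≠ 0 := by rintro rfl; exact zero_notMem_posRoots ha
  have hupd : Function.update (fun β => 1 + deviation t r 0 β x) a 1
      = fun β => 1 + deviation t r a β x := by
    funext β
    by_cases hβ : β = a
    · subst hβ; simp [deviation]
    · rw [Function.update_of_ne hβ]
      by_cases hp : β ∈ posRoots n
      · have h0 : β ≠ 0 := by rintro rfl; exact zero_notMem_posRoots hp
        simp [deviation, hp, hβ, h0]
      · simp [deviation, hp]
  -- Convergence is required only for the product with the factor at `a` replaced by 1, so that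
  -- factor, which may vanish, is never divided by.
  rw [Delta_eq_cofactor, cofactor, Multipliable.tprod_eq_mul_tprod_ite' a
    (by rw [hupd]; exact multipliable_one_add_of_summable (summable_deviation h a hx))]
  congr 1
  · simp [deviation, ha, ha0]
  · rw [cofactor, ← hupd]
    refine tprod_congr fun β => ?_
    simp [Function.update_apply]

/-- Reindexing the product by `s_i` is legitimate because it permutes `R⁺ \ {a_i}`, and `v_β ∘ s_i =
v_{s_i β}`. -/
theorem cofactor_reflPoint (hn : 2 ≤ n) (t : Multiplicity n) (r : ℂˣ) (i : Fin (n + 1))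
    {x : Fin n → ℂ} (hx : ∀ i, x i ≠ 0) :
    cofactor t r (simpleRoot n i) (reflPoint r (simpleRoot n i) x)
      = cofactor t r (simpleRoot n i) x := by
  classical
  have ha := simpleRoot_mem hn i
  let e : AffWeight n ≃ AffWeight n :=
    Function.Involutive.toPerm (reflect (simpleRoot n i)) (reflect_reflect ha)
  rw [cofactor, cofactor, ← e.tprod_eq (fun β => 1 + deviation t r (simpleRoot n i) β x)]
  refine tprod_congr fun β => ?_
  change _ = 1 + deviation t r (simpleRoot n i) (reflect (simpleRoot n i) β) x
  simp only [deviation, reflect_simpleRoot_mem_iff hn, v_reflPoint t r ha β hx]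

/-! ### Regularity -/

theorem eval_eq_sum (f : Laurent n) (x : Fin n → ℂ) :
    eval f x = ∑ mu ∈ f.coeff.support, f.coeff mu * ∏ i, x i ^ mu i := rfl

theorem continuousOn_eval (f : Laurent n) {K : Set (Fin n → ℂ)} (hK : ∀ x ∈ K, ∀ i, x i ≠ 0) :
    ContinuousOn (eval f) K := by
  have : eval f = fun x => ∑ mu ∈ f.coeff.support, f.coeff mu * ∏ i, x i ^ mu i := rfl
  rw [this]
  refine continuousOn_finsetSum _ fun mu _ => continuousOn_const.mul ?_
  refine continuousOn_finsetProd _ fun i _ => ?_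
  exact (continuous_apply i).continuousOn.zpow₀ _ fun x hx => Or.inl (hK x hx i)

theorem differentiableAt_eval_update (f : Laurent n) (x : Fin n → ℂ) (i0 : Fin n) {z : ℂ}
    (hz : z ≠ 0) : DifferentiableAt ℂ (fun z => eval f (Function.update x i0 z)) z := by
  have : (fun z => eval f (Function.update x i0 z))
      = fun z => ∑ mu ∈ f.coeff.support,
        f.coeff mu * ∏ i, Function.update x i0 z i ^ mu i := rfl
  rw [this]
  refine DifferentiableAt.fun_sum fun mu _ => DifferentiableAt.const_mul ?_ _
  refine DifferentiableAt.fun_finsetProd fun i _ => ?_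
  by_cases hi : i = i0
  · subst hi
    simp only [Function.update_self]
    exact differentiableAt_zpow.2 (Or.inl hz)
  · simp only [Function.update_of_ne hi]
    exact differentiableAt_const _

theorem continuousOn_deviation {t : Multiplicity n} {r : ℂˣ} (h : Admissible t r)
    (a β : AffWeight n) {K : Set (Fin n → ℂ)} (hK : K ⊆ collar n r)
    (haK : a = simpleRoot n 0 ∨ K ⊆ torus n) : ContinuousOn (deviation t r a β) K := by
  unfold deviation
  split_ifs with hβ
  · have hK0 : ∀ x ∈ K, ∀ i, x i ≠ 0 := fun x hx => ne_zero_of_mem_collar (hK hx)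
    have h1 : ContinuousOn (fun x => (1 - eval (mono r β) x) / eval (vNum t r β) x - 1) K := by
      refine (ContinuousOn.div (continuousOn_const.sub (continuousOn_eval _ hK0))
        (continuousOn_eval _ hK0) fun x hx => ?_).sub continuousOn_const
      refine vNum_ne_zero h hβ.1 (hK hx) ?_
      rcases haK with rfl | haK
      · exact Or.inl hβ.2
      · exact Or.inr (haK hx)
    exact h1.congr fun x hx => by simp only [inv_v t r β (hK0 x hx)]
  · exact continuousOn_const

theorem continuousOn_cofactor {t : Multiplicity n} {r : ℂˣ} (h : Admissible t r)
    (a : AffWeight n) {K : Set (Fin n → ℂ)} (hc : IsCompact K) (hK : K ⊆ collar n r)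
    (haK : a = simpleRoot n 0 ∨ K ⊆ torus n) : ContinuousOn (cofactor t r a) K := by
  obtain ⟨u, hu, hb⟩ := exists_summable_deviation_bound h
  have h1 := Summable.hasProdUniformlyOn_one_add (f := fun β x => deviation t r a β x) hc hu
    (Filter.Eventually.of_forall fun β x hx => hb a β x (hK hx) (haK.imp_right fun h => h hx))
    (fun β => continuousOn_deviation h a β hK haK)
  rw [hasProdUniformlyOn_iff_tendstoUniformlyOn] at h1
  refine h1.continuousOn (Filter.Frequently.of_forall fun s => ?_)
  exact continuousOn_finsetProd _ fun β _ =>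
    continuousOn_const.add (continuousOn_deviation h a β hK haK)

/-- A locally uniform limit of holomorphic finite products is holomorphic. -/
theorem differentiableOn_cofactor_update {t : Multiplicity n} {r : ℂˣ} (h : Admissible t r)
    (i0 : Fin n) (x : Fin n → ℂ) {U : Set ℂ} (hU : IsOpen U)
    (hx : ∀ z ∈ U, Function.update x i0 z ∈ collar n r) :
    DifferentiableOn ℂ (fun z => cofactor t r (simpleRoot n 0) (Function.update x i0 z)) U := by
  classical
  obtain ⟨u, hu, hb⟩ := exists_summable_deviation_bound h
  have hd : ∀ β, DifferentiableOn ℂ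
      (fun z => deviation t r (simpleRoot n 0) β (Function.update x i0 z)) U := by
    intro β
    unfold deviation
    split_ifs with hβ
    · have hz0 : ∀ z ∈ U, z ≠ 0 := fun z hz => by
        have := ne_zero_of_mem_collar (hx z hz) i0
        rwa [Function.update_self] at this
      have h1 : DifferentiableOn ℂ (fun z => (1 - eval (mono r β) (Function.update x i0 z)) /
          eval (vNum t r β) (Function.update x i0 z) - 1) U := by
        intro z hz
        refine DifferentiableAt.differentiableWithinAt ?_
        refine (DifferentiableAt.div ((differentiableAt_const _).sub
          (differentiableAt_eval_update _ x i0 (hz0 z hz)))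
          (differentiableAt_eval_update _ x i0 (hz0 z hz)) ?_).sub (differentiableAt_const _)
        exact vNum_ne_zero h hβ.1 (hx z hz) (Or.inl hβ.2)
      exact h1.congr fun z hz => by rw [inv_v t r β (ne_zero_of_mem_collar (hx z hz))]
    · exact differentiableOn_const _
  have h1 := Summable.hasProdLocallyUniformlyOn_one_add
    (f := fun β z => deviation t r (simpleRoot n 0) β (Function.update x i0 z)) hU hu
    (Filter.Eventually.of_forall fun β z hz => hb _ β _ (hx z hz) (Or.inl rfl))
    (fun β => (hd β).continuousOn)
  rw [hasProdLocallyUniformlyOn_iff_tendstoLocallyUniformlyOn] at h1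
  refine h1.differentiableOn (Filter.Eventually.of_forall fun s => ?_) hU
  exact DifferentiableOn.fun_finsetProd fun β _ => (differentiableOn_const _).add (hd β)

theorem isCompact_torus : IsCompact (torus n) := by
  have : torus n = Set.pi Set.univ fun _ => Metric.sphere (0 : ℂ) 1 := by
    ext x; simp [torus]
  rw [this]
  exact isCompact_univ_pi fun _ => isCompact_sphere _ _

theorem isCompact_collar (r : ℂˣ) : IsCompact (collar n r) := by
  have : collar n r = Set.pi Set.univ fun i : Fin n => Metric.closedBall (0 : ℂ) 1 ∩
      {z | (if (i : ℕ) = 0 then ‖(r : ℂ)‖ ^ 2 else 1) ≤ ‖z‖} := by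
    ext x; simp [collar]
  rw [this]
  exact isCompact_univ_pi fun _ => (isCompact_closedBall _ _).inter_right
    (isClosed_le continuous_const continuous_norm)

/-! ### Integration over the torus -/

/-- The integral over the torus with respect to the Haar measure of total mass `(2π)ⁿ`. -/
def haarIntegral (G : (Fin n → ℂ) → ℂ) : ℂ :=
  ∫ θ : Fin n → ℝ in Set.Icc 0 fun _ => 2 * Real.pi, G (torusMap 0 (fun _ => 1) θ)

theorem torusMap_mem (θ : Fin n → ℝ) : torusMap 0 (fun _ => 1) θ ∈ torus n := by
  intro i
  simp [torusMap, Complex.norm_exp_ofReal_mul_I]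

theorem continuous_comp_torusMap {G : (Fin n → ℂ) → ℂ} (hG : ContinuousOn G (torus n)) :
    Continuous fun θ => G (torusMap 0 (fun _ => 1) θ) := by
  refine hG.comp_continuous ?_ torusMap_mem
  unfold torusMap
  fun_prop

theorem integrableOn_comp_torusMap {G : (Fin n → ℂ) → ℂ} (hG : ContinuousOn G (torus n)) :
    IntegrableOn (fun θ => G (torusMap 0 (fun _ => 1) θ))
      (Set.Icc 0 fun _ => 2 * Real.pi) volume :=
  (continuous_comp_torusMap hG).integrableOn_Icc

theorem haarIntegral_sub {G H : (Fin n → ℂ) → ℂ} (hG : ContinuousOn G (torus n))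
    (hH : ContinuousOn H (torus n)) :
    haarIntegral (fun x => G x - H x) = haarIntegral G - haarIntegral H :=
  integral_sub (integrableOn_comp_torusMap hG) (integrableOn_comp_torusMap hH)

theorem haarIntegral_add {G H : (Fin n → ℂ) → ℂ} (hG : ContinuousOn G (torus n))
    (hH : ContinuousOn H (torus n)) :
    haarIntegral (fun x => G x + H x) = haarIntegral G + haarIntegral H :=
  integral_add (integrableOn_comp_torusMap hG) (integrableOn_comp_torusMap hH)

theorem haarIntegral_const_mul (c : ℂ) (G : (Fin n → ℂ) → ℂ) :
    haarIntegral (fun x => c * G x) = c * haarIntegral G :=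
  integral_const_mul _ _

theorem haarIntegral_congr {G H : (Fin n → ℂ) → ℂ} (h : ∀ x ∈ torus n, G x = H x) :
    haarIntegral G = haarIntegral H := by
  unfold haarIntegral
  congr 1
  funext θ
  exact h _ (torusMap_mem θ)

theorem volume_restrict_Icc :
    (volume : Measure (Fin n → ℝ)).restrict (Set.Icc 0 fun _ => 2 * Real.pi)
      = Measure.pi fun _ => (volume : Measure ℝ).restrict (Set.Icc 0 (2 * Real.pi)) := by
  rw [← Measure.restrict_pi_pi, ← volume_pi, Set.pi_univ_Icc]
  rfl

theorem haarIntegral_comp_perm (G : (Fin n → ℂ) → ℂ) (σ : Equiv.Perm (Fin n)) : haarIntegral (fun x => G fun k => x (σ k)) = haarIntegral G := by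
  unfold haarIntegral
  rw [volume_restrict_Icc]
  have hmp := measurePreserving_piCongrLeft
    (fun _ : Fin n => (volume : Measure ℝ).restrict (Set.Icc 0 (2 * Real.pi))) σ.symm
  conv_rhs => rw [← hmp.integral_comp']
  congr 1
  funext θ
  refine congrArg G ?_
  funext k
  have : (MeasurableEquiv.piCongrLeft (fun _ : Fin n => ℝ) σ.symm) θ k = θ (σ k) := by
    conv_lhs => rw [← σ.symm_apply_apply k]
    exact Equiv.piCongrLeft_apply_apply (fun _ : Fin n => ℝ) σ.symm θ (σ k)
  simp [torusMap, this]

theorem exp_two_pi_sub (t : ℝ) :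
    Complex.exp (((2 * Real.pi - t : ℝ) : ℂ) * Complex.I)
      = (Complex.exp ((t : ℂ) * Complex.I))⁻¹ := by
  rw [← Complex.exp_neg, ← Complex.exp_periodic (-((t : ℂ) * Complex.I))]
  congr 1
  push_cast
  ring

theorem haarIntegral_comp_inv {G : (Fin n → ℂ) → ℂ} (hG : ContinuousOn G (torus n))
    (i1 : Fin n) : haarIntegral (fun x => G (Function.update x i1 (x i1)⁻¹)) = haarIntegral G := by
  unfold haarIntegral
  rw [volume_restrict_Icc]
  set μ := (volume : Measure ℝ).restrict (Set.Icc 0 (2 * Real.pi)) with hμ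
  have h1 : MeasurePreserving (fun t : ℝ => 2 * Real.pi - t) μ μ := by
    have h := (Measure.measurePreserving_sub_left (volume : Measure ℝ) (2 * Real.pi)).restrict_preimage
      (measurableSet_Icc (a := (0 : ℝ)) (b := 2 * Real.pi))
    rwa [Set.preimage_const_sub_Icc, sub_zero, sub_self] at h
  have hmp := measurePreserving_pi (fun _ : Fin n => μ) (fun _ => μ)
    (f := fun i t => if i = i1 then 2 * Real.pi - t else t) (fun i => by
      by_cases hi : i = i1
      · simpa [hi] using h1
      · simp only [hi, if_false]; exact MeasurePreserving.id μ)
  conv_rhs => rw [← hmp.map_eq]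
  rw [integral_map hmp.measurable.aemeasurable
    (continuous_comp_torusMap hG).aestronglyMeasurable]
  congr 1
  funext θ
  refine congrArg G ?_
  funext k
  by_cases hk : k = i1
  · subst hk
    have := exp_two_pi_sub (θ k)
    push_cast at this
    simp [torusMap, this]
  · simp [torusMap, hk]

/-- By Cauchy's theorem `∮ g dz/z` is the same over `|z| = 1` and `|z| = q`; reversing the angle on
the inner circle produces `q / e^{it}`. -/
theorem integral_annulus {g : ℂ → ℂ} {q : ℝ} (hq0 : 0 < q) (hq1 : q < 1)
    (hc : ContinuousOn g {z | q ≤ ‖z‖ ∧ ‖z‖ ≤ 1})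
    (hd : DifferentiableOn ℂ g {z | q < ‖z‖ ∧ ‖z‖ < 1}) :
    ∫ t in Set.Icc 0 (2 * Real.pi), g (Complex.exp ((t : ℂ) * Complex.I))
      = ∫ t in Set.Icc 0 (2 * Real.pi), g (q / Complex.exp ((t : ℂ) * Complex.I)) := by
  have hopen : IsOpen {z : ℂ | q < ‖z‖ ∧ ‖z‖ < 1} :=
    (isOpen_lt continuous_const continuous_norm).inter (isOpen_lt continuous_norm continuous_const)
  have key := Complex.circleIntegral_sub_center_inv_smul_eq_of_differentiable_on_annulus_off_countable
    (c := 0) hq0 hq1.le (f := g) Set.countable_empty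
    (hc.mono fun z hz => by simpa [and_comm] using hz)
    (fun z hz => hd.differentiableAt (hopen.mem_nhds (by simpa [and_comm] using hz)))
  have hcirc : ∀ R : ℝ, 0 < R → (∮ z in C(0, R), (z - 0)⁻¹ • g z)
      = Complex.I * ∫ t in (0 : ℝ)..2 * Real.pi, g (R * Complex.exp ((t : ℂ) * Complex.I)) := by
    intro R hR
    rw [circleIntegral, ← intervalIntegral.integral_const_mul]
    congr 1
    funext t
    have hne : circleMap 0 R t ≠ 0 := circleMap_ne_center hR.ne'
    rw [deriv_circleMap, sub_zero, smul_eq_mul, smul_eq_mul, mul_assoc, mul_left_comm,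
      ← mul_assoc (circleMap 0 R t), mul_inv_cancel₀ hne, one_mul, circleMap_zero]
  rw [hcirc 1 one_pos, hcirc q hq0] at key
  have key2 := mul_left_cancel₀ Complex.I_ne_zero key
  have hle : (0 : ℝ) ≤ 2 * Real.pi := by positivity
  rw [integral_Icc_eq_integral_Ioc, integral_Icc_eq_integral_Ioc,
    ← intervalIntegral.integral_of_le hle, ← intervalIntegral.integral_of_le hle]
  simp only [Complex.ofReal_one, one_mul] at key2
  rw [key2]
  have h3 := intervalIntegral.integral_comp_sub_left (a := 0) (b := 2 * Real.pi)
    (fun t : ℝ => g (q * Complex.exp ((t : ℂ) * Complex.I))) (2 * Real.pi)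
  rw [sub_self, sub_zero] at h3
  rw [← h3]
  congr 1
  funext t
  rw [exp_two_pi_sub, div_eq_mul_inv]

theorem torusMap_cons {k : ℕ} (t : ℝ) (θ : Fin k → ℝ) :
    torusMap 0 (fun _ => 1) (Fin.cons t θ : Fin (k + 1) → ℝ)
      = Fin.cons (Complex.exp ((t : ℂ) * Complex.I)) (torusMap 0 (fun _ => 1) θ) := by
  funext j
  refine Fin.cases ?_ (fun j => ?_) j <;> simp [torusMap]

/-- Fubini isolates the first angle, and `integral_annulus` treats the inner integral; holomorphy in
the first variable alone suffices. -/
theorem haarIntegral_shift_succ {k : ℕ} {r : ℂˣ} {q : ℝ} (hq0 : 0 < q) (hq1 : q < 1)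
    (hr : (r : ℂ) ^ 2 = q) {G : (Fin (k + 1) → ℂ) → ℂ} (hc : ContinuousOn G (collar (k + 1) r))
    (hd : ∀ x ∈ torus (k + 1), DifferentiableOn ℂ (fun z => G (Function.update x 0 z))
      {z | q < ‖z‖ ∧ ‖z‖ < 1}) :
    haarIntegral (fun x => G (Function.update x 0 ((r : ℂ) ^ 2 / x 0))) = haarIntegral G := by
  have hρ : ‖(r : ℂ)‖ ^ 2 = q := by
    rw [← norm_pow, hr, Complex.norm_real, Real.norm_of_nonneg hq0.le]
  have hmem : ∀ x ∈ torus (k + 1), ∀ z : ℂ, q ≤ ‖z‖ ∧ ‖z‖ ≤ 1 →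
      Function.update x 0 z ∈ collar (k + 1) r := by
    intro x hx z hz i
    by_cases hi : i = 0
    · subst hi
      simp only [Function.update_self, Fin.val_zero, if_true, hρ]
      exact ⟨hz.2, hz.1⟩
    · have hi' : ¬ ((i : ℕ) = 0) := fun h => hi (Fin.ext h)
      rw [Function.update_of_ne hi, if_neg hi', hx i]
      exact ⟨le_rfl, le_rfl⟩
  have hr1 : ‖(r : ℂ)‖ < 1 := by
    have := norm_nonneg (r : ℂ)
    nlinarith
  have hG : ContinuousOn G (torus (k + 1)) := hc.mono (torus_subset_collar hr1)
  have hGs : ContinuousOn (fun x : Fin (k + 1) → ℂ => G (Function.update x 0 ((r : ℂ) ^ 2 / x 0)))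
      (torus (k + 1)) := by
    refine hc.comp ?_ fun x hx => hmem x hx _ ?_
    · refine continuousOn_pi.2 fun j => ?_
      by_cases hj : j = 0
      · subst hj
        simp only [Function.update_self]
        exact continuousOn_const.div (continuous_apply 0).continuousOn
          fun x hx => ne_zero_of_mem_torus hx 0
      · simp only [Function.update_of_ne hj]
        exact (continuous_apply j).continuousOn
    · rw [hr, norm_div, hx 0, Complex.norm_real, Real.norm_of_nonneg hq0.le, div_one]
      exact ⟨le_rfl, hq1.le⟩
  set μ := (volume : Measure ℝ).restrict (Set.Icc 0 (2 * Real.pi)) with hμ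
  have fubini : ∀ H : (Fin (k + 1) → ℂ) → ℂ, ContinuousOn H (torus (k + 1)) →
      haarIntegral H = ∫ θ : Fin k → ℝ, ∫ t : ℝ,
        H (Fin.cons (Complex.exp ((t : ℂ) * Complex.I)) (torusMap 0 (fun _ => 1) θ)) ∂μ
          ∂(Measure.pi fun _ => μ) := by
    intro H hH
    have hmp := (measurePreserving_piFinSuccAbove (fun _ : Fin (k + 1) => μ) 0).symm
    have hint := integrableOn_comp_torusMap hH
    rw [IntegrableOn, volume_restrict_Icc, ← hmp.integrable_comp_emb
      (MeasurableEquiv.measurableEmbedding _)] at hint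
    rw [haarIntegral, volume_restrict_Icc, ← hmp.integral_comp']
    refine (integral_prod_symm _ hint).trans ?_
    congr 1
    funext θ
    congr 1
    funext t
    rw [← torusMap_cons]
    exact congrArg (fun y => H (torusMap 0 (fun _ => 1) y)) (Fin.insertNth_zero' t θ)
  rw [fubini _ hG, fubini _ hGs]
  congr 1
  funext θ
  have hx : (Fin.cons 1 (torusMap 0 (fun _ => 1) θ) : Fin (k + 1) → ℂ) ∈ torus (k + 1) := by
    intro j
    refine Fin.cases ?_ (fun j => ?_) j
    · simp
    · simpa using torusMap_mem θ j
  have := integral_annulus (g := fun z => G (Fin.cons z (torusMap 0 (fun _ => 1) θ))) hq0 hq1 ?_ ?_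
  · rw [hμ, this]
    simp only [Fin.update_cons_zero, Fin.cons_zero, hr]
  · refine hc.comp (t := collar (k + 1) r) ?_ fun z hz => ?_
    · refine continuousOn_pi.2 fun j => ?_
      refine Fin.cases ?_ (fun j => ?_) j
      · simp only [Fin.cons_zero]; exact continuousOn_id
      · simpa using continuousOn_const
    · have := hmem _ hx z hz
      rwa [Fin.update_cons_zero] at this
  · have := hd _ hx
    simpa only [Fin.update_cons_zero] using this

theorem haarIntegral_shift {r : ℂˣ} {q : ℝ} (hq0 : 0 < q) (hq1 : q < 1)
    (hr : (r : ℂ) ^ 2 = q) (i0 : Fin n) (hi0 : (i0 : ℕ) = 0) {G : (Fin n → ℂ) → ℂ}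
    (hc : ContinuousOn G (collar n r))
    (hd : ∀ x ∈ torus n, DifferentiableOn ℂ (fun z => G (Function.update x i0 z))
      {z | q < ‖z‖ ∧ ‖z‖ < 1}) :
    haarIntegral (fun x => G (Function.update x i0 ((r : ℂ) ^ 2 / x i0))) = haarIntegral G := by
  obtain ⟨k, rfl⟩ : ∃ k, n = k + 1 := ⟨n - 1, by have := i0.2; omega⟩
  obtain rfl : i0 = 0 := Fin.ext hi0
  exact haarIntegral_shift_succ hq0 hq1 hr hc hd

/-! ### Fourier series -/

/-- The point of the torus with given angles. -/
def circlePoint (u : UnitAddTorus (Fin n)) : Fin n → ℂ := fun i => (u i).toCircle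

theorem circlePoint_mem (u : UnitAddTorus (Fin n)) : circlePoint u ∈ torus n := by
  intro i; exact Circle.norm_coe _

theorem continuous_circlePoint : Continuous (circlePoint (n := n)) := by
  refine continuous_pi fun i => ?_
  exact continuous_subtype_val.comp (AddCircle.continuous_toCircle.comp (continuous_apply i))

theorem exists_circlePoint {x : Fin n → ℂ} (hx : x ∈ torus n) :
    ∃ u, circlePoint u = x := by
  have h : ∀ i, ∃ u : AddCircle (1 : ℝ), ((u.toCircle : Circle) : ℂ) = x i := by
    intro i
    refine ⟨((Complex.arg (x i) / (2 * Real.pi) : ℝ) : AddCircle (1 : ℝ)), ?_⟩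
    rw [AddCircle.toCircle_apply_mk, Circle.coe_exp]
    conv_rhs => rw [← Complex.norm_mul_exp_arg_mul_I (x i), hx i]
    have := Real.pi_ne_zero
    simp only [Complex.ofReal_one, one_mul]
    congr 2
    norm_cast
    field_simp
  choose u hu using h
  exact ⟨u, funext hu⟩

theorem eval_circlePoint (mu : Fin n → ℤ) (u : UnitAddTorus (Fin n)) :
    eval (AddMonoidAlgebra.single mu 1) (circlePoint u) = UnitAddTorus.mFourier mu u := by
  rw [eval_single, one_mul]
  simp [UnitAddTorus.mFourier, circlePoint, fourier_apply, AddCircle.toCircle_zsmul]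

/-- Fourier coefficients are integrals over the half-open unit cube. Scaling by `2π` and discarding
a null boundary relates them to `haarIntegral`. -/
theorem integral_circlePoint_eq_zero {G : (Fin n → ℂ) → ℂ} (h : haarIntegral G = 0) :
    ∫ x : Fin n → ℝ in {x | ∀ i, x i ∈ Set.Ioc ((0 : Fin n → ℝ) i) ((0 : Fin n → ℝ) i + 1)},
      G (circlePoint fun i => x i) = 0 := by
  have hpos : (0 : ℝ) < 2 * Real.pi := by positivity
  have h1 := Measure.setIntegral_comp_smul_of_pos (volume : Measure (Fin n → ℝ))
    (fun θ => G (torusMap 0 (fun _ => 1) θ))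
    {x | ∀ i, x i ∈ Set.Ioc ((0 : Fin n → ℝ) i) ((0 : Fin n → ℝ) i + 1)} hpos
  have hset : (2 * Real.pi) • {x : Fin n → ℝ | ∀ i, x i ∈ Set.Ioc ((0 : Fin n → ℝ) i)
      ((0 : Fin n → ℝ) i + 1)} = Set.pi Set.univ fun _ => Set.Ioc 0 (2 * Real.pi) := by
    ext x
    rw [Set.mem_smul_set_iff_inv_smul_mem₀ hpos.ne']
    simp only [Set.mem_ofPred_eq, Pi.smul_apply, smul_eq_mul, Pi.zero_apply, zero_add,
      Set.mem_Ioc, Set.mem_pi, Set.mem_univ, true_imp_iff]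
    refine forall_congr' fun i => and_congr ?_ ?_
    · exact mul_pos_iff_of_pos_left (by positivity)
    · rw [inv_mul_le_iff₀ hpos, mul_one]
  have hae : (Set.pi Set.univ fun _ : Fin n => Set.Ioc 0 (2 * Real.pi))
      =ᵐ[volume] Set.Icc (0 : Fin n → ℝ) fun _ => 2 * Real.pi :=
    Measure.univ_pi_Ioc_ae_eq_Icc
  rw [hset, setIntegral_congr_set hae] at h1
  unfold haarIntegral at h
  rw [h, smul_zero] at h1
  rw [← h1]
  congr 1
  funext x
  congr 1
  funext i
  simp only [circlePoint, AddCircle.toCircle_apply_mk, Circle.coe_exp, torusMap]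
  simp

/-- All Fourier coefficients vanish, hence are summable, so the zero Fourier series converges to `Ψ`
at every point. -/
theorem eq_zero_of_haarIntegral_eq_zero {Ψ : (Fin n → ℂ) → ℂ} (hΨ : ContinuousOn Ψ (torus n))
    (h : ∀ f : Laurent n, haarIntegral (fun x => eval f x * Ψ x) = 0) :
    ∀ x ∈ torus n, Ψ x = 0 := by
  let Φ : C(UnitAddTorus (Fin n), ℂ) :=
    ⟨fun u => Ψ (circlePoint u), hΨ.comp_continuous continuous_circlePoint circlePoint_mem⟩
  have hcoef : UnitAddTorus.mFourierCoeff Φ = 0 := by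
    funext mu
    rw [UnitAddTorus.mFourierCoeff_eq_integral _ _ (0 : Fin n → ℝ)]
    have := integral_circlePoint_eq_zero (h (AddMonoidAlgebra.single (-mu) 1))
    simp only [eval_circlePoint] at this
    exact this
  intro x hx
  obtain ⟨u, rfl⟩ := exists_circlePoint hx
  have hs := UnitAddTorus.hasSum_mFourier_series_apply_of_summable (f := Φ)
    (by rw [hcoef]; exact summable_zero) u
  rw [hcoef] at hs
  simp only [Pi.zero_apply, zero_smul] at hs
  exact hs.unique hasSum_zero

theorem eq_zero_of_eval_eq_zero {p : Laurent n} (h : ∀ x ∈ torus n, eval p x = 0) : p = 0 := by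
  have hli := (UnitAddTorus.orthonormal_mFourier (d := Fin n)).linearIndependent
  rw [linearIndependent_iff] at hli
  have h0 : p.coeff.sum (fun mu c => c • UnitAddTorus.mFourier mu) = 0 := by
    ext u
    have h1 := h _ (circlePoint_mem u)
    rw [eval_eq_sum] at h1
    rw [Finsupp.sum, ContinuousMap.coe_sum, Finset.sum_apply]
    refine Eq.trans (Finset.sum_congr rfl fun mu _ => ?_) h1
    have := eval_circlePoint mu u
    rw [eval_single, one_mul] at this
    rw [this]; rfl
  have h2 := hli p.coeff (by
    rw [Finsupp.linearCombination_apply]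
    simp only [UnitAddTorus.mFourierLp, ← map_smul]
    rw [← map_finsuppSum, h0, map_zero])
  exact AddMonoidAlgebra.coeff_eq_zero.1 h2

/-! ### The bilinear form with weight `Δ` -/

/-- The bilinear form `(f, h) ↦ ∫ f h Δ` on Laurent polynomials. -/
def weightForm (t : Multiplicity n) (r : ℂˣ) (f h : Laurent n) : ℂ :=
  haarIntegral fun x => eval f x * eval h x * Delta t r x

theorem continuousOn_Delta {t : Multiplicity n} {r : ℂˣ} (h : Admissible t r) :
    ContinuousOn (Delta t r) (torus n) := by
  refine (continuousOn_cofactor h 0 isCompact_torus (torus_subset_collar h.norm_lt_one)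
    (Or.inr subset_rfl)).congr fun x _ => Delta_eq_cofactor t r x

theorem continuousOn_eval_torus (f : Laurent n) : ContinuousOn (eval f) (torus n) :=
  continuousOn_eval f fun _ hx => ne_zero_of_mem_torus hx

theorem continuousOn_weightForm {t : Multiplicity n} {r : ℂˣ} (h : Admissible t r)
    (f g : Laurent n) : ContinuousOn (fun x => eval f x * eval g x * Delta t r x) (torus n) :=
  ((continuousOn_eval_torus f).mul (continuousOn_eval_torus g)).mul (continuousOn_Delta h)

theorem weightForm_comm (t : Multiplicity n) (r : ℂˣ) (f g : Laurent n) :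
    weightForm t r f g = weightForm t r g f := by
  simp only [weightForm, mul_comm (eval f _)]

theorem weightForm_add_left {t : Multiplicity n} {r : ℂˣ} (h : Admissible t r)
    (f f' g : Laurent n) :
    weightForm t r (f + f') g = weightForm t r f g + weightForm t r f' g := by
  rw [weightForm, weightForm, weightForm,
    ← haarIntegral_add (continuousOn_weightForm h f g) (continuousOn_weightForm h f' g)]
  refine haarIntegral_congr fun x hx => ?_
  rw [eval_add _ _ (ne_zero_of_mem_torus hx)]; ring

theorem weightForm_smul_left (t : Multiplicity n) (r : ℂˣ) (c : ℂ) (f g : Laurent n) :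
    weightForm t r (c • f) g = c * weightForm t r f g := by
  rw [weightForm, weightForm, ← haarIntegral_const_mul]
  refine haarIntegral_congr fun x hx => ?_
  rw [eval_smul _ _ (ne_zero_of_mem_torus hx)]; ring

theorem weightForm_add_right {t : Multiplicity n} {r : ℂˣ} (h : Admissible t r)
    (f g g' : Laurent n) :
    weightForm t r f (g + g') = weightForm t r f g + weightForm t r f g' := by
  simp only [weightForm_comm t r f, weightForm_add_left h]

theorem weightForm_smul_right (t : Multiplicity n) (r : ℂˣ) (c : ℂ) (f g : Laurent n) :
    weightForm t r f (c • g) = c * weightForm t r f g := by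
  simp only [weightForm_comm t r f, weightForm_smul_left]

theorem weightForm_mul_left (t : Multiplicity n) (r : ℂˣ) (p f g : Laurent n) :
    weightForm t r (p * f) g = weightForm t r f (p * g) := by
  refine haarIntegral_congr fun x hx => ?_
  rw [eval_mul _ _ (ne_zero_of_mem_torus hx), eval_mul _ _ (ne_zero_of_mem_torus hx)]; ring

/-- On the unit torus `dx_j / x_j = i dθ_j`, which leaves the constant `iⁿ`. -/
theorem torusPairing_eq (t : Multiplicity n) (r : ℂˣ) (f g : Laurent n) :
    torusPairing t r f g = 1 / (2 * (Real.pi : ℂ) * Complex.I) ^ n *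
      (Complex.I ^ n * weightForm t r f (longestAct g)) := by
  rw [torusPairing, torusIntegral, weightForm, ← haarIntegral_const_mul]
  congr 2
  funext θ
  have hx := torusMap_mem θ
  rw [integrand, smul_eq_mul, Finset.prod_mul_distrib, Finset.prod_const, Finset.card_univ,
    Fintype.card_fin, Finset.prod_inv_distrib]
  have h1 : ∏ i, (((1 : ℝ) : ℂ) * Complex.exp ((θ i : ℂ) * Complex.I))
      = ∏ i, torusMap 0 (fun _ => 1) θ i := by simp [torusMap]
  have h2 : ∏ i, torusMap 0 (fun _ => 1) θ i ≠ 0 :=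
    Finset.prod_ne_zero_iff.2 fun i _ => ne_zero_of_mem_torus hx i
  rw [h1]
  field_simp

theorem torusIntegrable_integrand {t : Multiplicity n} {r : ℂˣ} (h : Admissible t r)
    (f g : Laurent n) :
    TorusIntegrable (integrand t r f g) (0 : Fin n → ℂ) (fun _ => (1 : ℝ)) := by
  refine integrableOn_comp_torusMap ((continuousOn_weightForm h f (longestAct g)).mul ?_)
  exact continuousOn_finsetProd _ fun i _ =>
    (continuous_apply i).continuousOn.inv₀ fun x hx => ne_zero_of_mem_torus hx i

/-! ### Nondegeneracy -/

theorem norm_eval_mono {r : ℂˣ} (β : AffWeight n) {x : Fin n → ℂ} (hx : x ∈ torus n) :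
    ‖eval (mono r β) x‖ = ‖(r : ℂ)‖ ^ β.2 := by
  simp [eval_mono, hx _, norm_prod]

theorem posGradRoots_subset : posGradRoots n ⊆ posRoots n := fun _ h => Or.inl h

theorem finite_posGradRoots : (posGradRoots n).Finite := by
  refine ((Set.finite_Icc (fun _ => -2 : Fin n → ℤ) (fun _ => 2)).prod
    (Set.finite_singleton (0 : ℤ))).subset fun β hβ => ⟨?_, ?_⟩
  · exact abs_le_two_of_mem_redRoots ((mem_posRoots_iff β).1 (posGradRoots_subset hβ)).1
  · rcases hβ with ⟨i, rfl⟩ | ⟨i, j, s, hij, rfl⟩ <;> rfl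

/-- A factor vanishes only where `x^β = 1`. For roots of positive level `|x^β|` is a positive power
of `|r| < 1`, so only the finitely many gradient roots matter. -/
theorem Delta_ne_zero {t : Multiplicity n} {r : ℂˣ} (h : Admissible t r) {x : Fin n → ℂ}
    (hx : x ∈ torus n) (hx1 : ∀ β ∈ posGradRoots n, eval (mono r β) x ≠ 1) :
    Delta t r x ≠ 0 := by
  classical
  rw [Delta_eq_cofactor]
  refine tprod_one_add_ne_zero_of_summable (fun β => ?_) (summable_deviation h 0 hx)
  unfold deviation
  split_ifs with hβ
  · rw [add_sub_cancel, inv_v t r β (ne_zero_of_mem_torus hx)]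
    refine div_ne_zero (sub_ne_zero.2 fun he => ?_)
      (vNum_ne_zero h hβ.1 (torus_subset_collar h.norm_lt_one hx) (Or.inr hx))
    rcases hβ.1 with hg | ⟨-, hpos⟩
    · exact hx1 β hg he.symm
    · have h1 := norm_eval_mono (r := r) β hx
      rw [← he, norm_one] at h1
      obtain ⟨k, hk⟩ := Int.eq_ofNat_of_zero_le hpos.le
      rw [hk, zpow_natCast] at h1
      exact (pow_lt_one₀ (norm_nonneg _) h.norm_lt_one (by omega)).ne' h1
  · simp

theorem eq_zero_of_weightForm_eq_zero {t : Multiplicity n} {r : ℂˣ} (h : Admissible t r)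
    {g : Laurent n} (hg : ∀ f, weightForm t r f g = 0) : g = 0 := by
  have h1 := eq_zero_of_haarIntegral_eq_zero (Ψ := fun x => eval g x * Delta t r x)
    ((continuousOn_eval_torus g).mul (continuousOn_Delta h)) (fun f => by
      rw [← hg f]; exact haarIntegral_congr fun x _ => by ring)
  -- The binomials kill the locus where `Δ` may vanish; since Laurent polynomials form a domain,
  -- they can be cancelled afterwards.
  have h2 : g * ∏ β ∈ (finite_posGradRoots (n := n)).toFinset, (1 - mono r β) = 0 := by
    refine eq_zero_of_eval_eq_zero fun x hx => ?_
    have hx0 := ne_zero_of_mem_torus hx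
    rw [eval_mul _ _ hx0, ← evalHom_apply x hx0 (∏ β ∈ _, _), map_prod]
    by_cases hx1 : ∀ β ∈ posGradRoots n, eval (mono r β) x ≠ 1
    · rw [(mul_eq_zero.1 (h1 x hx)).resolve_right (Delta_ne_zero h hx hx1), zero_mul]
    · push Not at hx1
      obtain ⟨β, hβ, he⟩ := hx1
      rw [Finset.prod_eq_zero ((finite_posGradRoots).mem_toFinset.2 hβ), mul_zero]
      rw [map_sub, map_one, evalHom_apply, he, sub_self]
  refine (mul_eq_zero.1 h2).resolve_right (Finset.prod_ne_zero_iff.2 fun β hβ => ?_)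
  have hβ' := posGradRoots_subset ((finite_posGradRoots).mem_toFinset.1 hβ)
  exact one_sub_mono_ne_zero r (fst_ne_zero ((mem_posRoots_iff β).1 hβ').1.1)

/-! ### The operators `T_i` are self-adjoint -/

/-- The integrand contains the cofactor of `a_i` rather than `Δ` because for `i = 0` the contour
must cross the annulus without meeting the poles of `v_{a_0}⁻¹`. -/
theorem haarIntegral_comp_reflPoint {t : Multiplicity n} {r : ℂˣ} (h : Admissible t r) {q : ℝ}
    (hq0 : 0 < q) (hq1 : q < 1) (hr : (r : ℂ) ^ 2 = q) (i : Fin (n + 1)) (f g : Laurent n) :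
    haarIntegral (fun x => (fun y => eval f y * eval g y * cofactor t r (simpleRoot n i) y)
        (reflPoint r (simpleRoot n i) x))
      = haarIntegral fun x => eval f x * eval g x * cofactor t r (simpleRoot n i) x := by
  have hn := h.two_le
  by_cases h0 : i = 0
  · subst h0
    have hi0 : ((⟨0, by omega⟩ : Fin n) : ℕ) = 0 := rfl
    simp only [reflPoint_simpleRoot_zero r _ hi0]
    refine haarIntegral_shift hq0 hq1 hr ⟨0, by omega⟩ hi0
      (G := fun y => eval f y * eval g y * cofactor t r (simpleRoot n 0) y) ?_ fun x hx => ?_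
    · have hc : ∀ x ∈ collar n r, ∀ i, x i ≠ 0 := fun x hx => ne_zero_of_mem_collar hx
      exact ((continuousOn_eval f hc).mul (continuousOn_eval g hc)).mul
        (continuousOn_cofactor h _ (isCompact_collar r) subset_rfl (Or.inl rfl))
    · have hρ : ‖(r : ℂ)‖ ^ 2 = q := by
        rw [← norm_pow, hr, Complex.norm_real, Real.norm_of_nonneg hq0.le]
      have hopen : IsOpen {z : ℂ | q < ‖z‖ ∧ ‖z‖ < 1} :=
        (isOpen_lt continuous_const continuous_norm).inter
          (isOpen_lt continuous_norm continuous_const)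
      have hev : ∀ p : Laurent n, DifferentiableOn ℂ
          (fun z => eval p (Function.update x ⟨0, by omega⟩ z)) {z | q < ‖z‖ ∧ ‖z‖ < 1} :=
        fun p z hz => (differentiableAt_eval_update p x _
          (norm_pos_iff.1 (hq0.trans hz.1))).differentiableWithinAt
      refine ((hev f).mul (hev g)).mul (differentiableOn_cofactor_update h _ x hopen ?_)
      intro z hz j
      by_cases hj : j = ⟨0, by omega⟩
      · subst hj
        simp only [Function.update_self, if_true, hρ]
        exact ⟨hz.2.le, hz.1.le⟩
      · have hj' : ¬ ((j : ℕ) = 0) := fun h => hj (Fin.ext h)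
        rw [Function.update_of_ne hj, if_neg hj', hx j]
        exact ⟨le_rfl, le_rfl⟩
  have hcont : ContinuousOn (fun y => eval f y * eval g y * cofactor t r (simpleRoot n i) y)
      (torus n) :=
    ((continuousOn_eval_torus f).mul (continuousOn_eval_torus g)).mul
      (continuousOn_cofactor h _ isCompact_torus (torus_subset_collar h.norm_lt_one)
        (Or.inr subset_rfl))
  by_cases hl : i = Fin.last n
  · subst hl
    have h1 : ((⟨n - 1, by omega⟩ : Fin n) : ℕ) + 1 = n := by simp only; omega
    simp only [reflPoint_simpleRoot_last r _ h1]
    exact haarIntegral_comp_inv hcont _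
  · have hi0 : (i : ℕ) ≠ 0 := fun h => h0 (Fin.ext h)
    have hin : (i : ℕ) ≠ n := fun h => hl (Fin.ext h)
    simp only [reflPoint_simpleRoot_mid r i h0 hl ⟨i - 1, by omega⟩ ⟨i, by omega⟩
      (by simp only; omega) rfl]
    exact haarIntegral_comp_perm
      (fun y => eval f y * eval g y * cofactor t r (simpleRoot n i) y) _

theorem weightForm_T {t : Multiplicity n} {r : ℂˣ} (h : Admissible t r) {q : ℝ}
    (hq0 : 0 < q) (hq1 : q < 1) (hr : (r : ℂ) ^ 2 = q) (i : Fin (n + 1)) (f g : Laurent n) :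
    weightForm t r (T t r i f) g = weightForm t r f (T t r i g) := by
  have hn := h.two_le
  have ha := simpleRoot_mem hn i
  set a := simpleRoot n i with hadef
  have hcof : ContinuousOn (cofactor t r a) (torus n) :=
    continuousOn_cofactor h _ isCompact_torus (torus_subset_collar h.norm_lt_one)
      (Or.inr subset_rfl)
  -- The terms without `s_i` multiply `p` by a fixed function, so they cancel in `(T_i f) g - f (T_i
  -- g)`.
  have hTD : ∀ p : Laurent n, ∀ x ∈ torus n, eval (T t r i p) x * Delta t r x =
      ((1 - eval (mono r a) x) / eval (vNum t r a) x * ((tpar t i : ℂ) * eval p x) +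
        (((tpar t i)⁻¹ : ℂˣ) : ℂ) * (eval (reflAct r a p) x - eval p x)) * cofactor t r a x := by
    intro p x hx
    have hx0 := ne_zero_of_mem_torus hx
    have hV : eval (vNum t r a) x ≠ 0 := vNum_ne_zero h (simpleRoot_mem_posRoots hn i)
      (torus_subset_collar h.norm_lt_one hx) (Or.inr hx)
    have h1 := congrArg (fun p => eval p x) (one_sub_mono_mul_T t r i p)
    simp only [eval_mul _ _ hx0, eval_add _ _ hx0, eval_sub _ _ hx0, eval_smul _ _ hx0,
      eval_one, ← hadef] at h1
    rw [Delta_eq_mul_cofactor h (simpleRoot_mem_posRoots hn i) hx, ← hadef, inv_v t r a hx0,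
      ← mul_assoc]
    congr 1
    field_simp
    linear_combination h1
  rw [← sub_eq_zero, weightForm, weightForm,
    ← haarIntegral_sub (continuousOn_weightForm h _ _) (continuousOn_weightForm h _ _)]
  have hinv := haarIntegral_comp_reflPoint h hq0 hq1 hr i f (reflAct r a g)
  have hG : ∀ x ∈ torus n, eval f (reflPoint r a x) * eval (reflAct r a g) (reflPoint r a x) *
      cofactor t r a (reflPoint r a x)
      = eval (reflAct r a f) x * eval g x * cofactor t r a x := by
    intro x hx
    have hx0 := ne_zero_of_mem_torus hx
    rw [cofactor_reflPoint hn t r i hx0, ← eval_reflAct r ha f hx0, ← eval_reflAct r ha _ hx0,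
      ← reflHom_apply r ha (reflAct r a g), ← reflHom_apply r ha g, reflHom_reflHom]
  rw [haarIntegral_congr hG, ← sub_eq_zero, ← haarIntegral_sub
    (G := fun x => eval (reflAct r a f) x * eval g x * cofactor t r a x)
    (H := fun x => eval f x * eval (reflAct r a g) x * cofactor t r a x)
    (((continuousOn_eval_torus _).mul (continuousOn_eval_torus _)).mul hcof)
    (((continuousOn_eval_torus _).mul (continuousOn_eval_torus _)).mul hcof)] at hinv
  rw [← mul_zero (((tpar t i)⁻¹ : ℂˣ) : ℂ), ← hinv, ← haarIntegral_const_mul]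
  refine haarIntegral_congr fun x hx => ?_
  linear_combination eval g x * hTD f x hx - eval f x * hTD g x hx

/-! ### The anti-isomorphism -/

/-- `X` and `Y` are adjoint with respect to the pairing. -/
def AreAdjoint (t : Multiplicity n) (r : ℂˣ) (X Y : Module.End ℂ (Laurent n)) : Prop :=
  ∀ f g, weightForm t r (X f) (longestHom g) = weightForm t r f (longestHom (Y g))

namespace AreAdjoint

variable {t : Multiplicity n} {r : ℂˣ} {X X' Y Y' : Module.End ℂ (Laurent n)}

theorem add (h : Admissible t r) (h1 : AreAdjoint t r X Y) (h2 : AreAdjoint t r X' Y') :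
    AreAdjoint t r (X + X') (Y + Y') := fun f g => by
  rw [LinearMap.add_apply, LinearMap.add_apply, map_add, weightForm_add_left h,
    weightForm_add_right h, h1, h2]

theorem mul (h1 : AreAdjoint t r X Y) (h2 : AreAdjoint t r X' Y') :
    AreAdjoint t r (X * X') (Y' * Y) := fun f g => by
  rw [Module.End.mul_apply, Module.End.mul_apply, h1, h2]

theorem scalar (c : ℂ) : AreAdjoint t r (algebraMap ℂ _ c) (algebraMap ℂ _ c) := fun f g => by
  rw [Module.algebraMap_end_apply, Module.algebraMap_end_apply, map_smul, weightForm_smul_left,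
    weightForm_smul_right]

theorem mulLeft (p : Laurent n) :
    AreAdjoint t r (LinearMap.mulLeft ℂ p) (LinearMap.mulLeft ℂ (longestHom p)) := fun f g => by
  rw [LinearMap.mulLeft_apply, LinearMap.mulLeft_apply, map_mul, longestHom_longestHom,
    weightForm_mul_left]

theorem operator (h : Admissible t r) {q : ℝ} (hq0 : 0 < q) (hq1 : q < 1) (hr : (r : ℂ) ^ 2 = q)
    (i : Fin (n + 1)) : AreAdjoint t r (T t r i) (T t.inverse r⁻¹ i +
      algebraMap ℂ _ ((tpar t i : ℂ) - (tpar t i : ℂ)⁻¹)) := fun f g => by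
  rw [weightForm_T h hq0 hq1 hr, LinearMap.add_apply, Module.algebraMap_end_apply,
    ← longestHom_T h.two_le, longestHom_longestHom]

theorem unique_right (h : Admissible t r) (h1 : AreAdjoint t r X Y) (h2 : AreAdjoint t r X Y') :
    Y = Y' := by
  refine LinearMap.ext fun g => ?_
  have h3 : longestHom (Y g) + (-1 : ℂ) • longestHom (Y' g) = 0 :=
    eq_zero_of_weightForm_eq_zero h fun f => by
      rw [weightForm_add_right h, weightForm_smul_right, ← h1, ← h2]; ring
  rw [neg_one_smul, ← sub_eq_add_neg, sub_eq_zero] at h3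
  rw [← longestHom_longestHom (Y g), h3, longestHom_longestHom]

/-- Nondegeneracy in the other argument, available because the form is symmetric; it yields
injectivity of the adjoint map. -/
theorem unique_left (h : Admissible t r) (h1 : AreAdjoint t r X Y) (h2 : AreAdjoint t r X' Y) :
    X = X' := by
  refine LinearMap.ext fun f => ?_
  have h3 : X f + (-1 : ℂ) • X' f = 0 :=
    eq_zero_of_weightForm_eq_zero h fun g => by
      rw [weightForm_add_right h, weightForm_smul_right, weightForm_comm, weightForm_comm t r g,
        ← longestHom_longestHom g, h1, h2]; ring
  rwa [neg_one_smul, ← sub_eq_add_neg, sub_eq_zero] at h3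

end AreAdjoint

/-! ### Adjoints inside the two Hecke algebras. -/

theorem T_mem (t : Multiplicity n) (r : ℂˣ) (i : Fin (n + 1)) : T t r i ∈ DAHA t r :=
  Algebra.subset_adjoin (Or.inl ⟨i, rfl⟩)

theorem mulLeft_mem (t : Multiplicity n) (r : ℂˣ) (p : Laurent n) :
    LinearMap.mulLeft ℂ p ∈ DAHA t r :=
  Algebra.subset_adjoin (Or.inr ⟨p, rfl⟩)

theorem exists_adjoint {t : Multiplicity n} {r : ℂˣ} (h : Admissible t r) {q : ℝ}
    (hq0 : 0 < q) (hq1 : q < 1) (hr : (r : ℂ) ^ 2 = q) {X : Module.End ℂ (Laurent n)}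
    (hX : X ∈ DAHA t r) : ∃ Y ∈ DAHA t.inverse r⁻¹, AreAdjoint t r X Y := by
  induction hX using Algebra.adjoin_induction with
  | mem X hX =>
    rcases hX with ⟨i, rfl⟩ | ⟨p, rfl⟩
    · exact ⟨_, add_mem (T_mem _ _ i) (Subalgebra.algebraMap_mem _ _),
        AreAdjoint.operator h hq0 hq1 hr i⟩
    · exact ⟨_, mulLeft_mem _ _ _, AreAdjoint.mulLeft p⟩
  | algebraMap c => exact ⟨_, Subalgebra.algebraMap_mem _ _, AreAdjoint.scalar c⟩
  | add X X' _ _ h1 h2 =>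
    obtain ⟨Y, hY, h1⟩ := h1
    obtain ⟨Y', hY', h2⟩ := h2
    exact ⟨_, add_mem hY hY', h1.add h h2⟩
  | mul X X' _ _ h1 h2 =>
    obtain ⟨Y, hY, h1⟩ := h1
    obtain ⟨Y', hY', h2⟩ := h2
    exact ⟨_, mul_mem hY' hY, h1.mul h2⟩

/-- Needed for surjectivity: `T_i'` is the adjoint of `T_i - (t_i - t_i⁻¹)`, and multiplication by
`p` that of multiplication by `σp`. -/
theorem exists_adjoint_left {t : Multiplicity n} {r : ℂˣ} (h : Admissible t r) {q : ℝ}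
    (hq0 : 0 < q) (hq1 : q < 1) (hr : (r : ℂ) ^ 2 = q) {Y : Module.End ℂ (Laurent n)}
    (hY : Y ∈ DAHA t.inverse r⁻¹) : ∃ X ∈ DAHA t r, AreAdjoint t r X Y := by
  induction hY using Algebra.adjoin_induction with
  | mem Y hY =>
    rcases hY with ⟨i, rfl⟩ | ⟨p, rfl⟩
    · refine ⟨_, add_mem (T_mem t r i) (Subalgebra.algebraMap_mem _
        (-((tpar t i : ℂ) - (tpar t i : ℂ)⁻¹))), ?_⟩
      have := (AreAdjoint.operator h hq0 hq1 hr i).add h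
        (AreAdjoint.scalar (-((tpar t i : ℂ) - (tpar t i : ℂ)⁻¹)))
      rwa [add_assoc, ← map_add, add_neg_cancel, map_zero, add_zero] at this
    · refine ⟨_, mulLeft_mem t r (longestHom p), ?_⟩
      have := AreAdjoint.mulLeft (t := t) (r := r) (longestHom p)
      rwa [longestHom_longestHom] at this
  | algebraMap c => exact ⟨_, Subalgebra.algebraMap_mem _ _, AreAdjoint.scalar c⟩
  | add Y Y' _ _ h1 h2 =>
    obtain ⟨X, hX, h1⟩ := h1
    obtain ⟨X', hX', h2⟩ := h2
    exact ⟨_, add_mem hX hX', h1.add h h2⟩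
  | mul Y Y' _ _ h1 h2 =>
    obtain ⟨X, hX, h1⟩ := h1
    obtain ⟨X', hX', h2⟩ := h2
    exact ⟨_, mul_mem hX' hX, h2.mul h1⟩

/-- Linearity and antimultiplicativity hold because both sides of each identity are adjoint to the
same operator, and adjoints are unique. -/
theorem exists_adjointEquiv {t : Multiplicity n} {r : ℂˣ} (h : Admissible t r) {q : ℝ}
    (hq0 : 0 < q) (hq1 : q < 1) (hr : (r : ℂ) ^ 2 = q) :
    ∃ φ : DAHA t r ≃ₐ[ℂ] (DAHA t.inverse r⁻¹)ᵐᵒᵖ, ∀ X : DAHA t r, AreAdjoint t r X (φ X).unop := by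
  choose Y hY hadj using fun X : DAHA t r => exists_adjoint h hq0 hq1 hr X.2
  let φ : DAHA t r →ₐ[ℂ] (DAHA t.inverse r⁻¹)ᵐᵒᵖ :=
    AlgHom.ofLinearMap
      { toFun := fun X => MulOpposite.op ⟨Y X, hY X⟩
        map_add' := fun X X' => MulOpposite.unop_injective (Subtype.ext
          ((hadj (X + X')).unique_right h ((hadj X).add h (hadj X'))))
        map_smul' := fun c X => MulOpposite.unop_injective (Subtype.ext
          ((hadj (c • X)).unique_right h fun f g => by
            simp only [SetLike.val_smul, LinearMap.smul_apply, RingHom.id_apply,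
              MulOpposite.unop_smul, map_smul, weightForm_smul_left, weightForm_smul_right]
            rw [hadj X]; rfl)) }
      (MulOpposite.unop_injective (Subtype.ext
        ((hadj 1).unique_right h fun f g => rfl)))
      fun X X' => MulOpposite.unop_injective (Subtype.ext
        ((hadj (X * X')).unique_right h ((hadj X).mul (hadj X'))))
  have hφ : Function.Bijective φ := by
    constructor
    · intro X X' he
      have he' : Y X = Y X' := congrArg (fun Z => (MulOpposite.unop Z).1) he
      exact Subtype.ext ((hadj X).unique_left h (he' ▸ hadj X'))
    · intro Z
      obtain ⟨X, hX, hXZ⟩ := exists_adjoint_left h hq0 hq1 hr Z.unop.2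
      exact ⟨⟨X, hX⟩, MulOpposite.unop_injective (Subtype.ext
        ((hadj ⟨X, hX⟩).unique_right h hXZ))⟩
  exact ⟨AlgEquiv.ofBijective φ hφ, hadj⟩

theorem isDoubleDagger_of_areAdjoint {t : Multiplicity n} {r : ℂˣ} (h : Admissible t r) {q : ℝ}
    (hq0 : 0 < q) (hq1 : q < 1) (hr : (r : ℂ) ^ 2 = q)
    {φ : DAHA t r ≃ₐ[ℂ] (DAHA t.inverse r⁻¹)ᵐᵒᵖ} (hφ : ∀ X : DAHA t r, AreAdjoint t r X (φ X).unop) :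
    IsDoubleDagger t r φ := by
  refine ⟨fun i => ?_, fun j => ?_⟩
  · have h1 : ((φ (genT t r i)).unop : Module.End ℂ (Laurent n)) = T t.inverse r⁻¹ i +
        algebraMap ℂ _ ((tpar t i : ℂ) - (tpar t i : ℂ)⁻¹) :=
      (hφ (genT t r i)).unique_right h (AreAdjoint.operator h hq0 hq1 hr i)
    -- The quadratic relation at parameter `t_i⁻¹`, rearranged to exhibit `T_i' + t_i - t_i⁻¹` as
    -- the inverse of `T_i'`.
    have h2 : T t.inverse r⁻¹ i * T t.inverse r⁻¹ i + ((tpar t i : ℂ) - (tpar t i : ℂ)⁻¹) •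
        T t.inverse r⁻¹ i = 1 := by
      refine LinearMap.ext fun f => ?_
      have h3 := T_mul_T_sub h.two_le t.inverse r⁻¹ i f
      have h5 : (tpar t.inverse i : ℂ) = (tpar t i : ℂ)⁻¹ := by
        rw [← Units.val_inv_eq_inv_val]; rfl
      rw [h5, inv_inv] at h3
      rw [LinearMap.add_apply, Module.End.mul_apply, h3, LinearMap.smul_apply,
        Module.End.one_apply]
      module
    constructor <;> apply Subtype.ext
    · change ((φ (genT t r i)).unop : Module.End ℂ (Laurent n)) * T t.inverse r⁻¹ i = 1
      rw [h1, add_mul, ← Algebra.smul_def, h2]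
    · change T t.inverse r⁻¹ i * ((φ (genT t r i)).unop : Module.End ℂ (Laurent n)) = 1
      rw [h1, mul_add, ← Algebra.commutes, ← Algebra.smul_def, h2]
  · have h1 : ((φ (genZ t r j)).unop : Module.End ℂ (Laurent n))
        = LinearMap.mulLeft ℂ (AddMonoidAlgebra.single (-eps j) 1) := by
      rw [(hφ (genZ t r j)).unique_right h (AreAdjoint.mulLeft _)]
      simp [longestHom]
    have h2 : ∀ mu nu : Fin n → ℤ, mu + nu = 0 →
        (LinearMap.mulLeft ℂ (AddMonoidAlgebra.single mu 1) : Module.End ℂ (Laurent n)) *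
          LinearMap.mulLeft ℂ (AddMonoidAlgebra.single nu 1) = 1 := by
      intro mu nu hmn
      rw [Module.End.mul_eq_comp, ← LinearMap.mulLeft_mul, AddMonoidAlgebra.single_mul_single, hmn, one_mul,
        ← AddMonoidAlgebra.one_def, LinearMap.mulLeft_one]
      rfl
    constructor <;> apply Subtype.ext
    · change ((φ (genZ t r j)).unop : Module.End ℂ (Laurent n)) *
        LinearMap.mulLeft ℂ (AddMonoidAlgebra.single (eps j) 1) = 1
      rw [h1, h2 _ _ (neg_add_cancel _)]
    · change LinearMap.mulLeft ℂ (AddMonoidAlgebra.single (eps j) 1) *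
        ((φ (genZ t r j)).unop : Module.End ℂ (Laurent n)) = 1
      rw [h1, h2 _ _ (add_neg_cancel _)]

/-! ### Uniqueness of the anti-isomorphism. -/

/-- The embedding of the Laurent polynomials as multiplication operators. -/
def mulHom (t : Multiplicity n) (r : ℂˣ) : Laurent n →ₐ[ℂ] DAHA t r :=
  (Algebra.lmul ℂ (Laurent n)).codRestrict (DAHA t r) fun p => mulLeft_mem t r p

/-- The exponents on which the maps agree form a subgroup containing every `ε_j`; closure under
negation is the uniqueness of inverses. -/
theorem algHom_laurent_ext {A : Type*} [Semiring A] [Algebra ℂ A] {φ ψ : Laurent n →ₐ[ℂ] A}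
    (h : ∀ j, φ (AddMonoidAlgebra.single (eps j) 1) = ψ (AddMonoidAlgebra.single (eps j) 1)) :
    φ = ψ := by
  let S : AddSubgroup (Fin n → ℤ) :=
    { carrier := {mu | φ (AddMonoidAlgebra.single mu 1) = ψ (AddMonoidAlgebra.single mu 1)}
      zero_mem' := by
        change φ (AddMonoidAlgebra.single 0 1) = ψ (AddMonoidAlgebra.single 0 1)
        rw [← AddMonoidAlgebra.one_def, map_one, map_one]
      add_mem' := fun {mu nu} h1 h2 => by
        replace h1 : φ (AddMonoidAlgebra.single mu 1) = ψ (AddMonoidAlgebra.single mu 1) := h1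
        replace h2 : φ (AddMonoidAlgebra.single nu 1) = ψ (AddMonoidAlgebra.single nu 1) := h2
        change φ (AddMonoidAlgebra.single (mu + nu) 1) = ψ (AddMonoidAlgebra.single (mu + nu) 1)
        have : (AddMonoidAlgebra.single (mu + nu) 1 : Laurent n)
            = AddMonoidAlgebra.single mu 1 * AddMonoidAlgebra.single nu 1 := by
          rw [AddMonoidAlgebra.single_mul_single, one_mul]
        rw [this, map_mul, map_mul, h1, h2]
      neg_mem' := fun {mu} h1 => by
        replace h1 : φ (AddMonoidAlgebra.single mu 1) = ψ (AddMonoidAlgebra.single mu 1) := h1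
        change φ (AddMonoidAlgebra.single (-mu) 1) = ψ (AddMonoidAlgebra.single (-mu) 1)
        have e1 : (AddMonoidAlgebra.single (-mu) 1 * AddMonoidAlgebra.single mu 1 : Laurent n)
            = 1 := by
          rw [AddMonoidAlgebra.single_mul_single, one_mul, neg_add_cancel,
            AddMonoidAlgebra.one_def]
        refine left_inv_eq_right_inv (a := φ (AddMonoidAlgebra.single mu 1)) ?_ ?_
        · rw [← map_mul, e1, map_one]
        · rw [h1, ← map_mul, mul_comm, e1, map_one] }
  have hS : ∀ mu, mu ∈ S := by
    intro mu
    have : mu = ∑ j, mu j • eps j := by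
      funext k; simp [Finset.sum_apply, eps_apply]
    rw [this]
    exact sum_mem fun j _ => zsmul_mem (h j) _
  refine AlgHom.toLinearMap_injective
    ((AddMonoidAlgebra.basis (Fin n → ℤ) ℂ).ext fun mu => ?_)
  rw [AddMonoidAlgebra.basis_apply]
  exact hS mu

/-- The values on `T_i` and `z_j` are fixed as two-sided inverses. The values on all multiplication
operators follow from those on the `z_j`, and these operators generate together with the `T_i`. -/
theorem IsDoubleDagger.unique {t : Multiplicity n} {r : ℂˣ}
    {φ ψ : DAHA t r ≃ₐ[ℂ] (DAHA t.inverse r⁻¹)ᵐᵒᵖ} (hφ : IsDoubleDagger t r φ)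
    (hψ : IsDoubleDagger t r ψ) : φ = ψ := by
  have hmul : φ.toAlgHom.comp (mulHom t r) = ψ.toAlgHom.comp (mulHom t r) :=
    algHom_laurent_ext fun j => by
      have h1 : (φ (genZ t r j)).unop = (ψ (genZ t r j)).unop :=
        left_inv_eq_right_inv (hφ.2 j).1 (hψ.2 j).2
      exact MulOpposite.unop_injective h1
  have key : ∀ X (hX : X ∈ DAHA t r), φ ⟨X, hX⟩ = ψ ⟨X, hX⟩ := by
    intro X hX
    induction hX using Algebra.adjoin_induction with
    | mem X hX =>
      rcases hX with ⟨i, rfl⟩ | ⟨p, rfl⟩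
      · exact MulOpposite.unop_injective (left_inv_eq_right_inv (hφ.1 i).1 (hψ.1 i).2)
      · exact AlgHom.congr_fun hmul p
    | algebraMap c => exact (φ.commutes c).trans (ψ.commutes c).symm
    | add X X' hX hX' h1 h2 =>
      have h3 := map_add φ ⟨X, hX⟩ ⟨X', hX'⟩
      rw [h1, h2, ← map_add] at h3
      exact h3
    | mul X X' hX hX' h1 h2 =>
      have h3 := map_mul φ ⟨X, hX⟩ ⟨X', hX'⟩
      rw [h1, h2, ← map_mul] at h3
      exact h3
  exact AlgEquiv.ext fun X => key X.1 X.2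

end Koornwinder

end

/-! ### The main theorem. -/

theorem mainTheorem10 (n : ℕ) (hn : 2 ≤ n)
    (q : ℝ) (hq0 : 0 < q) (hq1 : q < 1) (r : ℂˣ) (hr : (r : ℂ) ^ 2 = (q : ℂ))
    (t : Koornwinder.Multiplicity n)
    (τ : ℝ) (hτ0 : 0 < τ) (hτ1 : τ < 1)
    (ht : ∀ i : Fin (n + 1), i ≠ 0 → i ≠ Fin.last n → (Koornwinder.tpar t i : ℂ) = (τ : ℂ))
    (ha : ‖(Koornwinder.tpar t 0 : ℂ) * (Koornwinder.tparDual t 0 : ℂ) * (r : ℂ)‖ < 1)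
    (hb : ‖-((Koornwinder.tpar t 0 : ℂ) * (Koornwinder.tparDual t 0 : ℂ)⁻¹ * (r : ℂ))‖ < 1)
    (hc : ‖(Koornwinder.tpar t (Fin.last n) : ℂ) *
      (Koornwinder.tparDual t (Fin.last n) : ℂ)‖ < 1)
    (hd : ‖-((Koornwinder.tpar t (Fin.last n) : ℂ) *
      (Koornwinder.tparDual t (Fin.last n) : ℂ)⁻¹)‖ < 1) :
    (∀ x : Fin n → ℂ, (∀ i, ‖x i‖ = 1) →
      Multipliable (fun β : Koornwinder.posRoots n => (Koornwinder.v t r β x)⁻¹)) ∧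
    (∀ f g : Koornwinder.Laurent n,
      TorusIntegrable (Koornwinder.integrand t r f g) (0 : Fin n → ℂ) (fun _ => (1 : ℝ))) ∧
    (∃! φ : Koornwinder.DAHA t r ≃ₐ[ℂ] (Koornwinder.DAHA t.inverse r⁻¹)ᵐᵒᵖ,
      Koornwinder.IsDoubleDagger t r φ) ∧
    (∀ φ : Koornwinder.DAHA t r ≃ₐ[ℂ] (Koornwinder.DAHA t.inverse r⁻¹)ᵐᵒᵖ,
      Koornwinder.IsDoubleDagger t r φ →
      ∀ (X : Koornwinder.DAHA t r) (f g : Koornwinder.Laurent n),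
        Koornwinder.torusPairing t r ((X : Module.End ℂ (Koornwinder.Laurent n)) f) g =
          Koornwinder.torusPairing t r f
            (((φ X).unop : Module.End ℂ (Koornwinder.Laurent n)) g)) := by
  have h : Koornwinder.Admissible t r := by
    refine ⟨hn, ?_, ?_, ?_, ?_, hc, by rwa [norm_neg] at hd⟩
    · have h1 : ‖(r : ℂ)‖ ^ 2 = q := by
        rw [← norm_pow, hr, Complex.norm_real, Real.norm_of_nonneg hq0.le]
      have := norm_nonneg (r : ℂ)
      nlinarith
    · rw [ht _ (by simp [Fin.ext_iff]) (by rw [Ne, Fin.ext_iff, Fin.val_last]; simp only; omega),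
        Complex.norm_real, Real.norm_of_nonneg hτ0.le]
      exact hτ1
    · rwa [norm_mul] at ha
    · rwa [norm_neg, norm_mul] at hb
  obtain ⟨φ, hφ⟩ := Koornwinder.exists_adjointEquiv h hq0 hq1 hr
  have hdd := Koornwinder.isDoubleDagger_of_areAdjoint h hq0 hq1 hr hφ
  refine ⟨fun x hx => Koornwinder.multipliable_factors h hx,
    Koornwinder.torusIntegrable_integrand h, ⟨φ, hdd, fun ψ hψ => hψ.unique hdd⟩,
    fun ψ hψ X f g => ?_⟩
  -- By uniqueness any such map is the adjoint map just constructed, for which the identity holds by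
  -- definition.
  rw [hψ.unique hdd, Koornwinder.torusPairing_eq, Koornwinder.torusPairing_eq,
    ← Koornwinder.longestHom_apply, ← Koornwinder.longestHom_apply, hφ X]
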